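/- Let $V$ be a finite-dimensional complex Hermitian vector space and $S^1=\mathbb{R}/2\pi\mathbb{Z}$. For $f\in C^\infty(S^1,V)$ let $\hat f(k)=\frac1{2\pi}\int_0^{2\pi}e^{-ikx}f(x)\,dx$. Let $PDO(S^1,V)$ be the set of linear operators $A$ on $C^\infty(S^1,V)$ of the form $$Af(x)=\sum_{k\in\mathbb{Z}}e^{ikx}\sigma(x,k)\hat f(k),$$ where, for some $m\in\mathbb{R}$ (of either sign), $\sigma\in C^\infty(S^1\times\mathbb{R},\mathrm{End}(V))$ is a symbol of order $m$, that is, for all $\alpha,\beta\in\mathbb{N}$ there is a constant $C$ with $\|\partial_\xi^\alpha\partial_x^\beta\sigma(x,\xi)\|\le C(1+|\xi|)^{m-\alpha}$ for all $(x,\xi)$; no expansion into homogeneous terms is required. Let $PDO^{-\infty}(S^1,V)$ be the set of smoothing operators, i.e. the operators $Af(x)=\int_{S^1}K(x,y)f(y)\,dy$ with $K\in C^\infty(S^1\times S^1,\mathrm{End}(V))$. Let $p=p_{E_+}$ be the projection $(pf)(x)=\sum_{k>0}e^{ikx}\hat f(k)$ onto the positive spectral subspace of $D=-i\frac{d}{dx}$.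 For operators $a,b,c$ put $\theta_a(c)=a\circ p\circ c$ and $$\Omega(a,b)=\theta_a\theta_b-\theta_b\theta_a-\theta_{[a,b]},\qquad [a,b]=a\circ b-b\circ a .$$ Then: 1. $PDO(S^1,V)$ is an algebra under composition (hence a Lie algebra under the commutator) and contains $p$; in particular $\theta_a$ maps $PDO(S^1,V)$ to itself for every $a\in PDO(S^1,V)$. 2. For all $a,b\in PDO(S^1,V)$ there is a smoothing operator, again denoted $\Omega(a,b)$, such that $\Omega(a,b)(c)=\Omega(a,b)\circ c$ for all $c$. 3. For every $k\ge1$ and all $x_1,\dots,x_{2k}\in PDO(S^1,V)$, the operator $\Omega(x_1,x_2)\circ\cdots\circ\Omega(x_{2k-1},x_{2k})$ is smoothing and extends to a trace-class operator on $L^2(S^1,V)$. With $\mathrm{tr}$ the ordinary trace of trace-class operators, let $$\mathrm{tr}(\Omega^k)(x_1,\dots,x_{2k})=\frac1{(2k)!}\sum_{s\in\mathfrak{S}_{2k}}\varepsilon(s)\,\mathrm{tr}\big(\Omega(x_{s(1)},x_{s(2)})\circ\cdots\circ\Omega(x_{s(2k-1)},x_{s(2k)})\big).$$ For every Lie subalgebra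 $\mathcal{A}\subseteq PDO(S^1,V)$, in particular for $\mathcal{A}=PDO(S^1,V)$, the restriction $\omega$ of $\mathrm{tr}(\Omega^k)$ to $\mathcal{A}$ is an alternating $2k$-linear form and a closed $2k$-cocycle of the Lie algebra $\mathcal{A}$ with values in $\mathbb{C}$: for all $x_0,\dots,x_{2k}\in\mathcal{A}$, $$\sum_{0\le i<j\le 2k}(-1)^{i+j}\,\omega\big([x_i,x_j],x_0,\dots,\widehat{x_i},\dots,\widehat{x_j},\dots,x_{2k}\big)=0 .$$ -/

import Mathlib

open scoped ContDiff

noncomputable section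

namespace PDOCocycle

/-! ### The circle and its smooth vector-valued functions -/

instance factTwoPiPos : Fact (0 < 2 * Real.pi) := ⟨Real.two_pi_pos⟩

/-- The circle `ℝ / 2πℤ`. -/
abbrev S1 : Type := AddCircle (2 * Real.pi)

/-- The functions on the circle whose lift to `ℝ` is smooth. -/
def smoothFunctions (V : Type*) [NormedAddCommGroup V] [InnerProductSpace ℂ V] : Submodule ℂ (S1 → V) where
  carrier := {f | ContDiff ℝ ∞ (fun x : ℝ => f (x : S1))}
  add_mem' := by
    intro f g hf hg
    rw [Set.mem_ofPred_eq] at hf hg ⊢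
    exact hf.add hg
  zero_mem' := by
    rw [Set.mem_ofPred_eq]
    exact contDiff_const
  smul_mem' := by
    intro c f hf
    rw [Set.mem_ofPred_eq] at hf ⊢
    exact contDiff_const.smul hf

/-- `C^∞(S¹, V)`. -/
def CInf (V : Type*) [NormedAddCommGroup V] [InnerProductSpace ℂ V] : Type _ :=
  smoothFunctions V

section CInfBasic

variable {V : Type*} [NormedAddCommGroup V] [InnerProductSpace ℂ V]

instance instAddCommGroupCInf : AddCommGroup (CInf V) :=
  inferInstanceAs (AddCommGroup (smoothFunctions V))

instance instModuleCInf : Module ℂ (CInf V) :=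
  inferInstanceAs (Module ℂ (smoothFunctions V))

instance instFunLikeCInf : FunLike (CInf V) S1 V where
  coe f := f.1
  coe_injective _ _ h := Subtype.ext h

/-- A function with smooth lift, as an element of `C^∞(S¹, V)`. -/
def CInf.mk (f : S1 → V) (hf : ContDiff ℝ ∞ (fun x : ℝ => f (x : S1))) : CInf V :=
  ⟨f, hf⟩

@[simp] theorem CInf.mk_apply (f : S1 → V) (hf) (x : S1) : CInf.mk f hf x = f x := rfl

@[ext] theorem CInf.ext {f g : CInf V} (h : ∀ x, f x = g x) : f = g := DFunLike.ext f g h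

@[simp] theorem CInf.coe_add (f g : CInf V) : ⇑(f + g) = ⇑f + ⇑g := rfl

@[simp] theorem CInf.coe_smul (c : ℂ) (f : CInf V) : ⇑(c • f) = c • ⇑f := rfl

theorem CInf.contDiff (f : CInf V) : ContDiff ℝ ∞ (fun x : ℝ => (f : S1 → V) (x : S1)) :=
  f.2

end CInfBasic

/-- Linear operators on `C^∞(S¹, V)`. -/
abbrev Op (V : Type*) [NormedAddCommGroup V] [InnerProductSpace ℂ V] : Type _ :=
  Module.End ℂ (CInf V)

section FourierDecay

variable {V : Type*} [NormedAddCommGroup V] [InnerProductSpace ℂ V]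

theorem CInf.continuous (f : CInf V) : Continuous (f : S1 → V) := by
  have h : Continuous (fun x : ℝ => (f : S1 → V) (x : S1)) := (CInf.contDiff f).continuous
  exact (QuotientAddGroup.isQuotientMap_mk (N := AddSubgroup.zmultiples (2 * Real.pi))).continuous_iff.2 h

theorem CInf.integrable (f : CInf V) :
    MeasureTheory.Integrable (f : S1 → V) AddCircle.haarAddCircle :=
  (CInf.continuous f).integrable_of_hasCompactSupport (HasCompactSupport.of_compactSpace _)

theorem fourier_two_pi (k : ℤ) (x : ℝ) :
    (fourier k (x : S1) : ℂ) = Complex.exp ((k * Complex.I) * x) := by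
  rw [fourier_coe_apply]
  congr 1
  have : (Real.pi : ℂ) ≠ 0 := by exact_mod_cast Real.pi_ne_zero
  push_cast
  field_simp

/-- Fourier coefficient (up to the factor `2π`) of a periodic function on the line. -/
def coeffR (g : ℝ → V) (k : ℤ) : V :=
  ∫ x in (0 : ℝ)..(2 * Real.pi), Complex.exp ((((-k : ℤ) : ℂ) * Complex.I) * x) • g x

theorem hasDerivAt_expR (a : ℂ) (x : ℝ) :
    HasDerivAt (fun x : ℝ => Complex.exp (a * x)) (a * Complex.exp (a * x)) x := by
  have h1 : HasDerivAt (fun z : ℂ => Complex.exp (a * z)) (Complex.exp (a * x) * (a * 1)) (x : ℂ) :=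
    ((hasDerivAt_id (x : ℂ)).const_mul a).cexp
  have := h1.comp_ofReal
  convert this using 1
  ring

theorem exp_periodic (k : ℤ) (x : ℝ) :
    Complex.exp (((k : ℂ) * Complex.I) * ((x + 2 * Real.pi : ℝ) : ℂ)) =
      Complex.exp (((k : ℂ) * Complex.I) * x) := by
  rw [Complex.exp_eq_exp_iff_exists_int]
  exact ⟨k, by push_cast; ring⟩

theorem coeffR_deriv [CompleteSpace V] {g : ℝ → V} (hg : ContDiff ℝ 1 g)
    (hp : Function.Periodic g (2 * Real.pi)) (k : ℤ) :
    coeffR (deriv g) k = ((k : ℂ) * Complex.I) • coeffR g k := by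
  set a : ℂ := (((-k : ℤ) : ℂ) * Complex.I) with ha
  have hgc := hg.continuous
  have hdc : Continuous (deriv g) := hg.continuous_deriv le_rfl
  have hec : Continuous (fun x : ℝ => Complex.exp (a * x)) := by fun_prop
  have hd : ∀ x : ℝ, HasDerivAt (fun x : ℝ => Complex.exp (a * x) • g x)
      (Complex.exp (a * x) • deriv g x + a • (Complex.exp (a * x) • g x)) x := by
    intro x
    have := (hasDerivAt_expR a x).smul ((hg.differentiable one_ne_zero) x).hasDerivAt
    refine (this.congr_deriv ?_ : HasDerivAt (fun x : ℝ => Complex.exp (a * x) • g x) _ x)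
    rw [smul_smul]
  have h1 : Continuous (fun x : ℝ => Complex.exp (a * x) • deriv g x) := hec.smul hdc
  have h2 : Continuous (fun x : ℝ => a • (Complex.exp (a * x) • g x)) :=
    (hec.smul hgc).const_smul a
  have h := intervalIntegral.integral_eq_sub_of_hasDerivAt (a := 0) (b := 2 * Real.pi)
    (fun x _ => hd x) ((h1.add h2).intervalIntegrable _ _)
  have e1 : Complex.exp (a * ((2 * Real.pi : ℝ) : ℂ)) • g (2 * Real.pi) =
      Complex.exp (a * ((0 : ℝ) : ℂ)) • g 0 := by
    have := exp_periodic (-k) 0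
    have := hp 0
    simp_all
  rw [e1, sub_self, intervalIntegral.integral_add (h1.intervalIntegrable _ _)
    (h2.intervalIntegrable _ _), intervalIntegral.integral_smul] at h
  have : coeffR (deriv g) k = - (a • coeffR g k) := eq_neg_of_add_eq_zero_left h
  rw [this, ← neg_smul, ha]
  push_cast
  simp

theorem coeffR_iteratedDeriv [CompleteSpace V] {g : ℝ → V} (hg : ContDiff ℝ ∞ g)
    (hp : Function.Periodic g (2 * Real.pi)) (k : ℤ) (n : ℕ) :
    coeffR (iteratedDeriv n g) k = ((k : ℂ) * Complex.I) ^ n • coeffR g k ∧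
      Function.Periodic (iteratedDeriv n g) (2 * Real.pi) := by
  induction n with
  | zero => exact ⟨by simp, by simpa using hp⟩
  | succ n ih =>
    have hc : ContDiff ℝ 1 (iteratedDeriv n g) := by
      rw [iteratedDeriv_eq_iterate]
      exact (hg.iterate_deriv n).of_le (by exact_mod_cast le_top)
    rw [iteratedDeriv_succ]
    refine ⟨?_, ?_⟩
    · rw [coeffR_deriv hc ih.2, ih.1, smul_smul, pow_succ']
    · intro x
      have h : (fun y => iteratedDeriv n g (y + 2 * Real.pi)) = iteratedDeriv n g := funext ih.2
      rw [← deriv_comp_add_const, h]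

theorem CInf.fourierCoeff_eq (f : CInf V) (k : ℤ) :
    fourierCoeff (f : S1 → V) k =
      (1 / (2 * Real.pi)) • coeffR (fun x : ℝ => (f : S1 → V) (x : S1)) k := by
  rw [fourierCoeff_eq_intervalIntegral _ _ 0, zero_add, coeffR]
  simp_rw [fourier_two_pi]

theorem CInf.periodic (f : CInf V) :
    Function.Periodic (fun x : ℝ => (f : S1 → V) (x : S1)) (2 * Real.pi) := by
  intro x
  simp only [AddCircle.coe_add_period]

/-- The Fourier coefficients of a smooth function decay faster than any power. -/
theorem CInf.fourierCoeff_decay [CompleteSpace V] (f : CInf V) (n : ℕ) :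
    ∃ C : ℝ, ∀ k : ℤ, |(k : ℝ)| ^ n * ‖fourierCoeff (f : S1 → V) k‖ ≤ C := by
  set g : ℝ → V := fun x : ℝ => (f : S1 → V) (x : S1)
  have hg : ContDiff ℝ ∞ g := f.2
  have hc : Continuous (iteratedDeriv n g) :=
    hg.continuous_iteratedDeriv n (by exact_mod_cast le_top)
  obtain ⟨M, hM⟩ := (isCompact_Icc (a := (0 : ℝ)) (b := 2 * Real.pi)).exists_bound_of_continuousOn
    hc.continuousOn
  refine ⟨(1 / (2 * Real.pi)) * (M * |2 * Real.pi - 0|), fun k => ?_⟩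
  have h1 := (coeffR_iteratedDeriv hg (CInf.periodic f) k n).1
  have h2 : ‖coeffR (iteratedDeriv n g) k‖ ≤ M * |2 * Real.pi - 0| := by
    refine intervalIntegral.norm_integral_le_of_norm_le_const fun x hx => ?_
    rw [Set.uIoc_of_le Real.two_pi_pos.le] at hx
    rw [norm_smul]
    have : ‖Complex.exp ((((-k : ℤ) : ℂ) * Complex.I) * x)‖ = 1 := by
      rw [Complex.norm_exp]; simp
    rw [this, one_mul]
    exact hM x ⟨hx.1.le, hx.2⟩
  rw [h1, norm_smul, norm_pow, norm_mul, Complex.norm_I, mul_one, Complex.norm_intCast] at h2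
  rw [(CInf.fourierCoeff_eq f) k, norm_smul, Real.norm_of_nonneg (by positivity)]
  calc |(k : ℝ)| ^ n * (1 / (2 * Real.pi) * ‖coeffR g k‖)
      = (1 / (2 * Real.pi)) * (|(k : ℝ)| ^ n * ‖coeffR g k‖) := by ring
    _ ≤ _ := by gcongr

theorem CInf.summable_pow_mul [CompleteSpace V] (f : CInf V) (n : ℕ) :
    Summable fun k : ℤ => |(k : ℝ)| ^ n * ‖fourierCoeff (f : S1 → V) k‖ := by
  obtain ⟨C, hC⟩ := (CInf.fourierCoeff_decay f) (n + 2)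
  obtain ⟨C', hC'⟩ := (CInf.fourierCoeff_decay f) n
  have hs : Summable fun k : ℤ => C * (1 / (k : ℝ) ^ 2) :=
    (Real.summable_one_div_int_pow.2 one_lt_two).mul_left C
  refine Summable.of_norm_bounded_eventually hs ?_
  have : ({0} : Set ℤ)ᶜ ∈ (Filter.cofinite : Filter ℤ) := (Set.finite_singleton 0).compl_mem_cofinite
  filter_upwards [this] with k hk
  have hk0 : (0 : ℝ) < (k : ℝ) ^ 2 := by
    have : (k : ℝ) ≠ 0 := by exact_mod_cast hk
    positivity
  rw [Real.norm_of_nonneg (by positivity), mul_one_div, le_div_iff₀ hk0]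
  calc _ = |(k : ℝ)| ^ (n + 2) * ‖fourierCoeff (f : S1 → V) k‖ := by
        rw [← sq_abs (k : ℝ)]; ring
    _ ≤ C := hC k

/-- The `k`-th term of the series defining the positive-frequency part. -/
def posTerm (f : S1 → V) (k : ℤ) (x : S1) : V :=
  if 0 < k then (fourier k x : ℂ) • fourierCoeff f k else 0

theorem norm_posTerm_le (f : S1 → V) (k : ℤ) (x : S1) :
    ‖posTerm f k x‖ ≤ ‖fourierCoeff f k‖ := by
  unfold posTerm
  split_ifs
  · rw [norm_smul, fourier_apply, Circle.norm_coe, one_mul]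
  · simp

theorem CInf.summable_posTerm [CompleteSpace V] (f : CInf V) (x : S1) :
    Summable fun k => posTerm (f : S1 → V) k x := by
  refine Summable.of_norm_bounded (g := fun k : ℤ => ‖fourierCoeff (f : S1 → V) k‖) ?_
    (fun k => norm_posTerm_le _ k x)
  simpa using (CInf.summable_pow_mul f) 0

theorem iteratedDeriv_exp_smul (a : ℂ) (v : V) (n : ℕ) :
    iteratedDeriv n (fun x : ℝ => Complex.exp (a * x) • v) =
      fun x : ℝ => a ^ n • (Complex.exp (a * x) • v) := by
  induction n with
  | zero => simp
  | succ n ih =>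
    rw [iteratedDeriv_succ, ih]
    funext x
    have h := ((hasDerivAt_expR a x).smul_const v).const_smul (a ^ n)
    have : deriv (fun x : ℝ => a ^ n • (Complex.exp (a * x) • v)) x =
        a ^ n • ((a * Complex.exp (a * x)) • v) := h.deriv
    rw [this, smul_smul, smul_smul]
    congr 1
    ring

theorem CInf.contDiff_posPart [CompleteSpace V] (f : CInf V) :
    ContDiff ℝ ∞ (fun x : ℝ => ∑' k : ℤ, posTerm (f : S1 → V) k (x : S1)) := by
  have hterm : ∀ k : ℤ, 0 < k → (fun x : ℝ => posTerm (f : S1 → V) k (x : S1)) =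
      fun x : ℝ => Complex.exp ((k * Complex.I) * x) • fourierCoeff (f : S1 → V) k := by
    intro k hk
    funext x
    rw [posTerm, if_pos hk, fourier_two_pi]
  have hterm0 : ∀ k : ℤ, ¬ 0 < k → (fun x : ℝ => posTerm (f : S1 → V) k (x : S1)) =
      fun _ : ℝ => (0 : V) := by
    intro k hk
    funext x
    rw [posTerm, if_neg hk]
  refine contDiff_tsum (v := fun (n : ℕ) (k : ℤ) => |(k : ℝ)| ^ n * ‖fourierCoeff (f : S1 → V) k‖)
    (fun k => ?_) (fun n _ => (CInf.summable_pow_mul f) n) (fun n k x _ => ?_)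
  · by_cases hk : 0 < k
    · rw [hterm k hk]
      have h : ContDiff ℝ ∞ (fun x : ℝ => Complex.exp ((k * Complex.I) * x)) := by
        have : ContDiff ℝ ∞ (fun x : ℝ => (x : ℂ)) := Complex.ofRealCLM.contDiff
        exact (contDiff_const.mul this).cexp
      exact h.smul contDiff_const
    · rw [hterm0 k hk]
      exact contDiff_const
  · rw [norm_iteratedFDeriv_eq_norm_iteratedDeriv]
    by_cases hk : 0 < k
    · rw [hterm k hk, iteratedDeriv_exp_smul]
      simp only [norm_smul, norm_pow, norm_mul, Complex.norm_I, mul_one, Complex.norm_intCast]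
      rw [Complex.norm_exp]
      simp
    · rw [hterm0 k hk]
      have : iteratedDeriv n (fun _ : ℝ => (0 : V)) x = 0 := by
        simp
      rw [this, norm_zero]
      positivity

end FourierDecay

universe u

variable (V : Type u) [NormedAddCommGroup V] [InnerProductSpace ℂ V] [FiniteDimensional ℂ V]

/-- The projection `p_{E₊}` of `C^∞(S¹, V)` onto the span `E₊` of the eigenvectors of
`D = -i d/dx` with positive eigenvalue, along those with eigenvalue `≤ 0`. The `k`-eigenspace of
`D` is `e^{ikx} V`, so that `(p_{E₊} f)(x) = ∑_{k > 0} e^{ikx} f̂(k)`. -/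
def pPos : Op V where
  toFun f := CInf.mk
    (fun x => ∑' k : ℤ, if 0 < k then (fourier k x : ℂ) • fourierCoeff (f : S1 → V) k else 0)
    (haveI := FiniteDimensional.complete ℂ V
    CInf.contDiff_posPart f)
  map_add' f g := by
    have := FiniteDimensional.complete ℂ V
    ext x
    change ∑' k : ℤ, posTerm ((f : S1 → V) + (g : S1 → V)) k x =
      ∑' k : ℤ, posTerm (f : S1 → V) k x + ∑' k : ℤ, posTerm (g : S1 → V) k x
    rw [← (CInf.summable_posTerm f x).tsum_add (CInf.summable_posTerm g x)]
    refine tsum_congr fun k => ?_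
    simp only [posTerm, fourierCoeff.add (CInf.integrable f) (CInf.integrable g)]
    split_ifs
    · rw [Pi.add_apply, smul_add]
    · rw [add_zero]
  map_smul' c f := by
    have := FiniteDimensional.complete ℂ V
    ext x
    change ∑' k : ℤ, posTerm (c • (f : S1 → V)) k x = c • ∑' k : ℤ, posTerm (f : S1 → V) k x
    rw [← (CInf.summable_posTerm f x).tsum_const_smul c]
    refine tsum_congr fun k => ?_
    simp only [posTerm, fourierCoeff.const_smul]
    split_ifs
    · rw [smul_comm]
    · rw [smul_zero]

variable {V}

/-! ### Pseudodifferential operators and smoothing operators -/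

/-- `σ` is a (not necessarily classical) symbol of order `m` on `T*S¹ = S¹ × ℝ`: it is smooth with
values in `End V`, and `‖∂_ξ^α ∂_x^β σ(x, ξ)‖ ≤ C_{αβ} (1 + |ξ|)^{m - α}` for all `α`, `β`. -/
def IsSymbol (m : ℝ) (σ : S1 → ℝ → (V →L[ℂ] V)) : Prop :=
  ContDiff ℝ ∞ (fun q : ℝ × ℝ => σ (q.1 : S1) q.2) ∧
  ∀ α β : ℕ, ∃ C : ℝ, ∀ x ξ : ℝ,
    ‖iteratedDeriv α (fun η : ℝ => iteratedDeriv β (fun y : ℝ => σ (y : S1) η) x) ξ‖ ≤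
      C * (1 + |ξ|) ^ (m - α)

/-- `A ∈ PDO(S¹, V)`: `A` is the quantization of a symbol of some real order (of either sign).
On the circle the Fourier transform of `f` is carried by the integers, and
`A f (x) = ∫ e^{ixξ} σ(x, ξ) f̂(ξ) dξ` is the Fourier series `∑_k e^{ikx} σ(x, k) f̂(k)`. -/
def IsPDO (A : Op V) : Prop :=
  ∃ (m : ℝ) (σ : S1 → ℝ → (V →L[ℂ] V)), IsSymbol m σ ∧
    ∀ (f : CInf V) (x : S1),
      HasSum (fun k : ℤ => (fourier k x : ℂ) • σ x k (fourierCoeff (f : S1 → V) k))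
        ((A f : S1 → V) x)

/-- `A ∈ PDO^{-∞}(S¹, V)`: `A` is an integral operator with smooth kernel. -/
def IsSmoothing (A : Op V) : Prop :=
  ∃ K : S1 → S1 → (V →L[ℂ] V),
    ContDiff ℝ ∞ (fun q : ℝ × ℝ => K (q.1 : S1) (q.2 : S1)) ∧
    ∀ (f : CInf V) (x : S1), (A f : S1 → V) x = ∫ y : S1, K x y ((f : S1 → V) y)

/-! ### Trace-class operators and their trace -/

section Trace

variable {H : Type*} [NormedAddCommGroup H] [InnerProductSpace ℂ H]

/-- Trace-class (i.e. nuclear) operators on a Hilbert space: `T = ∑ ⟨u n, ·⟩ v n` with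
`∑ ‖u n‖ ‖v n‖ < ∞`. -/
def IsTraceClass (T : H →L[ℂ] H) : Prop :=
  ∃ u v : ℕ → H, Summable (fun n => ‖u n‖ * ‖v n‖) ∧
    ∀ x : H, HasSum (fun n => inner ℂ (u n) x • v n) (T x)

/-- `tr T = ∑ ⟨b i, T (b i)⟩` over a Hilbert basis `b` of `H`. -/
def trace [CompleteSpace H] (T : H →L[ℂ] H) : ℂ :=
  ∑' i, inner ℂ ((exists_hilbertBasis ℂ H).choose_spec.choose i)
    (T ((exists_hilbertBasis ℂ H).choose_spec.choose i))

end Trace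

variable (V) in
/-- `L²(S¹, V)`. -/
abbrev L2 : Type _ := MeasureTheory.Lp V 2 (MeasureTheory.volume : MeasureTheory.Measure S1)

/-- The inclusion `C^∞(S¹, V) ⊆ L²(S¹, V)`. -/
def toL2 (f : CInf V) : L2 V :=
  ContinuousMap.toLp 2 MeasureTheory.volume ℂ ⟨(f : S1 → V), (CInf.continuous f)⟩

/-- The bounded operator `T` on `L²(S¹, V)` extends the operator `A` on `C^∞(S¹, V)`. As
`C^∞(S¹, V)` is dense there is at most one such `T`. -/
def Extends (T : L2 V →L[ℂ] L2 V) (A : Op V) : Prop :=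
  ∀ f : CInf V, T (toL2 f) = toL2 (A f)

open Classical in
/-- The trace of an operator on `C^∞(S¹, V)`: the trace of its bounded extension to `L²(S¹, V)`
(and `0` if there is no such extension). -/
def tr (A : Op V) : ℂ :=
  haveI := FiniteDimensional.complete ℂ V
  if h : ∃ T : L2 V →L[ℂ] L2 V, Extends T A then trace h.choose else 0

/-- `A` extends to a trace-class operator on `L²(S¹, V)`, and `tr A = ∑ ⟨b i, A (b i)⟩` for every
Hilbert basis `b`. -/
def HasTrace (A : Op V) : Prop :=
  ∃ T : L2 V →L[ℂ] L2 V, Extends T A ∧ IsTraceClass T ∧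
    ∀ (ι : Type u) (b : HilbertBasis ι ℂ (L2 V)), HasSum (fun i => inner ℂ (b i) (T (b i))) (tr A)

/-! ### The connection, its curvature and the Chern–Weil forms -/

/-- The commutator bracket `[a, b] = a ∘ b - b ∘ a` on operators. -/
instance instLieRingOp : LieRing (Op V) := LieRing.ofAssociativeRing

/-- The connection: `θ_a(c) = a ∘ p_{E₊} ∘ c`. -/
def theta (a c : Op V) : Op V := a * pPos V * c

/-- The curvature `Ω(a, b) = θ_a θ_b - θ_b θ_a - θ_{[a, b]}`, evaluated at `c`. -/
def Omega (a b c : Op V) : Op V :=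
  theta a (theta b c) - theta b (theta a c) - theta (a * b - b * a) c

/-- The operator on `C^∞(S¹, V)` by which `Ω(a, b)` acts by composition on the left; it is also
denoted by `Ω(a, b)`. -/
def curv (a b : Op V) : Op V :=
  Omega a b 1

/-- `Ω(x₁, x₂) ∘ Ω(x₃, x₄) ∘ ⋯ ∘ Ω(x_{2k-1}, x_{2k})`. -/
def curvProd (k : ℕ) (x : Fin (2 * k) → Op V) : Op V :=
  (List.ofFn fun i : Fin k =>
    curv (x ⟨2 * i, by omega⟩) (x ⟨2 * i + 1, by omega⟩)).prod

/-- The form `tr (Ω^k)`, i.e. the skew-symmetrization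
`1 / (2k)! ∑_s ε(s) tr (Ω(x_{s(1)}, x_{s(2)}) ∘ ⋯ ∘ Ω(x_{s(2k-1)}, x_{s(2k)}))`. -/
def trOmegaPow (k : ℕ) (x : Fin (2 * k) → Op V) : ℂ :=
  ((2 * k).factorial : ℂ)⁻¹ * ∑ s : Equiv.Perm (Fin (2 * k)),
    ((Equiv.Perm.sign s : ℤ) : ℂ) * tr (curvProd k (x ∘ s))

/-- The Chevalley–Eilenberg coboundary, with trivial coefficients, of an alternating `n`-cochain of
a Lie algebra `L`:
`(d c)(x₀, …, x_n) = ∑_{i < j} (-1)^j c(x₀, …, x_{i-1}, [x_i, x_j], x_{i+1}, …, x̂_j, …, x_n)`.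
Moving the bracket to the first place, which costs a sign `(-1)^i`, gives the usual
`∑_{i < j} (-1)^{i+j} c([x_i, x_j], x₀, …, x̂_i, …, x̂_j, …, x_n)`. -/
def ceDiff {L : Type*} [LieRing L] [LieAlgebra ℂ L] {n : ℕ} (c : L [⋀^Fin n]→ₗ[ℂ] ℂ)
    (x : Fin (n + 1) → L) : ℂ :=
  ∑ j : Fin (n + 1), ∑ i ∈ Finset.Iio j,
    (-1) ^ (j : ℕ) * c (Function.update x i ⁅x i, x j⁆ ∘ j.succAbove)

end PDOCocycle

end

open PDOCocycle

/-! Everything is read off from matrices with respect to the Fourier modes. If `c l ξ` is the `l`-th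
Fourier coefficient in `x` of a symbol `σ`, the operator has the matrix `c (j - k) k`, which decays
rapidly away from the diagonal and grows polynomially along it. This passage is possible in both
directions (`IsPDO.exists_isFourierSymbol`, `IsFourierSymbol.isPDO`). Composition is the matrix
product, and it comes from the exact symbol `∑ r, a (l - r) (ξ + r) * b r ξ`
(`IsFourierSymbol.comp`), so that no asymptotic expansion is needed and the operators form an
algebra. The projection `p` has a smooth cut-off as symbol, because only the values at integers
matter.

With `ρ a = a * p` the curvature is `h a b - h b a`, where `h a b = ρ a * ρ b - ρ (a * b) = -a * ((1
- p) * b * p)`. The matrix of `(1 - p) * b * p` lives on `j ≤ 0 < k`, where `|j - k| = |j| + |k|`;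
hence decay off the diagonal is rapid decay in both indices (`one_sub_pPos_mul_mul_pPos_mem`).
Rapidly decreasing matrices are stable under multiplication by pseudodifferential operators on
either side; they give smoothing and nuclear operators, with trace `∑ k, tr (M k k)`
(`hasTrace_and_tr_eq`), and `tr (A * B) = tr (B * A)` if one factor is of this kind (`tr_mul_comm`).

Closedness is then algebra (`ceDiff_eq_zero_of_trace`). Under antisymmetrization every `Ω` may be
replaced by `2 h`. The coboundary of an antisymmetrized cochain is, up to sign, the
antisymmetrization of the alternating sum over products of neighbouring arguments
(`ceDiff_eq_sum_contract`). For `h x₀ x₁ * h x₂ x₃ * ⋯` this sum telescopes by the Bianchi identity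
`ρ a * h b c - h (a * b) c + h a (b * c) - h a b * ρ c = 0`, and leaves `ρ x₀ * h x₁ x₂ * ⋯ - h x₀
x₁ * ⋯ * ρ x_{2k}` (`sum_contract_seqProd`). By the trace property the two end terms differ by a
cyclic rotation of `2k + 1` arguments, which is an even permutation, so they cancel. -/

noncomputable section

open Equiv
namespace PDOCocycle

/-! ### Permutations with one prescribed value. -/

section Permutations

/-- The permutation of `Fin (n + 1)` that sends `p` to `b` and, in the complements of `p` and `b`,
acts as `s`. -/
def permInsert {n : ℕ} (p b : Fin (n + 1)) (s : Perm (Fin n)) : Perm (Fin (n + 1)) :=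
  b.cycleRange.symm * Perm.decomposeFin.symm (0, s) * p.cycleRange

variable {n : ℕ} (p b : Fin (n + 1)) (s : Perm (Fin n))

theorem permInsert_self : permInsert p b s p = b := by
  simp [permInsert]

theorem permInsert_succAbove (i : Fin n) :
    permInsert p b s (p.succAbove i) = b.succAbove (s i) := by
  simp [permInsert]

theorem sign_permInsert :
    Perm.sign (permInsert p b s) = (-1) ^ (p + b : ℕ) * Perm.sign s := by
  rw [permInsert, Perm.sign_mul, Perm.sign_mul, Perm.sign_symm, Fin.sign_cycleRange,
    Fin.sign_cycleRange, Perm.decomposeFin.symm_sign, if_pos rfl, one_mul, pow_add]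
  exact (mul_right_comm _ _ _).trans (congrArg (· * _) (mul_comm _ _))

theorem permInsert_bijective (p : Fin (n + 1)) :
    Function.Bijective fun bs : Fin (n + 1) × Perm (Fin n) => permInsert p bs.1 bs.2 := by
  rw [Fintype.bijective_iff_injective_and_card]
  refine ⟨fun ⟨b, s⟩ ⟨b', s'⟩ h => ?_, ?_⟩
  · have hb : b = b' := by
      have := congrArg (fun t : Perm (Fin (n + 1)) => t p) h
      simpa only [permInsert_self] using this
    subst hb
    refine Prod.ext rfl (Equiv.ext fun i => ?_)
    have := congrArg (fun t : Perm (Fin (n + 1)) => t (p.succAbove i)) h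
    simp only [permInsert_succAbove] at this
    exact b.succAbove_right_injective this
  · simp [Fintype.card_perm, Nat.factorial_succ]

/-- A permutation of `Fin (n + 1)` is determined by the image of `p` and by a permutation of
`Fin n`. -/
theorem sum_perm_succ {N : Type*} [AddCommMonoid N] (p : Fin (n + 1))
    (f : Perm (Fin (n + 1)) → N) :
    ∑ t, f t = ∑ b, ∑ s, f (permInsert p b s) := by
  rw [← Fintype.sum_prod_type' (f := fun b s => f (permInsert p b s))]
  exact ((permInsert_bijective p).sum_comp f).symm

end Permutations

/-! ### The Chevalley–Eilenberg coboundary on an associative algebra. -/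

section Antisymmetrization

attribute [local instance 100] LieRing.ofAssociativeRing

variable {L : Type*} [AddCommGroup L] [Module ℂ L] {n : ℕ}

/-- Deleting an argument of an alternating map is compatible with permutations. -/
theorem map_comp_perm_succAbove (φ : L [⋀^Fin n]→ₗ[ℂ] ℂ) (w : Fin (n + 1) → L)
    (t : Perm (Fin (n + 1))) (p : Fin (n + 1)) :
    φ ((w ∘ t) ∘ p.succAbove) =
      ((Perm.sign t : ℤ) : ℂ) * (-1) ^ (p + t p : ℕ) * φ (w ∘ (t p).succAbove) := by
  obtain ⟨⟨b, s⟩, rfl⟩ := (permInsert_bijective p).2 t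
  have h : (w ∘ permInsert p b s) ∘ p.succAbove = (w ∘ b.succAbove) ∘ s := by
    funext i
    simp [permInsert_succAbove]
  simp only [h, φ.map_perm, permInsert_self, sign_permInsert]
  rw [Units.smul_def, zsmul_eq_mul]
  push_cast
  have : ((-1 : ℂ) ^ (p + b : ℕ)) * (-1) ^ (p + b : ℕ) = 1 := by
    rw [← mul_pow]; simp
  linear_combination -(((Perm.sign s : ℤ) : ℂ) * φ (w ∘ b.succAbove)) * this

/-- The two argument lists differ by the transposition of `i` and `j`; the powers of `-1` account
for the different places of deletion. -/
theorem map_update_succAbove_swap (φ : L [⋀^Fin n]→ₗ[ℂ] ℂ) (x : Fin (n + 1) → L) (y : L)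
    {i j : Fin (n + 1)} (hij : i ≠ j) :
    (-1) ^ (j : ℕ) * φ (Function.update x i y ∘ j.succAbove) =
      -((-1) ^ (i : ℕ) * φ (Function.update x j y ∘ i.succAbove)) := by
  have h := map_comp_perm_succAbove φ (Function.update x i y) (swap i j) i
  rw [Perm.sign_swap hij, swap_apply_left] at h
  have e : (Function.update x i y ∘ swap i j) ∘ i.succAbove =
      Function.update x j y ∘ i.succAbove := by
    funext a
    simp only [Function.comp_apply]
    by_cases ha : i.succAbove a = j
    · rw [ha, swap_apply_right, Function.update_self, Function.update_self]
    · rw [swap_apply_of_ne_of_ne (Fin.succAbove_ne i a) ha,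
        Function.update_of_ne (Fin.succAbove_ne i a), Function.update_of_ne ha]
  rw [e] at h
  rw [h, pow_add]
  have : ((-1 : ℂ) ^ (i : ℕ)) * (-1) ^ (i : ℕ) = 1 := by
    rw [← mul_pow]; simp
  push_cast
  linear_combination (-(-1) ^ (j : ℕ) * φ (Function.update x i y ∘ j.succAbove)) * this

/-- The product of two neighbouring entries of a sequence, in place of these entries. -/
def contract {R : Type*} [Mul R] (q : ℕ) (y : ℕ → R) (i : ℕ) : R :=
  if i < q then y i else if i = q then y q * y (q + 1) else y (i + 1)

/-- A finite sequence, continued by zeros. -/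
def extendZero {R : Type*} [Zero R] {m : ℕ} (x : Fin m → R) (i : ℕ) : R :=
  if h : i < m then x ⟨i, h⟩ else 0

variable {R : Type*} [Ring R] [Algebra ℂ R]

/-- In `[x_i, x_j] = x_i x_j - x_j x_i` the second product, standing at place `i` with `j` deleted,
is moved by `map_update_succAbove_swap` to place `j` with `i` deleted. Thus each ordered pair `a ≠
b` contributes `x a * x b` at place `a` with `b` deleted and sign `(-1)^b`, which removes the
condition `i < j`. -/
theorem ceDiff_eq_sum_mul (φ : R [⋀^Fin n]→ₗ[ℂ] ℂ) (x : Fin (n + 1) → R) :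
    ceDiff φ x = ∑ b : Fin (n + 1), (-1) ^ (b : ℕ) * ∑ a : Fin n,
      φ (Function.update (x ∘ b.succAbove) a (x (b.succAbove a) * x b)) := by
  set F : Fin (n + 1) → Fin (n + 1) → ℂ := fun b a =>
    (-1) ^ (b : ℕ) * φ (Function.update x a (x a * x b) ∘ b.succAbove) with hF
  have h1 : ∀ b : Fin (n + 1), (-1) ^ (b : ℕ) * ∑ a : Fin n,
      φ (Function.update (x ∘ b.succAbove) a (x (b.succAbove a) * x b)) =
      ∑ a ∈ Finset.univ.filter (· ≠ b), F b a := by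
    intro b
    rw [Finset.mul_sum]
    have : Finset.univ.filter (· ≠ b) = Finset.univ.map b.succAboveEmb := by
      ext a
      simp only [Finset.mem_filter, Finset.mem_univ, true_and, Finset.mem_map,
        Fin.coe_succAboveEmb]
      exact Fin.exists_succAbove_eq_iff.symm
    rw [this, Finset.sum_map]
    refine Finset.sum_congr rfl fun a _ => ?_
    simp only [hF, Fin.coe_succAboveEmb]
    rw [← Function.update_comp_eq_of_injective x b.succAbove_right_injective]
  have h2 : ∀ j i : Fin (n + 1), i < j →
      (-1) ^ (j : ℕ) * φ (Function.update x i ⁅x i, x j⁆ ∘ j.succAbove) = F j i + F i j := by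
    intro j i hij
    obtain ⟨a, rfl⟩ := Fin.exists_succAbove_eq hij.ne
    have e : ∀ y, Function.update x (j.succAbove a) y ∘ j.succAbove =
        Function.update (x ∘ j.succAbove) a y := fun y =>
      Function.update_comp_eq_of_injective x j.succAbove_right_injective a y
    have := map_update_succAbove_swap φ x (x j * x (j.succAbove a)) hij.ne
    simp only [hF]
    rw [LieRing.of_associative_ring_bracket, e, φ.map_update_sub, ← e, ← e]
    linear_combination -this
  rw [ceDiff]
  simp_rw [h1]
  have h3 : ∀ b : Fin (n + 1), ∑ a ∈ Finset.univ.filter (· ≠ b), F b a =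
      ∑ a ∈ Finset.Iio b, F b a + ∑ a ∈ Finset.Ioi b, F b a := by
    intro b
    rw [← Finset.sum_union]
    · congr 1
      ext a
      simp [lt_or_lt_iff_ne]
    · rw [Finset.disjoint_left]
      intro a ha hb
      exact absurd (Finset.mem_Iio.1 ha) (Finset.mem_Ioi.1 hb).not_gt
  simp_rw [h3, Finset.sum_add_distrib]
  have h4 : ∑ b : Fin (n + 1), ∑ a ∈ Finset.Ioi b, F b a =
      ∑ a : Fin (n + 1), ∑ b ∈ Finset.Iio a, F b a :=
    Finset.sum_comm' (by simp)
  rw [h4, ← Finset.sum_add_distrib]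
  refine Finset.sum_congr rfl fun j _ => ?_
  rw [← Finset.sum_add_distrib]
  exact Finset.sum_congr rfl fun i hi => h2 j i (Finset.mem_Iio.1 hi)

/-- The coboundary of the antisymmetrization of a cochain on an associative algebra. -/
theorem ceDiff_eq_sum_contract (φ : R [⋀^Fin n]→ₗ[ℂ] ℂ) (G : (Fin n → R) → ℂ)
    (hG : ∀ z, φ z = ∑ s : Perm (Fin n), ((Perm.sign s : ℤ) : ℂ) * G (z ∘ s))
    (x : Fin (n + 1) → R) :
    ceDiff φ x = -∑ t : Perm (Fin (n + 1)), ((Perm.sign t : ℤ) : ℂ) *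
      ∑ q : Fin n, (-1) ^ (q : ℕ) * G (fun i => contract q (extendZero (x ∘ t)) i) := by
  rw [ceDiff_eq_sum_mul]
  simp_rw [hG, Finset.mul_sum]
  have h1 : ∀ b : Fin (n + 1), ∑ a : Fin n, ∑ s : Perm (Fin n), (-1) ^ (b : ℕ) *
      (((Perm.sign s : ℤ) : ℂ) *
        G (Function.update (x ∘ b.succAbove) a (x (b.succAbove a) * x b) ∘ s)) =
      ∑ q : Fin n, ∑ s : Perm (Fin n), (-1) ^ (b : ℕ) * (((Perm.sign s : ℤ) : ℂ) *
        G (Function.update (x ∘ b.succAbove ∘ s) q (x (b.succAbove (s q)) * x b))) := by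
    intro b
    rw [Finset.sum_comm, Finset.sum_comm (s := Finset.univ (α := Fin n))]
    refine Finset.sum_congr rfl fun s _ => ?_
    -- The place `a` is written as `s q`, so that `q` is where the product stands after permuting.
    rw [← Equiv.sum_comp s]
    refine Finset.sum_congr rfl fun q _ => ?_
    rw [Function.update_comp_eq_of_injective (x ∘ b.succAbove) s.injective]
    rfl
  simp_rw [h1]
  rw [Finset.sum_comm, Finset.sum_comm (s := Finset.univ (α := Perm (Fin (n + 1)))),
    ← Finset.sum_neg_distrib]
  refine Finset.sum_congr rfl fun q _ => ?_
  -- The deleted argument `b` is inserted directly behind place `q`, where it becomes the right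
  -- neighbour of the argument it multiplies. The insertion at `q + 1` has sign `(-1)^(q + 1 + b)`;
  -- the extra `1` is the global minus sign.
  rw [sum_perm_succ q.succ, ← Finset.sum_neg_distrib]
  refine Finset.sum_congr rfl fun b _ => ?_
  rw [← Finset.sum_neg_distrib]
  refine Finset.sum_congr rfl fun s _ => ?_
  have e : (fun i : Fin n => contract q (extendZero (x ∘ permInsert q.succ b s)) i) =
      Function.update (x ∘ b.succAbove ∘ s) q (x (b.succAbove (s q)) * x b) := by
    funext i
    have hc : ∀ j : Fin n, x (b.succAbove (s j)) =
        x (permInsert q.succ b s (q.succ.succAbove j)) := fun j => by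
      rw [permInsert_succAbove]
    have hb : x b = x (permInsert q.succ b s q.succ) := by rw [permInsert_self]
    rcases lt_trichotomy i q with h | h | h
    · rw [Function.update_of_ne h.ne, contract, if_pos (by exact h), extendZero,
        dif_pos (by omega), Function.comp_apply, Function.comp_apply, Function.comp_apply, hc,
        Fin.succAbove_of_castSucc_lt _ _ (Nat.lt_succ_of_lt (Fin.lt_def.1 h))]
      rfl
    · subst h
      rw [Function.update_self, contract, if_neg (lt_irrefl _), if_pos rfl, extendZero,
        dif_pos (by omega), extendZero, dif_pos (by omega), hc, hb, Fin.succAbove_succ_self]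
      rfl
    · rw [Function.update_of_ne h.ne', contract, if_neg (by exact h.asymm),
        if_neg (fun e => h.ne' (Fin.ext e)), extendZero,
        dif_pos (by omega), Function.comp_apply, Function.comp_apply, Function.comp_apply, hc,
        Fin.succAbove_of_le_castSucc _ _ (Nat.succ_le_of_lt (Fin.lt_def.1 h))]
      rfl
  rw [e, sign_permInsert]
  push_cast
  have h2 : ((-1 : ℂ) ^ (q : ℕ)) * (-1) ^ (q : ℕ) = 1 := by
    rw [← mul_pow]; simp
  rw [Fin.val_succ, pow_add, pow_add, pow_one]
  linear_combination -((-1) ^ (b : ℕ) * ((Perm.sign s : ℤ) : ℂ) *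
    G (Function.update (x ∘ b.succAbove ∘ s) q (x (b.succAbove (s q)) * x b))) * h2

end Antisymmetrization

end PDOCocycle

end

noncomputable section

open Equiv
namespace PDOCocycle

/-! ### The telescoping identity. -/

section PairProducts

variable {R : Type*} [Ring R]

/-- `F 0 x₀ x₁ * F 1 x₂ x₃ * ⋯`. -/
def pairProd {k : ℕ} (F : Fin k → R → R → R) (x : Fin (2 * k) → R) : R :=
  (List.ofFn fun i : Fin k => F i (x ⟨2 * i, by omega⟩) (x ⟨2 * i + 1, by omega⟩)).prod

/-- `F y₀ y₁ * F y₂ y₃ * ⋯`, with `k` factors. -/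
def seqProd (F : R → R → R) : ℕ → (ℕ → R) → R
  | 0, _ => 1
  | k + 1, y => F (y 0) (y 1) * seqProd F k (fun i => y (i + 2))

theorem pairProd_const_eq_seqProd (F : R → R → R) {k : ℕ} (x : Fin (2 * k) → R) (y : ℕ → R)
    (h : ∀ i, x i = y i) : pairProd (fun _ => F) x = seqProd F k y := by
  induction k generalizing y with
  | zero => simp [pairProd, seqProd]
  | succ k ih =>
    rw [pairProd, List.ofFn_succ, List.prod_cons, seqProd,
      ← ih (fun i : Fin (2 * k) => x ⟨i + 2, by omega⟩) _ (fun i => h _), h, h]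
    rfl

/-- The curvature of `a ↦ a * p`, before antisymmetrization. -/
def halfCurv (p a b : R) : R := a * p * b * p - a * b * p

/-- With `ρ a = a * p` and `h = halfCurv p`, the Bianchi identity `h (a * b) c - h a (b * c) = ρ a *
h b c - h a b * ρ c` makes the sum telescope. In the induction `q = 0, 1` give this difference for
the first three entries, while for `q ≥ 2` the factor `h y₀ y₁` is untouched and the induction
hypothesis applies to the rest; the inner terms with `ρ y₂` cancel. -/
theorem sum_contract_seqProd (p : R) (k : ℕ) (y : ℕ → R) :
    ∑ q ∈ Finset.range (2 * k), (-1) ^ q * seqProd (halfCurv p) k (contract q y) =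
      y 0 * p * seqProd (halfCurv p) k (fun i => y (i + 1)) -
        seqProd (halfCurv p) k y * (y (2 * k) * p) := by
  induction k generalizing y with
  | zero => simp [seqProd]
  | succ k ih =>
    have h1 : ∀ q : ℕ, seqProd (halfCurv p) (k + 1) (contract (q + 2) y) =
        halfCurv p (y 0) (y 1) * seqProd (halfCurv p) k (contract q fun i => y (i + 2)) := by
      intro q
      have : (fun i => contract (q + 2) y (i + 2)) = contract q fun i => y (i + 2) := by
        funext i
        simp only [contract, Nat.add_lt_add_iff_right, Nat.add_right_cancel_iff]
      rw [seqProd, this]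
      simp [contract]
    have h2 : seqProd (halfCurv p) (k + 1) (contract 0 y) =
        halfCurv p (y 0 * y 1) (y 2) * seqProd (halfCurv p) k (fun i => y (i + 3)) := by
      simp [seqProd, contract]
    have h3 : seqProd (halfCurv p) (k + 1) (contract 1 y) =
        halfCurv p (y 0) (y 1 * y 2) * seqProd (halfCurv p) k (fun i => y (i + 3)) := by
      simp [seqProd, contract]
    have h4 : ∀ q ∈ Finset.range (2 * k), (-1) ^ (q + 1 + 1) *
        (halfCurv p (y 0) (y 1) * seqProd (halfCurv p) k (contract q fun i => y (i + 2))) =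
        halfCurv p (y 0) (y 1) *
          ((-1) ^ q * seqProd (halfCurv p) k (contract q fun i => y (i + 2))) := by
      intro q _
      rw [pow_add, pow_add, pow_one, mul_assoc ((-1 : R) ^ q), neg_one_mul, neg_neg, mul_one]
      rcases neg_one_pow_eq_or R q with h | h <;> simp [h]
    rw [show 2 * (k + 1) = 2 * k + 1 + 1 by ring, Finset.sum_range_succ', Finset.sum_range_succ']
    simp only [zero_add, h1, h2, h3]
    rw [Finset.sum_congr rfl h4, ← Finset.mul_sum, ih]
    simp only [seqProd, halfCurv, zero_add, Nat.add_assoc, Nat.reduceAdd]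
    noncomm_ring

end PairProducts

/-! ### Multilinearity of the products and removal of the antisymmetry of each factor. -/

section Multilinearity

variable {R : Type*} [Ring R] [Algebra ℂ R] {k : ℕ}

/-- An argument enters exactly one factor, so linearity in it reduces to linearity of that factor
and of the product map `mkPiAlgebraFin`. -/
theorem pairProd_update_even (F : Fin k → R → R → R) (x : Fin (2 * k) → R) (m : Fin k) (a : R) :
    pairProd F (Function.update x ⟨2 * m, by omega⟩ a) =
      MultilinearMap.mkPiAlgebraFin ℂ k R (Function.update
        (fun i => F i (x ⟨2 * i, by omega⟩) (x ⟨2 * i + 1, by omega⟩)) m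
        (F m a (x ⟨2 * m + 1, by omega⟩))) := by
  rw [pairProd, MultilinearMap.mkPiAlgebraFin_apply]
  congr 2
  funext i
  rw [Function.update_of_ne (a := (⟨2 * i + 1, _⟩ : Fin (2 * k)))
    (by rw [Ne, Fin.mk.injEq]; omega)]
  by_cases h : i = m
  · subst h
    rw [Function.update_self, Function.update_self]
  · rw [Function.update_of_ne h, Function.update_of_ne]
    rw [Ne, Fin.mk.injEq]
    exact fun e => h (Fin.ext (by omega))

theorem pairProd_update_odd (F : Fin k → R → R → R) (x : Fin (2 * k) → R) (m : Fin k) (a : R) :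
    pairProd F (Function.update x ⟨2 * m + 1, by omega⟩ a) =
      MultilinearMap.mkPiAlgebraFin ℂ k R (Function.update
        (fun i => F i (x ⟨2 * i, by omega⟩) (x ⟨2 * i + 1, by omega⟩)) m
        (F m (x ⟨2 * m, by omega⟩) a)) := by
  rw [pairProd, MultilinearMap.mkPiAlgebraFin_apply]
  congr 2
  funext i
  rw [Function.update_of_ne (a := (⟨2 * i, _⟩ : Fin (2 * k)))
    (by rw [Ne, Fin.mk.injEq]; omega)]
  by_cases h : i = m
  · subst h
    rw [Function.update_self, Function.update_self]
  · rw [Function.update_of_ne h, Function.update_of_ne]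
    rw [Ne, Fin.mk.injEq]
    exact fun e => h (Fin.ext (by omega))

theorem even_or_odd_index (i : Fin (2 * k)) : ∃ m : Fin k,
    i = ⟨2 * m, by omega⟩ ∨ i = ⟨2 * m + 1, by omega⟩ := by
  refine ⟨⟨i / 2, by omega⟩, ?_⟩
  simp only [Fin.ext_iff]
  omega

/-- The product of the values of a bilinear map on consecutive pairs, as a multilinear map. -/
def pairProdMultilinear (k : ℕ) (F : R →ₗ[ℂ] R →ₗ[ℂ] R) :
    MultilinearMap ℂ (fun _ : Fin (2 * k) => R) R :=
  MultilinearMap.mk' (fun x => pairProd (fun _ a b => F a b) x)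
    (by
      intro x i a b
      obtain ⟨m, rfl | rfl⟩ := even_or_odd_index i
      · simp only [pairProd_update_even, map_add, LinearMap.add_apply,
          MultilinearMap.map_update_add]
      · simp only [pairProd_update_odd, map_add, MultilinearMap.map_update_add])
    (by
      intro x i c a
      obtain ⟨m, rfl | rfl⟩ := even_or_odd_index i
      · simp only [pairProd_update_even, map_smul, LinearMap.smul_apply,
          MultilinearMap.map_update_smul]
      · simp only [pairProd_update_odd, map_smul, MultilinearMap.map_update_smul])

/-- Under antisymmetrization, `F a b - F b a` may be replaced by `2 F a b`, in one factor. -/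
theorem sum_sign_pairProd_update (τ : R →ₗ[ℂ] ℂ) (F : Fin k → R → R → R) (m : Fin k)
    (Q : R → R → R) (x : Fin (2 * k) → R) :
    ∑ s : Perm (Fin (2 * k)), ((Perm.sign s : ℤ) : ℂ) *
        τ (pairProd (Function.update F m fun a b => Q a b - Q b a) (x ∘ s)) =
      2 * ∑ s : Perm (Fin (2 * k)), ((Perm.sign s : ℤ) : ℂ) *
        τ (pairProd (Function.update F m Q) (x ∘ s)) := by
  have e : ∀ (P : R → R → R) (z : Fin (2 * k) → R), pairProd (Function.update F m P) z =
      MultilinearMap.mkPiAlgebraFin ℂ k R (Function.update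
        (fun i => F i (z ⟨2 * i, by omega⟩) (z ⟨2 * i + 1, by omega⟩)) m
        (P (z ⟨2 * m, by omega⟩) (z ⟨2 * m + 1, by omega⟩))) := by
    intro P z
    rw [pairProd, MultilinearMap.mkPiAlgebraFin_apply]
    congr 2
    funext i
    by_cases h : i = m
    · subst h
      rw [Function.update_self, Function.update_self]
    · rw [Function.update_of_ne h, Function.update_of_ne h]
  -- The two arguments of the factor `m` are exchanged by the odd permutation `c`; replacing `s` by
  -- `s * c` turns the sum with `Q b a` into minus the sum with `Q a b`.
  set c : Perm (Fin (2 * k)) := swap ⟨2 * m, by omega⟩ ⟨2 * m + 1, by omega⟩ with hc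
  have hsign : Perm.sign c = -1 := Perm.sign_swap (by rw [Ne, Fin.mk.injEq]; omega)
  have h1 : ∀ z : Fin (2 * k) → R,
      pairProd (Function.update F m fun a b => Q a b - Q b a) z =
        pairProd (Function.update F m Q) z - pairProd (Function.update F m Q) (z ∘ c) := by
    intro z
    have h3 : ∀ v, Function.update
        (fun i => F i (z ⟨2 * i, by omega⟩) (z ⟨2 * i + 1, by omega⟩)) m v =
        Function.update (fun i : Fin k =>
          F i ((z ∘ c) ⟨2 * i, by omega⟩) ((z ∘ c) ⟨2 * i + 1, by omega⟩)) m v := by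
      intro v
      funext i
      by_cases h : i = m
      · subst h
        rw [Function.update_self, Function.update_self]
      · have hi : (i : ℕ) ≠ m := fun e => h (Fin.ext e)
        rw [Function.update_of_ne h, Function.update_of_ne h, Function.comp_apply,
          Function.comp_apply, hc, swap_apply_of_ne_of_ne, swap_apply_of_ne_of_ne]
        all_goals
          rw [Ne, Fin.mk.injEq]
          omega
    rw [e, e, e, MultilinearMap.map_update_sub, h3 (Q (z ⟨2 * m + 1, by omega⟩) _)]
    simp only [Function.comp_apply, hc, swap_apply_left, swap_apply_right]
  simp_rw [h1, map_sub, mul_sub]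
  rw [Finset.sum_sub_distrib, sub_eq_add_neg]
  refine Eq.trans (congrArg _ ?_) (two_mul _).symm
  rw [← Finset.sum_neg_distrib, ← Equiv.sum_comp (Equiv.mulRight c)]
  refine Finset.sum_congr rfl fun s _ => ?_
  have h2 : (x ∘ ⇑(s * c)) ∘ ⇑c = x ∘ s := by
    funext i
    simp [hc]
  rw [Equiv.coe_mulRight, h2]
  simp [hsign]

/-- The factors are replaced one after another from the left, each at the cost of a factor `2`. -/
theorem sum_sign_pairProd_sub (τ : R →ₗ[ℂ] ℂ) (Q : R → R → R) (x : Fin (2 * k) → R) :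
    ∑ s : Perm (Fin (2 * k)), ((Perm.sign s : ℤ) : ℂ) *
        τ (pairProd (fun _ a b => Q a b - Q b a) (x ∘ s)) =
      2 ^ k * ∑ s : Perm (Fin (2 * k)), ((Perm.sign s : ℤ) : ℂ) *
        τ (pairProd (fun _ => Q) (x ∘ s)) := by
  have h : ∀ m ≤ k, ∑ s : Perm (Fin (2 * k)), ((Perm.sign s : ℤ) : ℂ) *
        τ (pairProd (fun _ a b => Q a b - Q b a) (x ∘ s)) =
      2 ^ m * ∑ s : Perm (Fin (2 * k)), ((Perm.sign s : ℤ) : ℂ) *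
        τ (pairProd (fun i a b => if (i : ℕ) < m then Q a b else Q a b - Q b a) (x ∘ s)) := by
    intro m
    induction m with
    | zero => simp
    | succ m ih =>
      intro hm
      set F : Fin k → R → R → R := fun i a b =>
        if (i : ℕ) < m then Q a b else Q a b - Q b a with hF
      have h1 : F = Function.update F ⟨m, hm⟩ fun a b => Q a b - Q b a := by
        rw [eq_comm, Function.update_eq_self_iff]
        simp [hF]
      have h2 : (fun (i : Fin k) a b => if (i : ℕ) < m + 1 then Q a b else Q a b - Q b a) =
          Function.update F ⟨m, hm⟩ Q := by
        funext i
        by_cases hi : i = ⟨m, hm⟩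
        · subst hi
          simp
        · have : (i : ℕ) ≠ m := fun e => hi (Fin.ext e)
          rw [Function.update_of_ne hi]
          funext a b
          simp only [hF]
          congr 1
          exact propext ⟨fun h => by omega, fun h => by omega⟩
      rw [ih (by omega), h2, h1, sum_sign_pairProd_update, ← h1, pow_succ, mul_assoc]
  rw [h k le_rfl]
  simp

end Multilinearity

/-! ### Closedness from the trace property. -/

section Cocycle

variable {R : Type*} [Ring R] [Algebra ℂ R] {k : ℕ}

attribute [local instance 100] LieRing.ofAssociativeRing

/-- The antisymmetrization of `τ (Ω x₀ x₁ * Ω x₂ x₃ * ⋯)`, where `Ω` is the curvature of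
`a ↦ a * p`, is closed if `τ` has the trace property. -/
theorem ceDiff_eq_zero_of_trace (τ : R →ₗ[ℂ] ℂ) (p : R) (c : ℂ) (φ : R [⋀^Fin (2 * k)]→ₗ[ℂ] ℂ)
    (hφ : ∀ z, φ z = c * ∑ s : Perm (Fin (2 * k)), ((Perm.sign s : ℤ) : ℂ) *
      τ (pairProd (fun _ a b => halfCurv p a b - halfCurv p b a) (z ∘ s)))
    (x : Fin (2 * k + 1) → R)
    (hτ : ∀ t : Perm (Fin (2 * k + 1)), ∀ j,
      τ (x j * p * pairProd (fun _ => halfCurv p) ((x ∘ t) ∘ Fin.succ)) =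
        τ (pairProd (fun _ => halfCurv p) ((x ∘ t) ∘ Fin.succ) * (x j * p))) :
    ceDiff φ x = 0 := by
  set T : (Fin (2 * k) → R) → ℂ := fun z => τ (pairProd (fun _ => halfCurv p) z) with hT
  have h1 : ∀ z, φ z = ∑ s : Perm (Fin (2 * k)), ((Perm.sign s : ℤ) : ℂ) *
      (c * 2 ^ k * T (z ∘ s)) := by
    intro z
    rw [hφ, sum_sign_pairProd_sub, Finset.mul_sum, Finset.mul_sum]
    exact Finset.sum_congr rfl fun s _ => by ring
  rw [ceDiff_eq_sum_contract φ (fun z => c * 2 ^ k * T z) h1, neg_eq_zero]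
  set W : (Fin (2 * k + 1) → R) → ℂ := fun z =>
    τ (pairProd (fun _ => halfCurv p) (z ∘ Fin.succ) * (z 0 * p)) with hW
  -- Of the two end terms of the telescoping sum, the trace property brings the first into the form
  -- `W`; the second already is `W`, at the tuple whose last entry has been rotated to the front.
  have h2 : ∀ t : Perm (Fin (2 * k + 1)), ∑ q : Fin (2 * k), (-1) ^ (q : ℕ) *
      (c * 2 ^ k * T fun i => contract q (extendZero (x ∘ t)) i) =
      c * 2 ^ k * (W (x ∘ t) - W (x ∘ ⇑(t * (finRotate (2 * k + 1))⁻¹))) := by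
    intro t
    have e1 : ∀ q, T (fun i => contract q (extendZero (x ∘ t)) i) =
        τ (seqProd (halfCurv p) k (contract q (extendZero (x ∘ t)))) := fun q => by
      rw [hT, ← pairProd_const_eq_seqProd _ _ _ fun i => rfl]
    have e2 : ∑ q : Fin (2 * k), (-1) ^ (q : ℕ) *
        (c * 2 ^ k * T fun i => contract q (extendZero (x ∘ t)) i) =
        c * 2 ^ k * τ (∑ q ∈ Finset.range (2 * k),
          (-1) ^ q * seqProd (halfCurv p) k (contract q (extendZero (x ∘ t)))) := by
      rw [map_sum, Finset.mul_sum, ← Fin.sum_univ_eq_sum_range (fun q => c * 2 ^ k *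
        τ ((-1) ^ q * seqProd (halfCurv p) k (contract q (extendZero (x ∘ t)))))]
      refine Finset.sum_congr rfl fun q _ => ?_
      rw [e1]
      rcases Nat.even_or_odd (q : ℕ) with h | h <;> simp [h.neg_one_pow]
    have e3 : seqProd (halfCurv p) k (fun i => extendZero (x ∘ t) (i + 1)) =
        pairProd (fun _ => halfCurv p) ((x ∘ t) ∘ Fin.succ) := by
      rw [pairProd_const_eq_seqProd]
      intro i
      rw [extendZero, dif_pos (by omega)]
      rfl
    have e4 : seqProd (halfCurv p) k (extendZero (x ∘ t)) =
        pairProd (fun _ => halfCurv p) ((x ∘ ⇑(t * (finRotate (2 * k + 1))⁻¹)) ∘ Fin.succ) := by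
      rw [pairProd_const_eq_seqProd]
      intro i
      have hi : (finRotate (2 * k + 1))⁻¹ i.succ = i.castSucc := by
        rw [Perm.inv_eq_iff_eq, finRotate_apply, Fin.coeSucc_eq_succ]
      rw [extendZero, dif_pos (by omega)]
      simp only [Function.comp_apply, Perm.mul_apply, hi]
      rfl
    have e5 : (x ∘ ⇑(t * (finRotate (2 * k + 1))⁻¹)) 0 = extendZero (x ∘ t) (2 * k) := by
      have hi : (finRotate (2 * k + 1))⁻¹ 0 = Fin.last (2 * k) := by
        rw [Perm.inv_eq_iff_eq, finRotate_last]
      rw [extendZero, dif_pos (by omega)]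
      simp only [Function.comp_apply, Perm.mul_apply, hi]
      rfl
    have e6 : extendZero (x ∘ t) 0 = x (t 0) := by
      rw [extendZero, dif_pos (by omega)]
      rfl
    rw [e2, sum_contract_seqProd, e3, e4, map_sub, e6, hτ, ← e5]
    rfl
  simp_rw [h2, mul_sub]
  rw [Finset.sum_sub_distrib, sub_eq_zero, eq_comm,
    ← Equiv.sum_comp (Equiv.mulRight (finRotate (2 * k + 1)))]
  refine Finset.sum_congr rfl fun t _ => ?_
  -- A cycle of odd length is even, so reindexing by the rotation costs no sign and the two sums
  -- agree.
  have h3 : Perm.sign (finRotate (2 * k + 1)) = 1 := by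
    rw [sign_finRotate]
    exact (even_two_mul k).neg_one_pow
  simp [h3]

end Cocycle

end PDOCocycle
end

noncomputable section

namespace PDOCocycle

/-! ### Weights and interchange of sums. -/

section Weights

/-- The weight `1 + |x|`. -/
def wt (x : ℝ) : ℝ := 1 + |x|

theorem one_le_wt (x : ℝ) : 1 ≤ wt x := le_add_of_nonneg_right (abs_nonneg x)

theorem wt_pos (x : ℝ) : 0 < wt x := zero_lt_one.trans_le (one_le_wt x)

/-- Peetre's inequality in its simplest form: a weight at `j` is exchanged for one at `k` at the
cost of a weight at `j - k`, which decay off the diagonal pays for. -/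
theorem wt_add_le (x y : ℝ) : wt (x + y) ≤ wt x * wt y := by
  unfold wt
  nlinarith [abs_add_le x y, mul_nonneg (abs_nonneg x) (abs_nonneg y)]

theorem wt_neg (x : ℝ) : wt (-x) = wt x := by
  rw [wt, abs_neg, wt]

theorem wt_le_mul_wt_sub (x y : ℝ) : wt x ≤ wt y * wt (x - y) := by
  simpa using wt_add_le y (x - y)

theorem wt_le_mul_wt_sub' (x y : ℝ) : wt x ≤ wt y * wt (y - x) := by
  rw [← wt_neg (y - x), neg_sub]
  exact wt_le_mul_wt_sub x y

theorem wt_pow_le_wt_pow (x : ℝ) {m n : ℕ} (h : m ≤ n) : wt x ^ m ≤ wt x ^ n :=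
  pow_le_pow_right₀ (one_le_wt x) h

theorem wt_pow_le (x : ℝ) (n : ℕ) : wt x ^ n ≤ 2 ^ n * (1 + |x| ^ n) := by
  have h := add_pow_le zero_le_one (abs_nonneg x) n
  rw [one_pow] at h
  refine h.trans ?_
  gcongr
  · exact one_le_two
  · exact Nat.sub_le n 1

/-- The comparison series behind most sums over frequencies below; it is the reason for the
recurring `+ 2` in the exponents. -/
theorem summable_inv_wt_sq : Summable fun k : ℤ => (wt k ^ 2)⁻¹ := by
  have hs : Summable fun k : ℤ => 1 / (k : ℝ) ^ 2 := Real.summable_one_div_int_pow.2 one_lt_two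
  refine Summable.of_norm_bounded_eventually hs ?_
  have : ({0} : Set ℤ)ᶜ ∈ (Filter.cofinite : Filter ℤ) := (Set.finite_singleton 0).compl_mem_cofinite
  filter_upwards [this] with k hk
  have hk0 : (0 : ℝ) < |(k : ℝ)| := abs_pos.2 (by exact_mod_cast hk)
  rw [Real.norm_of_nonneg (inv_nonneg.2 (sq_nonneg _)), one_div, ← sq_abs (k : ℝ)]
  have : |(k : ℝ)| ≤ wt k := le_add_of_nonneg_left zero_le_one
  gcongr

end Weights

/-- Fubini for a double series with known row and column sums. It carries the composition of
matrices, the passage from matrices to symbols, the independence of the trace from the basis, and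
its cyclicity. -/
theorem hasSum_swap {α β E : Type*} [NormedAddCommGroup E] [CompleteSpace E] {g : α × β → E}
    (hg : Summable g) {F : α → E} {G : β → E} {S : E} (hF : ∀ a, HasSum (fun b => g (a, b)) (F a))
    (hG : ∀ b, HasSum (fun a => g (a, b)) (G b)) (hS : HasSum F S) : HasSum G S := by
  have h1 : ∑' x, g x = S := (hg.hasSum.prod_fiberwise hF).unique hS
  have h2 : HasSum (g ∘ Prod.swap) S := by
    rw [← h1]
    exact (Equiv.prodComm β α).hasSum_iff.2 hg.hasSum
  exact h2.prod_fiberwise hG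

theorem completeSpace_of_finiteDimensional_complex (V : Type*) [NormedAddCommGroup V]
    [InnerProductSpace ℂ V] [FiniteDimensional ℂ V] : CompleteSpace V :=
  FiniteDimensional.complete ℂ V

attribute [local instance] completeSpace_of_finiteDimensional_complex

/-! ### Fourier inversion for vector-valued smooth functions. -/

section Coefficients

variable {V : Type*} [NormedAddCommGroup V] [InnerProductSpace ℂ V] [FiniteDimensional ℂ V]

/-- The Fourier coefficients of a smooth function. -/
def coef (f : CInf V) (k : ℤ) : V := fourierCoeff (f : S1 → V) k

omit [FiniteDimensional ℂ V] in
theorem coef_add (f g : CInf V) (k : ℤ) : coef (f + g) k = coef f k + coef g k :=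
  congrFun (fourierCoeff.add (CInf.integrable f) (CInf.integrable g)) k

omit [FiniteDimensional ℂ V] in
theorem coef_smul (c : ℂ) (f : CInf V) (k : ℤ) : coef (c • f) k = c • coef f k :=
  fourierCoeff.const_smul _ _ _

theorem summable_wt_mul_coef (f : CInf V) (n : ℕ) :
    Summable fun k : ℤ => wt k ^ n * ‖coef f k‖ := by
  have h := ((CInf.summable_pow_mul f 0).add (CInf.summable_pow_mul f n)).mul_left (2 ^ n)
  refine h.of_nonneg_of_le (fun k => by have := wt_pos k; positivity) fun k => ?_
  rw [← add_mul, ← mul_assoc, pow_zero]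
  exact mul_le_mul_of_nonneg_right (wt_pow_le _ _) (norm_nonneg _)

theorem summable_norm_coef (f : CInf V) : Summable fun k : ℤ => ‖coef f k‖ := by
  simpa using summable_wt_mul_coef f 0

theorem fourierCoeff_clm {E F : Type*} [NormedAddCommGroup E] [NormedSpace ℂ E] [CompleteSpace E]
    [NormedAddCommGroup F] [NormedSpace ℂ F] [CompleteSpace F] (L : E →L[ℂ] F) (f : S1 → E)
    (hf : Continuous f) (k : ℤ) :
    fourierCoeff (fun x => L (f x)) k = L (fourierCoeff f k) := by
  rw [fourierCoeff, fourierCoeff, ← L.integral_comp_comm]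
  · simp
  · exact (((map_continuous (fourier (-k))).smul hf).integrable_of_hasCompactSupport
      (HasCompactSupport.of_compactSpace _))

theorem norm_fourier_apply (k : ℤ) (x : S1) : ‖(fourier k x : ℂ)‖ = 1 := by
  rw [fourier_apply, Circle.norm_coe]

theorem summable_fourier_smul_coef (f : CInf V) (x : S1) :
    Summable fun k : ℤ => (fourier k x : ℂ) • coef f k :=
  (summable_norm_coef f).of_norm_bounded fun k => by
    rw [norm_smul, norm_fourier_apply, one_mul]

/-- Scalar Fourier inversion is applied to `⟪v, f x⟫` for every `v`. -/
theorem hasSum_fourier_coef (f : CInf V) (x : S1) :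
    HasSum (fun k : ℤ => (fourier k x : ℂ) • coef f k) (f x) := by
  have hs := summable_fourier_smul_coef f x
  have key : f x = ∑' k : ℤ, (fourier k x : ℂ) • coef f k := by
    refine ext_inner_left ℂ fun v => ?_
    let g : C(S1, ℂ) := ⟨fun x => inner ℂ v (f x), continuous_const.inner (CInf.continuous f)⟩
    have hg : ∀ k, fourierCoeff (g : S1 → ℂ) k = inner ℂ v (coef f k) := fun k =>
      fourierCoeff_clm (innerSL ℂ v) f (CInf.continuous f) k
    have hsum : Summable (fourierCoeff (g : S1 → ℂ)) := by
      refine ((summable_norm_coef f).mul_left ‖v‖).of_norm_bounded fun k => ?_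
      rw [hg]
      exact norm_inner_le_norm _ _
    have h1 := has_pointwise_sum_fourier_series_of_summable hsum x
    have h2 := (innerSL ℂ v).hasSum hs.hasSum
    have e : (fun k => fourierCoeff (g : S1 → ℂ) k • (fourier k x : ℂ)) =
        fun k => innerSL ℂ v ((fourier k x : ℂ) • coef f k) := by
      funext k
      simp only [hg, innerSL_apply_apply, inner_smul_right, smul_eq_mul, mul_comm]
    rw [e] at h1
    exact h1.unique h2
  rw [key]
  exact hs.hasSum

end Coefficients

/-! ### Tempered and rapidly decreasing matrices. -/

section Matrices

variable {V : Type*} [NormedAddCommGroup V] [InnerProductSpace ℂ V] [FiniteDimensional ℂ V]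

/-- `M j k` is the matrix of the operator `A` with respect to the Fourier modes. -/
def HasMatrix (A : Op V) (M : ℤ → ℤ → (V →L[ℂ] V)) : Prop :=
  ∀ f j, HasSum (fun k => M j k (coef f k)) (coef (A f) j)

/-- The product of infinite matrices. -/
def matMul (M N : ℤ → ℤ → (V →L[ℂ] V)) (j k : ℤ) : V →L[ℂ] V := ∑' r, M j r * N r k

/-- Matrices which act on rapidly decreasing sequences, as do their transposes. -/
def Tempered (M : ℤ → ℤ → (V →L[ℂ] V)) : Prop :=
  ∀ N : ℕ, ∃ (C : ℝ) (n : ℕ), ∀ j k : ℤ, wt k ^ N * ‖M j k‖ ≤ C * wt j ^ n ∧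
    wt j ^ N * ‖M j k‖ ≤ C * wt k ^ n

/-- Rapidly decreasing matrices. -/
def Rapid (M : ℤ → ℤ → (V →L[ℂ] V)) : Prop :=
  ∀ N : ℕ, ∃ C : ℝ, ∀ j k : ℤ, wt j ^ N * (wt k ^ N * ‖M j k‖) ≤ C

variable {M N : ℤ → ℤ → (V →L[ℂ] V)} {A B : Op V}

theorem nonneg_of_wt_mul_norm_le {a b c C : ℝ} {n : ℕ} (ha : 0 ≤ a) (hb : 0 ≤ b)
    (h : a * b ≤ C * wt c ^ n) : 0 ≤ C :=
  nonneg_of_mul_nonneg_left ((mul_nonneg ha hb).trans h) (pow_pos (wt_pos c) n)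

omit [FiniteDimensional ℂ V] in
theorem Rapid.tempered (hM : Rapid M) : Tempered M := by
  intro N
  obtain ⟨C, hC⟩ := hM N
  refine ⟨C, 0, fun j k => ?_⟩
  have h1 := one_le_pow₀ (one_le_wt j) (n := N)
  have h2 := one_le_pow₀ (one_le_wt k) (n := N)
  have h3 := norm_nonneg (M j k)
  rw [pow_zero, pow_zero, mul_one]
  refine ⟨le_trans ?_ (hC j k), le_trans ?_ (hC j k)⟩
  · exact le_mul_of_one_le_left (by positivity) h1
  · gcongr
    exact le_mul_of_one_le_left h3 h2

omit [FiniteDimensional ℂ V] in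
theorem Tempered.norm_row_le (hM : Tempered M) : ∃ (C : ℝ) (n : ℕ), 0 ≤ C ∧
    ∀ j r : ℤ, ‖M j r‖ ≤ C * wt j ^ n * (wt r ^ 2)⁻¹ := by
  obtain ⟨C, n, hC⟩ := hM 2
  refine ⟨C, n, nonneg_of_wt_mul_norm_le (pow_nonneg (wt_pos _).le 2) (norm_nonneg _) (hC 0 0).1,
    fun j r => ?_⟩
  rw [← div_eq_mul_inv, le_div_iff₀ (pow_pos (wt_pos _) 2), mul_comm]
  exact (hC j r).1

omit [FiniteDimensional ℂ V] in
theorem Tempered.norm_le (hM : Tempered M) : ∃ (C : ℝ) (n : ℕ), 0 ≤ C ∧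
    ∀ r k : ℤ, ‖M r k‖ ≤ C * wt k ^ n := by
  obtain ⟨C, n, hC⟩ := hM 0
  refine ⟨C, n, nonneg_of_wt_mul_norm_le (pow_nonneg (wt_pos _).le 0) (norm_nonneg _) (hC 0 0).1,
    fun j r => ?_⟩
  simpa using (hC j r).2

theorem Tempered.summable_mul (hM : Tempered M) (hN : Tempered N) (j k : ℤ) :
    Summable fun r => M j r * N r k := by
  obtain ⟨C, n, hC0, hC⟩ := hM.norm_row_le
  obtain ⟨C', n', hC0', hC'⟩ := hN.norm_le
  refine ((summable_inv_wt_sq.mul_left (C * wt j ^ n)).mul_right (C' * wt k ^ n')).of_norm_bounded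
    fun r => ?_
  refine (norm_mul_le _ _).trans ?_
  have := wt_pos j
  exact mul_le_mul (hC j r) (hC' r k) (norm_nonneg _) (by have := wt_pos r; positivity)

/-- The double series converges absolutely: the rows of `M` are summable over the middle index, and
the polynomial growth of `N` in the last index is absorbed by the decay of `coef f`. -/
theorem HasMatrix.mul (hA : HasMatrix A M) (hB : HasMatrix B N) (hM : Tempered M)
    (hN : Tempered N) : HasMatrix (A * B) (matMul M N) := by
  intro f j
  obtain ⟨C, n, hC0, hC⟩ := hM.norm_row_le
  obtain ⟨C', n', hC0', hC'⟩ := hN.norm_le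
  have hj := wt_pos j
  refine hasSum_swap (g := fun q : ℤ × ℤ => M j q.1 (N q.1 q.2 (coef f q.2))) ?_
    (fun r => ?_) (fun k => ?_) (hA (B f) j)
  · have h1 := (summable_inv_wt_sq.mul_left (C * wt j ^ n)).mul_of_nonneg
      ((summable_wt_mul_coef f n').mul_left C')
      (fun r => by have := wt_pos r; positivity) (fun k => by have := wt_pos k; positivity)
    refine h1.of_norm_bounded fun q => ?_
    refine ((M j q.1).le_opNorm _).trans ?_
    refine mul_le_mul (hC _ _) ?_ (norm_nonneg _) (by have := wt_pos q.1; positivity)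
    refine ((N q.1 q.2).le_opNorm _).trans ?_
    rw [← mul_assoc]
    exact mul_le_mul_of_nonneg_right (hC' _ _) (norm_nonneg _)
  · exact (M j r).hasSum (hB f r)
  · exact (hM.summable_mul hN j k).hasSum.mapL (ContinuousLinearMap.apply ℂ V (coef f k))

theorem norm_matMul_le {j k : ℤ} {w D : ℝ} (hw : 0 < w)
    (h : ∀ r : ℤ, w * (‖M j r‖ * ‖N r k‖) ≤ D * (wt r ^ 2)⁻¹) :
    w * ‖matMul M N j k‖ ≤ D * ∑' r : ℤ, (wt r ^ 2)⁻¹ := by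
  have h1 : ‖matMul M N j k‖ ≤ w⁻¹ * (D * ∑' r : ℤ, (wt r ^ 2)⁻¹) := by
    refine tsum_of_norm_bounded ((summable_inv_wt_sq.hasSum.mul_left D).mul_left w⁻¹) fun r => ?_
    refine (norm_mul_le _ _).trans ?_
    rw [le_inv_mul_iff₀ hw]
    exact h r
  rwa [le_inv_mul_iff₀ hw] at h1

/-- With `Tempered.matMul_rapid` this is the ideal property: the growth of the tempered factor in
the middle index is beaten by the decay of the other factor. -/
theorem Rapid.matMul_tempered (hM : Rapid M) (hN : Tempered N) : Rapid (matMul M N) := by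
  intro m
  obtain ⟨C, n, hC⟩ := hN m
  -- The exponent `m` is the decay wanted in `j`; in the middle index `n` absorbs the growth of `N`
  -- and `2` pays for the summation.
  obtain ⟨D, hD⟩ := hM (m + n + 2)
  have hC0 : 0 ≤ C :=
    nonneg_of_wt_mul_norm_le (pow_nonneg (wt_pos _).le _) (norm_nonneg _) (hC 0 0).1
  refine ⟨C * D * ∑' r : ℤ, (wt r ^ 2)⁻¹, fun j k => ?_⟩
  have hj := wt_pos j
  have hk := wt_pos k
  rw [← mul_assoc]
  refine norm_matMul_le (by positivity) fun r => ?_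
  have hr := wt_pos r
  rw [← div_eq_mul_inv, le_div_iff₀ (by positivity)]
  calc wt j ^ m * wt k ^ m * (‖M j r‖ * ‖N r k‖) * wt r ^ 2
      = wt j ^ m * (wt k ^ m * ‖N r k‖) * wt r ^ 2 * ‖M j r‖ := by ring
    _ ≤ wt j ^ (m + n + 2) * (C * wt r ^ n) * wt r ^ 2 * ‖M j r‖ := by
      gcongr ?_ * ?_ * _ * _
      · exact wt_pow_le_wt_pow _ (by omega)
      · exact (hC r k).1
    _ = C * (wt j ^ (m + n + 2) * (wt r ^ (n + 2) * ‖M j r‖)) := by ring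
    _ ≤ C * (wt j ^ (m + n + 2) * (wt r ^ (m + n + 2) * ‖M j r‖)) := by
      gcongr C * (_ * (?_ * _))
      exact wt_pow_le_wt_pow _ (by omega)
    _ ≤ C * D := by
      gcongr
      exact hD j r

theorem Tempered.matMul_rapid (hM : Tempered M) (hN : Rapid N) : Rapid (matMul M N) := by
  intro m
  obtain ⟨C, n, hC⟩ := hM m
  obtain ⟨D, hD⟩ := hN (m + n + 2)
  have hC0 : 0 ≤ C :=
    nonneg_of_wt_mul_norm_le (pow_nonneg (wt_pos _).le _) (norm_nonneg _) (hC 0 0).1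
  refine ⟨C * D * ∑' r : ℤ, (wt r ^ 2)⁻¹, fun j k => ?_⟩
  have hj := wt_pos j
  have hk := wt_pos k
  rw [← mul_assoc]
  refine norm_matMul_le (by positivity) fun r => ?_
  have hr := wt_pos r
  rw [← div_eq_mul_inv, le_div_iff₀ (by positivity)]
  calc wt j ^ m * wt k ^ m * (‖M j r‖ * ‖N r k‖) * wt r ^ 2
      = wt k ^ m * (wt j ^ m * ‖M j r‖) * wt r ^ 2 * ‖N r k‖ := by ring
    _ ≤ wt k ^ (m + n + 2) * (C * wt r ^ n) * wt r ^ 2 * ‖N r k‖ := by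
      gcongr ?_ * ?_ * _ * _
      · exact wt_pow_le_wt_pow _ (by omega)
      · exact (hC j r).2
    _ = C * (wt r ^ (n + 2) * (wt k ^ (m + n + 2) * ‖N r k‖)) := by ring
    _ ≤ C * (wt r ^ (m + n + 2) * (wt k ^ (m + n + 2) * ‖N r k‖)) := by
      gcongr C * (?_ * _)
      exact wt_pow_le_wt_pow _ (by omega)
    _ ≤ C * D := by
      gcongr
      exact hD r k

omit [FiniteDimensional ℂ V] in
theorem HasMatrix.add (hA : HasMatrix A M) (hB : HasMatrix B N) :
    HasMatrix (A + B) (M + N) := by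
  intro f j
  rw [LinearMap.add_apply, coef_add]
  exact (hA f j).add (hB f j)

omit [FiniteDimensional ℂ V] in
theorem HasMatrix.smul (c : ℂ) (hA : HasMatrix A M) : HasMatrix (c • A) (c • M) := by
  intro f j
  rw [LinearMap.smul_apply, coef_smul]
  exact (hA f j).const_smul c

omit [FiniteDimensional ℂ V] in
theorem Rapid.add (hM : Rapid M) (hN : Rapid N) : Rapid (M + N) := by
  intro m
  obtain ⟨C, hC⟩ := hM m
  obtain ⟨D, hD⟩ := hN m
  refine ⟨C + D, fun j k => le_trans ?_ (add_le_add (hC j k) (hD j k))⟩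
  have hj := wt_pos j
  have hk := wt_pos k
  rw [← mul_add, ← mul_add]
  gcongr
  exact norm_add_le _ _

theorem Rapid.smul (c : ℂ) (hM : Rapid M) : Rapid (c • M) := by
  intro m
  obtain ⟨C, hC⟩ := hM m
  refine ⟨‖c‖ * C, fun j k => ?_⟩
  have := mul_le_mul_of_nonneg_left (hC j k) (norm_nonneg c)
  refine le_trans (le_of_eq ?_) this
  rw [Pi.smul_apply, Pi.smul_apply, norm_smul]
  ring

/-- Operators with a rapidly decreasing matrix. -/
def rapidOps (V : Type*) [NormedAddCommGroup V] [InnerProductSpace ℂ V] [FiniteDimensional ℂ V] :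
    Submodule ℂ (Op V) where
  carrier := {A | ∃ M, Rapid M ∧ HasMatrix A M}
  add_mem' := fun ⟨M, hM, hA⟩ ⟨N, hN, hB⟩ => ⟨M + N, hM.add hN, hA.add hB⟩
  zero_mem' := ⟨0, fun _ => ⟨0, fun _ _ => by simp⟩, fun f j => by
    have : coef (0 : CInf V) j = 0 := by
      simpa using coef_smul (0 : ℂ) (0 : CInf V) j
    simp [this]⟩
  smul_mem' := fun c _ ⟨M, hM, hA⟩ => ⟨c • M, hM.smul c, hA.smul c⟩

end Matrices

end PDOCocycle
end

noncomputable section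

namespace PDOCocycle

/-! ### Termwise differentiation with only locally uniform bounds. -/

section SmoothSeries

variable {α : Type*} {E : Type} [NormedAddCommGroup E] [NormedSpace ℝ E]

/-- Termwise differentiation of series whose derivatives of all orders converge uniformly on
bounded sets. -/
theorem contDiff_tsum_and_norm_iteratedFDeriv_le (n : ℕ) :
    ∀ {F : Type*} [NormedAddCommGroup F] [NormedSpace ℝ F] [CompleteSpace F] {f : α → E → F},
    (∀ i, ContDiff ℝ ∞ (f i)) →
    (∀ (k : ℕ) (R : ℝ), ∃ v : α → ℝ, Summable v ∧
      ∀ i x, ‖x‖ < R → ‖iteratedFDeriv ℝ k (f i) x‖ ≤ v i) →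
    ContDiff ℝ n (fun x => ∑' i, f i x) ∧ ∀ (x : E) (w : α → ℝ), Summable w →
      (∀ i, ‖iteratedFDeriv ℝ n (f i) x‖ ≤ w i) →
      ‖iteratedFDeriv ℝ n (fun x => ∑' i, f i x) x‖ ≤ ∑' i, w i := by
  have hd : ∀ {F : Type _} [NormedAddCommGroup F] [NormedSpace ℝ F] [CompleteSpace F]
      {f : α → E → F}, (∀ i, ContDiff ℝ ∞ (f i)) →
      (∀ (k : ℕ) (R : ℝ), ∃ v : α → ℝ, Summable v ∧
        ∀ i x, ‖x‖ < R → ‖iteratedFDeriv ℝ k (f i) x‖ ≤ v i) →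
      ∀ x, HasFDerivAt (fun x => ∑' i, f i x) (∑' i, fderiv ℝ (f i) x) x := by
    intro F _ _ _ f hf hb x
    -- The ball contains `x`, where the derivative is wanted, and `0`, where convergence of the
    -- series itself is checked.
    obtain ⟨v, hv, hvb⟩ := hb 1 (‖x‖ + 1)
    obtain ⟨v', hv', hvb'⟩ := hb 0 1
    refine hasFDerivAt_tsum_of_isPreconnected (s := Metric.ball 0 (‖x‖ + 1)) (x₀ := 0) hv
      Metric.isOpen_ball (convex_ball _ _).isPreconnected
      (fun i y _ => ((hf i).differentiable (by simp) y).hasFDerivAt) (fun i y hy => ?_)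
      (Metric.mem_ball_self (by positivity)) ?_ (by simp)
    · rw [← norm_iteratedFDeriv_one]
      exact hvb i y (by simpa using hy)
    · refine hv'.of_norm_bounded fun i => ?_
      simpa using hvb' i 0 (by simp)
  -- The target space varies in the induction, since the derivative of the series has values in `E
  -- →L[ℝ] F`.
  induction n with
  | zero =>
    intro F _ _ _ f hf hb
    refine ⟨?_, fun x w hw hwb => ?_⟩
    · have : Differentiable ℝ (fun x => ∑' i, f i x) := fun x => (hd hf hb x).differentiableAt
      exact contDiff_zero.2 this.continuous
    · rw [norm_iteratedFDeriv_zero]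
      exact tsum_of_norm_bounded hw.hasSum fun i => by simpa using hwb i
  | succ n ih =>
    intro F _ _ _ f hf hb
    have h1 : fderiv ℝ (fun x => ∑' i, f i x) = fun x => ∑' i, fderiv ℝ (f i) x :=
      funext fun x => (hd hf hb x).fderiv
    obtain ⟨h2, h3⟩ := ih (f := fun i => fderiv ℝ (f i))
      (fun i => (hf i).fderiv_right (m := ∞) (by simp)) (fun k R => by
        obtain ⟨v, hv, hvb⟩ := hb (k + 1) R
        refine ⟨v, hv, fun i x hx => ?_⟩
        rw [norm_iteratedFDeriv_fderiv]
        exact hvb i x hx)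
    refine ⟨?_, fun x w hw hwb => ?_⟩
    · push_cast
      rw [contDiff_succ_iff_fderiv]
      refine ⟨fun x => (hd hf hb x).differentiableAt, by simp, ?_⟩
      rw [h1]
      exact h2
    · rw [← norm_iteratedFDeriv_fderiv, h1]
      refine h3 x w hw fun i => ?_
      rw [norm_iteratedFDeriv_fderiv]
      exact hwb i

end SmoothSeries

attribute [local instance] completeSpace_of_finiteDimensional_complex

/-! ### Symbols in terms of their Fourier coefficients, and their composition. -/

section ReducedSymbols

variable {V : Type*} [NormedAddCommGroup V] [InnerProductSpace ℂ V] [FiniteDimensional ℂ V]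

/-- The Fourier coefficients `c l ξ` of a symbol of order `m` with respect to `x`. -/
def IsFourierSymbol (m : ℕ) (c : ℤ → ℝ → (V →L[ℂ] V)) : Prop :=
  (∀ l, ContDiff ℝ ∞ (c l)) ∧ ∀ α N : ℕ, ∃ C : ℝ, ∀ (l : ℤ) (ξ : ℝ),
    wt l ^ N * (wt ξ ^ α * ‖iteratedFDeriv ℝ α (c l) ξ‖) ≤ C * wt ξ ^ m

theorem exists_summable_bound_of_growth {F : Type*} [NormedAddCommGroup F] [NormedSpace ℝ F]
    {m : ℕ} {f : ℤ → ℝ → F} (hb : ∀ k : ℕ, ∃ C : ℝ, ∀ (r : ℤ) (ξ : ℝ),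
      wt ξ ^ k * ‖iteratedFDeriv ℝ k (f r) ξ‖ ≤ C * wt ξ ^ m * (wt r ^ 2)⁻¹) (k : ℕ) (R : ℝ) :
    ∃ v : ℤ → ℝ, Summable v ∧ ∀ r ξ, ‖ξ‖ < R → ‖iteratedFDeriv ℝ k (f r) ξ‖ ≤ v r := by
  obtain ⟨C, hC⟩ := hb k
  refine ⟨fun r => C * (1 + R) ^ m * (wt r ^ 2)⁻¹, summable_inv_wt_sq.mul_left _,
    fun r ξ hξ => ?_⟩
  have h1 := hC r ξ
  have hr := wt_pos r
  have hξ0 := wt_pos ξ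
  have h2 : ‖iteratedFDeriv ℝ k (f r) ξ‖ ≤ wt ξ ^ k * ‖iteratedFDeriv ℝ k (f r) ξ‖ :=
    le_mul_of_one_le_left (norm_nonneg _) (one_le_pow₀ (one_le_wt ξ))
  have hC0 : 0 ≤ C := by
    have h3 : 0 ≤ C * wt ξ ^ m * (wt r ^ 2)⁻¹ := le_trans (by positivity) h1
    exact nonneg_of_mul_nonneg_left (nonneg_of_mul_nonneg_left h3 (by positivity))
      (by positivity)
  refine (h2.trans h1).trans ?_
  have h4 : wt ξ ≤ 1 + R := by
    rw [wt]
    linarith [Real.norm_eq_abs ξ]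
  change _ ≤ C * (1 + R) ^ m * (wt r ^ 2)⁻¹
  gcongr

theorem isFourierSymbol_tsum {m : ℕ} {f : ℤ → ℤ → ℝ → (V →L[ℂ] V)}
    (hf : ∀ l r, ContDiff ℝ ∞ (f l r))
    (hb : ∀ α N : ℕ, ∃ C : ℝ, ∀ (l r : ℤ) (ξ : ℝ),
      wt l ^ N * (wt ξ ^ α * ‖iteratedFDeriv ℝ α (f l r) ξ‖) ≤ C * wt ξ ^ m * (wt r ^ 2)⁻¹) :
    IsFourierSymbol m (fun l ξ => ∑' r, f l r ξ) := by
  have hloc : ∀ l (k : ℕ) (R : ℝ), ∃ v : ℤ → ℝ, Summable v ∧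
      ∀ r ξ, ‖ξ‖ < R → ‖iteratedFDeriv ℝ k (f l r) ξ‖ ≤ v r := by
    refine fun l => exists_summable_bound_of_growth (m := m) fun k => ?_
    obtain ⟨C, hC⟩ := hb k 0
    exact ⟨C, fun r ξ => by simpa using hC l r ξ⟩
  refine ⟨fun l => contDiff_infty.2 fun n =>
    (contDiff_tsum_and_norm_iteratedFDeriv_le n (hf l) (hloc l)).1, fun α N => ?_⟩
  obtain ⟨C, hC⟩ := hb α N
  refine ⟨C * ∑' r : ℤ, (wt r ^ 2)⁻¹, fun l ξ => ?_⟩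
  have hl := wt_pos l
  have hξ := wt_pos ξ
  have h := (contDiff_tsum_and_norm_iteratedFDeriv_le α (hf l) (hloc l)).2 ξ
    (fun r => (wt l ^ N * wt ξ ^ α)⁻¹ * (C * wt ξ ^ m * (wt r ^ 2)⁻¹))
    ((summable_inv_wt_sq.mul_left _).mul_left _) (fun r => by
      rw [le_inv_mul_iff₀ (by positivity), mul_assoc]
      exact hC l r ξ)
  rw [tsum_mul_left, tsum_mul_left, le_inv_mul_iff₀ (by positivity), mul_assoc] at h
  refine h.trans (le_of_eq ?_)
  ring

omit [FiniteDimensional ℂ V] in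
theorem IsFourierSymbol.nonneg {m : ℕ} {c : ℤ → ℝ → (V →L[ℂ] V)} {α N : ℕ} {C : ℝ}
    (hC : ∀ (l : ℤ) (ξ : ℝ),
      wt l ^ N * (wt ξ ^ α * ‖iteratedFDeriv ℝ α (c l) ξ‖) ≤ C * wt ξ ^ m) : 0 ≤ C := by
  have h := hC 0 0
  have := wt_pos ((0 : ℤ) : ℝ)
  have := wt_pos (0 : ℝ)
  exact nonneg_of_mul_nonneg_left (le_trans (by positivity) h) (by positivity)

/-- The symbol of the composition of two operators. -/
theorem IsFourierSymbol.comp {m n : ℕ} {a b : ℤ → ℝ → (V →L[ℂ] V)} (ha : IsFourierSymbol m a)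
    (hb : IsFourierSymbol n b) :
    IsFourierSymbol (m + n) fun l ξ => ∑' r : ℤ, a (l - r) (ξ + r) * b r ξ := by
  have hshift : ∀ l r : ℤ, ContDiff ℝ ∞ fun ξ : ℝ => a (l - r) (ξ + r) := fun l r =>
    (ha.1 (l - r)).comp (contDiff_id.add contDiff_const)
  refine isFourierSymbol_tsum (fun l r => (hshift l r).mul (hb.1 r)) fun α N => ?_
  choose A hA using fun i => ha.2 i N
  -- Each summand of the exponent is a power of `wt r` produced below: `N` from `wt l ≤ wt r * wt (l
  -- - r)`, `i` from `wt ξ ≤ wt r * wt (ξ + r)`, `m` from `wt (ξ + r) ≤ wt ξ * wt r`, and `2` for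
  -- the sum over `r`.
  choose B hB using fun i => hb.2 (α - i) (N + i + m + 2)
  refine ⟨∑ i ∈ Finset.range (α + 1), (α.choose i : ℝ) * (A i * B i), fun l r ξ => ?_⟩
  have hl := wt_pos l
  have hr := wt_pos r
  have hξ := wt_pos ξ
  have hξr := wt_pos (ξ + r)
  have hlr := wt_pos ((l - r : ℤ) : ℝ)
  have h1 := norm_iteratedFDeriv_mul_le (hshift l r) (hb.1 r) ξ (n := α) (by exact_mod_cast le_top)
  refine (mul_le_mul_of_nonneg_left (mul_le_mul_of_nonneg_left h1 (by positivity))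
    (by positivity)).trans ?_
  rw [Finset.mul_sum, Finset.mul_sum, Finset.sum_mul, Finset.sum_mul]
  refine Finset.sum_le_sum fun i hi => ?_
  rw [iteratedFDeriv_comp_add_right i (r : ℝ) ξ]
  have hiα : i ≤ α := Nat.lt_succ_iff.1 (Finset.mem_range.1 hi)
  have hA0 : 0 ≤ A i := IsFourierSymbol.nonneg (hA i)
  have hB0 : 0 ≤ B i := IsFourierSymbol.nonneg (hB i)
  set X := ‖iteratedFDeriv ℝ i (a (l - r)) (ξ + r)‖ with hX
  set Y := ‖iteratedFDeriv ℝ (α - i) (b r) ξ‖ with hY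
  have hX0 : 0 ≤ X := norm_nonneg _
  have hY0 : 0 ≤ Y := norm_nonneg _
  have w1 : wt l ≤ wt r * wt ((l - r : ℤ) : ℝ) := by
    push_cast
    exact wt_le_mul_wt_sub _ _
  have w2 : wt ξ ≤ wt r * wt (ξ + r) := by
    have := wt_add_le (ξ + r) (-r)
    rwa [add_neg_cancel_right, wt_neg, mul_comm] at this
  have w3 : wt (ξ + r) ≤ wt ξ * wt r := wt_add_le _ _
  rw [← div_eq_mul_inv, le_div_iff₀ (by positivity)]
  calc wt l ^ N * (wt ξ ^ α * (α.choose i * X * Y)) * wt r ^ 2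
      = α.choose i * (wt l ^ N * (wt ξ ^ i * X) * (wt ξ ^ (α - i) * Y) * wt r ^ 2) := by
        rw [← pow_mul_pow_sub (wt ξ) hiα]
        ring
    _ ≤ α.choose i * ((wt r * wt ((l - r : ℤ) : ℝ)) ^ N * ((wt r * wt (ξ + r)) ^ i * X) *
          (wt ξ ^ (α - i) * Y) * wt r ^ 2) := by
        gcongr
    _ = α.choose i * ((wt ((l - r : ℤ) : ℝ) ^ N * (wt (ξ + r) ^ i * X)) *
          (wt r ^ (N + i + 2) * (wt ξ ^ (α - i) * Y))) := by ring
    _ ≤ α.choose i * ((A i * wt (ξ + r) ^ m) * (wt r ^ (N + i + 2) * (wt ξ ^ (α - i) * Y))) := by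
        gcongr α.choose i * (?_ * _)
        exact hA i (l - r) (ξ + r)
    _ ≤ α.choose i * ((A i * (wt ξ * wt r) ^ m) *
          (wt r ^ (N + i + 2) * (wt ξ ^ (α - i) * Y))) := by
        gcongr
    _ = α.choose i * (A i * wt ξ ^ m * (wt r ^ (N + i + m + 2) * (wt ξ ^ (α - i) * Y))) := by
        ring
    _ ≤ α.choose i * (A i * wt ξ ^ m * (B i * wt ξ ^ n)) := by
        gcongr α.choose i * (_ * ?_)
        exact hB i r ξ
    _ = _ := by ring

/-- The order `m + n` serves only as a common upper bound of `m` and `n`. -/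
theorem IsFourierSymbol.add {m n : ℕ} {a b : ℤ → ℝ → (V →L[ℂ] V)} (ha : IsFourierSymbol m a)
    (hb : IsFourierSymbol n b) : IsFourierSymbol (m + n) (fun l ξ => a l ξ + b l ξ) := by
  refine ⟨fun l => (ha.1 l).add (hb.1 l), fun α N => ?_⟩
  obtain ⟨A, hA⟩ := ha.2 α N
  obtain ⟨B, hB⟩ := hb.2 α N
  refine ⟨A + B, fun l ξ => ?_⟩
  have hA0 : 0 ≤ A := IsFourierSymbol.nonneg hA
  have hB0 : 0 ≤ B := IsFourierSymbol.nonneg hB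
  have hl := wt_pos l
  have hξ := wt_pos ξ
  have h1 : iteratedFDeriv ℝ α (fun ξ => a l ξ + b l ξ) ξ =
      iteratedFDeriv ℝ α (a l) ξ + iteratedFDeriv ℝ α (b l) ξ :=
    iteratedFDeriv_add_apply ((ha.1 l).of_le (by exact_mod_cast le_top)).contDiffAt
      ((hb.1 l).of_le (by exact_mod_cast le_top)).contDiffAt
  rw [h1]
  calc _ ≤ wt l ^ N * (wt ξ ^ α *
        (‖iteratedFDeriv ℝ α (a l) ξ‖ + ‖iteratedFDeriv ℝ α (b l) ξ‖)) := by
        gcongr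
        exact norm_add_le _ _
    _ = wt l ^ N * (wt ξ ^ α * ‖iteratedFDeriv ℝ α (a l) ξ‖) +
        wt l ^ N * (wt ξ ^ α * ‖iteratedFDeriv ℝ α (b l) ξ‖) := by ring
    _ ≤ A * wt ξ ^ m + B * wt ξ ^ n := add_le_add (hA l ξ) (hB l ξ)
    _ ≤ A * wt ξ ^ (m + n) + B * wt ξ ^ (m + n) := by
        gcongr
        all_goals first | exact one_le_wt ξ | omega
    _ = _ := by ring

/-- Symbols which do not depend on `x`, and are of order `0`. -/
theorem isFourierSymbol_single {c : ℝ → (V →L[ℂ] V)} (hc : ContDiff ℝ ∞ c)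
    (hb : ∀ α : ℕ, ∃ C : ℝ, ∀ ξ : ℝ, wt ξ ^ α * ‖iteratedFDeriv ℝ α c ξ‖ ≤ C) :
    IsFourierSymbol 0 (fun l => if l = 0 then c else fun _ => 0) := by
  refine ⟨fun l => ?_, fun α N => ?_⟩
  · dsimp only
    split_ifs
    · exact hc
    · exact contDiff_const
  · obtain ⟨C, hC⟩ := hb α
    have hC0 : 0 ≤ C := le_trans (by have := wt_pos 0; positivity) (hC 0)
    refine ⟨C, fun l ξ => ?_⟩
    rw [pow_zero, mul_one]
    by_cases hl : l = 0
    · simpa [hl, wt] using hC ξ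
    · have : iteratedFDeriv ℝ α (fun _ : ℝ => (0 : V →L[ℂ] V)) ξ = 0 := by
        have := congrFun (iteratedFDeriv_fun_zero (𝕜 := ℝ) (E := ℝ) (F := V →L[ℂ] V) (n := α)) ξ
        exact this
      simp [hl, this, hC0]

end ReducedSymbols

end PDOCocycle
end

noncomputable section

namespace PDOCocycle

/-! ### From Fourier coefficients back to symbols and operators. -/

section FourierSeries

variable {F : Type*} [NormedAddCommGroup F] [NormedSpace ℂ F]

theorem norm_exp_int_mul (l : ℤ) (y : ℝ) : ‖Complex.exp ((l * Complex.I) * y)‖ = 1 := by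
  rw [Complex.norm_exp]
  simp

theorem norm_int_mul_I_pow (l : ℤ) (n : ℕ) : ‖((l : ℂ) * Complex.I) ^ n‖ = |(l : ℝ)| ^ n := by
  rw [norm_pow, norm_mul, Complex.norm_I, mul_one, Complex.norm_intCast]

theorem abs_pow_le_wt_pow (x : ℝ) (n : ℕ) : |x| ^ n ≤ wt x ^ n :=
  pow_le_pow_left₀ (abs_nonneg x) (le_add_of_nonneg_left zero_le_one) n

theorem contDiff_exp_mul (a : ℂ) : ContDiff ℝ ∞ (fun y : ℝ => Complex.exp (a * y)) := by
  have : ContDiff ℝ ∞ (fun x : ℝ => (x : ℂ)) := Complex.ofRealCLM.contDiff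
  exact (contDiff_const.mul this).cexp

theorem iteratedDeriv_exp_mul (a : ℂ) (n : ℕ) :
    iteratedDeriv n (fun y : ℝ => Complex.exp (a * y)) =
      fun y : ℝ => a ^ n * Complex.exp (a * y) := by
  have := iteratedDeriv_exp_smul a (1 : ℂ) n
  simpa using this

theorem iteratedDeriv_fourierSeries [CompleteSpace F] (n : ℕ) : ∀ {d : ℤ → F},
    (∀ N : ℕ, Summable fun l : ℤ => wt l ^ N * ‖d l‖) →
    iteratedDeriv n (fun y : ℝ => ∑' l : ℤ, Complex.exp ((l * Complex.I) * y) • d l) =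
      fun y : ℝ => ∑' l : ℤ, Complex.exp ((l * Complex.I) * y) • (((l : ℂ) * Complex.I) ^ n • d l) := by
  induction n with
  | zero =>
    intro d _
    simp
  | succ n ih =>
    intro d hd
    have h1 : deriv (fun y : ℝ => ∑' l : ℤ, Complex.exp ((l * Complex.I) * y) • d l) =
        fun y : ℝ => ∑' l : ℤ, Complex.exp ((l * Complex.I) * y) • (((l : ℂ) * Complex.I) • d l) := by
      funext y
      refine (hasDerivAt_tsum (u := fun l : ℤ => wt l ^ 1 * ‖d l‖) (y₀ := y)
        (g := fun (l : ℤ) (y : ℝ) => Complex.exp ((l * Complex.I) * y) • d l)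
        (g' := fun (l : ℤ) (y : ℝ) =>
          Complex.exp ((l * Complex.I) * y) • (((l : ℂ) * Complex.I) • d l)) (hd 1)
        (fun l y => ?_) (fun l y => ?_) ?_ y).deriv
      · have := (hasDerivAt_expR ((l : ℂ) * Complex.I) y).smul_const (d l)
        rw [mul_smul, smul_comm] at this
        exact this
      · rw [norm_smul, norm_exp_int_mul, one_mul, norm_smul, ← pow_one ((l : ℂ) * Complex.I),
          norm_int_mul_I_pow]
        exact mul_le_mul_of_nonneg_right (abs_pow_le_wt_pow _ _) (norm_nonneg _)
      · refine (hd 0).of_norm_bounded fun l => ?_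
        rw [norm_smul, norm_exp_int_mul, pow_zero]
    rw [iteratedDeriv_succ', h1, ih]
    · funext y
      simp only [smul_smul, pow_succ]
    · intro N
      refine (hd (N + 1)).of_nonneg_of_le (fun l => by have := wt_pos l; positivity) fun l => ?_
      rw [norm_smul, ← pow_one ((l : ℂ) * Complex.I), norm_int_mul_I_pow, pow_succ (wt _), mul_assoc]
      have := wt_pos l
      gcongr
      exact (abs_pow_le_wt_pow _ _).trans_eq (pow_one _)

end FourierSeries

theorem norm_iteratedFDeriv_comp_le {G E F : Type*} [NormedAddCommGroup G] [NormedSpace ℝ G]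
    [NormedAddCommGroup E] [NormedSpace ℝ E] [NormedAddCommGroup F] [NormedSpace ℝ F]
    (g : G →L[ℝ] E) (hg : ‖g‖ ≤ 1) {f : E → F} (hf : ContDiff ℝ ∞ f) (x : G) (i : ℕ) :
    ‖iteratedFDeriv ℝ i (fun y => f (g y)) x‖ ≤ ‖iteratedFDeriv ℝ i f (g x)‖ := by
  have h := g.iteratedFDeriv_comp_right hf x (i := i) (by exact_mod_cast le_top)
  change ‖iteratedFDeriv ℝ i (f ∘ g) x‖ ≤ _
  rw [h]
  refine (ContinuousMultilinearMap.norm_compContinuousLinearMap_le _ _).trans ?_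
  refine mul_le_of_le_one_right (norm_nonneg _) ?_
  exact Finset.prod_le_one (fun _ _ => norm_nonneg _) fun _ _ => hg

attribute [local instance] completeSpace_of_finiteDimensional_complex

section SymbolMatrix

variable {V : Type*} [NormedAddCommGroup V] [InnerProductSpace ℂ V] [FiniteDimensional ℂ V]
variable {m : ℕ} {c : ℤ → ℝ → (V →L[ℂ] V)}

theorem IsFourierSymbol.exists_bound (hc : IsFourierSymbol m c) (α N : ℕ) :
    ∃ C : ℝ, 0 ≤ C ∧ ∀ (l : ℤ) (ξ : ℝ),
      wt l ^ N * ‖iteratedFDeriv ℝ α (c l) ξ‖ ≤ C * wt ξ ^ m := by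
  obtain ⟨C, hC⟩ := hc.2 α N
  refine ⟨C, IsFourierSymbol.nonneg hC, fun l ξ => le_trans ?_ (hC l ξ)⟩
  have := wt_pos l
  gcongr
  exact le_mul_of_one_le_left (norm_nonneg _) (one_le_pow₀ (one_le_wt ξ))

theorem IsFourierSymbol.norm_le (hc : IsFourierSymbol m c) (N : ℕ) :
    ∃ C : ℝ, 0 ≤ C ∧ ∀ (l : ℤ) (ξ : ℝ), wt l ^ N * ‖c l ξ‖ ≤ C * wt ξ ^ m := by
  simpa only [norm_iteratedFDeriv_zero] using hc.exists_bound 0 N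

/-- Decay in `j - k` allows the weights at `j` and `k` to be exchanged; the additional exponent `m`
compensates the growth of the symbol in `k`. -/
theorem IsFourierSymbol.tempered (hc : IsFourierSymbol m c) :
    Tempered fun j k => c (j - k) k := by
  intro N
  obtain ⟨C, hC0, hC⟩ := hc.norm_le (N + m)
  refine ⟨C, N + m, fun j k => ?_⟩
  have h := hC (j - k) k
  have hj := wt_pos j
  have hk := wt_pos k
  have hjk := wt_pos ((j - k : ℤ) : ℝ)
  have h1 : wt k ≤ wt j * wt ((j - k : ℤ) : ℝ) := by
    push_cast
    exact wt_le_mul_wt_sub' _ _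
  have h2 : wt j ≤ wt k * wt ((j - k : ℤ) : ℝ) := by
    push_cast
    exact wt_le_mul_wt_sub _ _
  constructor
  · refine le_of_mul_le_mul_right ?_ (pow_pos hk m)
    calc wt k ^ N * ‖c (j - k) k‖ * wt k ^ m = wt k ^ (N + m) * ‖c (j - k) k‖ := by ring
      _ ≤ (wt j * wt ((j - k : ℤ) : ℝ)) ^ (N + m) * ‖c (j - k) k‖ := by gcongr
      _ = wt j ^ (N + m) * (wt ((j - k : ℤ) : ℝ) ^ (N + m) * ‖c (j - k) k‖) := by ring
      _ ≤ wt j ^ (N + m) * (C * wt k ^ m) := by gcongr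
      _ = _ := by ring
  · calc wt j ^ N * ‖c (j - k) k‖ ≤ (wt k * wt ((j - k : ℤ) : ℝ)) ^ N * ‖c (j - k) k‖ := by gcongr
      _ = wt k ^ N * (wt ((j - k : ℤ) : ℝ) ^ N * ‖c (j - k) k‖) := by ring
      _ ≤ wt k ^ N * (wt ((j - k : ℤ) : ℝ) ^ (N + m) * ‖c (j - k) k‖) := by
        gcongr wt k ^ N * (?_ * _)
        exact wt_pow_le_wt_pow _ (by omega)
      _ ≤ wt k ^ N * (C * wt k ^ m) := by gcongr
      _ = _ := by ring

omit [FiniteDimensional ℂ V] in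
theorem Tempered.norm_col_le {M : ℤ → ℤ → (V →L[ℂ] V)} (hM : Tempered M) :
    ∃ (C : ℝ) (n : ℕ), 0 ≤ C ∧ ∀ j k : ℤ, ‖M j k‖ ≤ (wt j ^ 2)⁻¹ * (C * wt k ^ n) := by
  obtain ⟨C, n, hC⟩ := hM 2
  refine ⟨C, n, nonneg_of_wt_mul_norm_le (pow_nonneg (wt_pos _).le 2) (norm_nonneg _) (hC 0 0).1,
    fun j r => ?_⟩
  rw [le_inv_mul_iff₀ (pow_pos (wt_pos _) 2)]
  exact (hC j r).2

theorem Tempered.summable_mul_coef {M : ℤ → ℤ → (V →L[ℂ] V)} (hM : Tempered M) (f : CInf V) :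
    Summable fun q : ℤ × ℤ => ‖M q.1 q.2 (coef f q.2)‖ := by
  obtain ⟨C, n, hC0, hC⟩ := hM.norm_col_le
  refine (summable_inv_wt_sq.mul_of_nonneg ((summable_wt_mul_coef f n).mul_left C)
    (fun r => by have := wt_pos r; positivity)
    (fun k => by have := wt_pos k; positivity)).of_nonneg_of_le (fun q => norm_nonneg _)
    fun q => ?_
  refine ((M q.1 q.2).le_opNorm _).trans ?_
  rw [← mul_assoc C, ← mul_assoc]
  exact mul_le_mul_of_nonneg_right (hC _ _) (norm_nonneg _)

/-- The symbol with given Fourier coefficients. -/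
def symbolOf (c : ℤ → ℝ → (V →L[ℂ] V)) (x : S1) (ξ : ℝ) : V →L[ℂ] V :=
  ∑' l : ℤ, (fourier l x : ℂ) • c l ξ

theorem IsFourierSymbol.summable_wt_mul_norm (hc : IsFourierSymbol m c) (ξ : ℝ) (N : ℕ) :
    Summable fun l : ℤ => wt l ^ N * ‖c l ξ‖ := by
  obtain ⟨C, hC0, hC⟩ := hc.norm_le (N + 2)
  refine (summable_inv_wt_sq.mul_left (C * wt ξ ^ m)).of_nonneg_of_le
    (fun l => by have := wt_pos l; positivity) fun l => ?_
  have := wt_pos l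
  rw [← div_eq_mul_inv, le_div_iff₀ (by positivity)]
  calc _ = wt l ^ (N + 2) * ‖c l ξ‖ := by ring
    _ ≤ _ := hC l ξ

theorem IsFourierSymbol.contDiff_symbolOf (hc : IsFourierSymbol m c) :
    ContDiff ℝ ∞ fun q : ℝ × ℝ => symbolOf c (q.1 : S1) q.2 := by
  have he : ∀ l : ℤ, ContDiff ℝ ∞ fun q : ℝ × ℝ => Complex.exp ((l * Complex.I) * q.1) :=
    fun l => (contDiff_exp_mul _).comp contDiff_fst
  have hcs : ∀ l : ℤ, ContDiff ℝ ∞ fun q : ℝ × ℝ => c l q.2 := fun l =>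
    (hc.1 l).comp contDiff_snd
  simp only [symbolOf, fourier_two_pi]
  refine contDiff_infty.2 fun n => (contDiff_tsum_and_norm_iteratedFDeriv_le n
    (fun l => (he l).smul (hcs l)) fun k R => ?_).1
  -- At most `k` powers of `l` come from differentiating the exponential; `2` more make the series
  -- summable.
  choose C hC0 hC using fun i => hc.exists_bound (k - i) (k + 2)
  refine ⟨fun l => (∑ i ∈ Finset.range (k + 1), k.choose i * (C i * (1 + R) ^ m)) *
    (wt l ^ 2)⁻¹, summable_inv_wt_sq.mul_left _, fun l q hq => ?_⟩
  refine (norm_iteratedFDeriv_smul_le (he l) (hcs l) q (n := k) (by exact_mod_cast le_top)).trans ?_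
  change _ ≤ (∑ i ∈ Finset.range (k + 1), (k.choose i : ℝ) * (C i * (1 + R) ^ m)) * (wt l ^ 2)⁻¹
  rw [Finset.sum_mul]
  refine Finset.sum_le_sum fun i hi => ?_
  have hl := wt_pos l
  have hik : i ≤ k := Nat.lt_succ_iff.1 (Finset.mem_range.1 hi)
  have h1 : ‖iteratedFDeriv ℝ i (fun q : ℝ × ℝ => Complex.exp ((l * Complex.I) * q.1)) q‖ ≤
      wt l ^ k := by
    refine (norm_iteratedFDeriv_comp_le (ContinuousLinearMap.fst ℝ ℝ ℝ)
      (ContinuousLinearMap.norm_fst_le ..) (contDiff_exp_mul _) q i).trans ?_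
    rw [norm_iteratedFDeriv_eq_norm_iteratedDeriv, iteratedDeriv_exp_mul, norm_mul,
      norm_int_mul_I_pow, norm_exp_int_mul, mul_one]
    exact (abs_pow_le_wt_pow _ _).trans (wt_pow_le_wt_pow _ hik)
  have h2 : ‖iteratedFDeriv ℝ (k - i) (fun q : ℝ × ℝ => c l q.2) q‖ ≤
      ‖iteratedFDeriv ℝ (k - i) (c l) q.2‖ :=
    norm_iteratedFDeriv_comp_le (ContinuousLinearMap.snd ℝ ℝ ℝ)
      (ContinuousLinearMap.norm_snd_le ..) (hc.1 l) q (k - i)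
  have h3 : wt q.2 ≤ 1 + R := by
    have := (norm_snd_le q).trans hq.le
    rw [wt]
    linarith [Real.norm_eq_abs q.2]
  have h4 := wt_pos q.2
  rw [← div_eq_mul_inv, le_div_iff₀ (by positivity)]
  calc _ ≤ k.choose i * wt l ^ k * ‖iteratedFDeriv ℝ (k - i) (c l) q.2‖ * wt l ^ 2 := by
        gcongr
    _ = k.choose i * (wt l ^ (k + 2) * ‖iteratedFDeriv ℝ (k - i) (c l) q.2‖) := by ring
    _ ≤ k.choose i * (C i * wt q.2 ^ m) := by
        gcongr _ * ?_
        exact hC i l q.2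
    _ ≤ _ := by
        have := hC0 i
        gcongr

theorem IsFourierSymbol.isSymbol_symbolOf (hc : IsFourierSymbol m c) :
    IsSymbol (m : ℝ) (symbolOf c) := by
  refine ⟨hc.contDiff_symbolOf, fun α β => ?_⟩
  -- The derivatives in `x` produce `β` powers of `l`, and `2` more are spent on the sum over `l`.
  obtain ⟨C, hC⟩ := hc.2 α (β + 2)
  have hC0 := IsFourierSymbol.nonneg hC
  refine ⟨C * ∑' l : ℤ, (wt l ^ 2)⁻¹, fun x ξ => ?_⟩
  have h1 : (fun η : ℝ => iteratedDeriv β (fun y : ℝ => symbolOf c (y : S1) η) x) = fun η =>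
      ∑' l : ℤ, (Complex.exp ((l * Complex.I) * x) * ((l : ℂ) * Complex.I) ^ β) • c l η := by
    funext η
    simp only [symbolOf, fourier_two_pi]
    rw [iteratedDeriv_fourierSeries β (hc.summable_wt_mul_norm η)]
    simp only [smul_smul]
  set K : ℤ → ℂ := fun l => Complex.exp ((l * Complex.I) * x) * ((l : ℂ) * Complex.I) ^ β with hK
  have hKn : ∀ l, ‖K l‖ ≤ wt l ^ β := fun l => by
    rw [hK, norm_mul, norm_exp_int_mul, one_mul, norm_int_mul_I_pow]
    exact abs_pow_le_wt_pow _ _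
  have hKs : ∀ l, ContDiff ℝ ∞ fun η => K l • c l η := fun l =>
    (contDiff_const : ContDiff ℝ ∞ fun _ : ℝ => K l).smul (hc.1 l)
  have hb : ∀ (a : ℕ) (D : ℝ), (∀ (l : ℤ) (ξ : ℝ), wt l ^ (β + 2) *
      (wt ξ ^ a * ‖iteratedFDeriv ℝ a (c l) ξ‖) ≤ D * wt ξ ^ m) → ∀ (l : ℤ) (ξ : ℝ),
      wt ξ ^ a * ‖iteratedFDeriv ℝ a (fun η => K l • c l η) ξ‖ ≤ D * wt ξ ^ m * (wt l ^ 2)⁻¹ := by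
    intro a D hD l ξ
    have hl := wt_pos l
    have hξ := wt_pos ξ
    have h2 : iteratedFDeriv ℝ a (fun η => K l • c l η) ξ = K l • iteratedFDeriv ℝ a (c l) ξ := by
      change iteratedFDeriv ℝ a (K l • c l) ξ = _
      exact iteratedFDeriv_const_smul_apply ((hc.1 l).of_le (by exact_mod_cast le_top)).contDiffAt
    rw [h2, norm_smul, ← div_eq_mul_inv, le_div_iff₀ (by positivity)]
    calc _ ≤ wt ξ ^ a * (wt l ^ β * ‖iteratedFDeriv ℝ a (c l) ξ‖) * wt l ^ 2 := by
          gcongr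
          exact hKn l
      _ = wt l ^ (β + 2) * (wt ξ ^ a * ‖iteratedFDeriv ℝ a (c l) ξ‖) := by ring
      _ ≤ _ := hD l ξ
  rw [h1, ← norm_iteratedFDeriv_eq_norm_iteratedDeriv]
  have hξ := wt_pos ξ
  have h3 := (contDiff_tsum_and_norm_iteratedFDeriv_le α hKs
    (exists_summable_bound_of_growth (m := m) fun k => by
      obtain ⟨D, hD⟩ := hc.2 k (β + 2)
      exact ⟨D, hb k D hD⟩)).2 ξ (fun l => (wt ξ ^ α)⁻¹ * (C * wt ξ ^ m * (wt l ^ 2)⁻¹))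
    ((summable_inv_wt_sq.mul_left _).mul_left _) (fun l => by
      rw [le_inv_mul_iff₀ (by positivity)]
      exact hb α C hC l ξ)
  refine h3.trans (le_of_eq ?_)
  rw [tsum_mul_left, tsum_mul_left, Real.rpow_sub (by positivity), Real.rpow_natCast,
    Real.rpow_natCast]
  change _ = C * _ * (wt ξ ^ m / wt ξ ^ α)
  rw [div_eq_mul_inv]
  ring

/-- The double series with terms `e^{ijx} c (j - k) k f̂(k)` gives `A f x` if it is summed over `k`
first, and the quantization of `symbolOf c` if it is summed over `j = l + k` first. -/
theorem IsFourierSymbol.isPDO (hc : IsFourierSymbol m c) {A : Op V}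
    (hA : HasMatrix A fun j k => c (j - k) k) : IsPDO A := by
  refine ⟨m, symbolOf c, hc.isSymbol_symbolOf, fun f x => ?_⟩
  refine hasSum_swap (g := fun q : ℤ × ℤ => (fourier q.1 x : ℂ) • c (q.1 - q.2) q.2 (coef f q.2))
    ?_ (fun j => (hA f j).const_smul (fourier j x : ℂ)) (fun k => ?_)
    (hasSum_fourier_coef (A f) x)
  · refine (hc.tempered.summable_mul_coef f).of_norm_bounded fun q => ?_
    rw [norm_smul, norm_fourier_apply, one_mul]
  · have h1 : Summable fun l : ℤ => (fourier l x : ℂ) • c l k := by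
      refine (hc.summable_wt_mul_norm k 0).of_norm_bounded fun l => ?_
      rw [norm_smul, norm_fourier_apply, pow_zero]
    have h2 := (h1.hasSum.mapL (ContinuousLinearMap.apply ℂ V (coef f k))).const_smul
      (fourier k x : ℂ)
    rw [← (Equiv.subRight k).hasSum_iff] at h2
    convert h2 using 1
    · funext j
      simp only [Function.comp_apply, Equiv.subRight_apply, ContinuousLinearMap.apply_apply,
        smul_apply, smul_smul]
      rw [← fourier_add, add_sub_cancel]
    · rfl

end SymbolMatrix

end PDOCocycle
end

noncomputable section

namespace PDOCocycle

/-! ### Differentiation under the integral sign. -/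

section ParametricIntegrals

variable {F : Type*} [NormedAddCommGroup F] [NormedSpace ℝ F]

/-- The partial derivative of `G` in the direction `w`. -/
def dirDeriv (w : ℝ × ℝ) (G : ℝ × ℝ → F) (q : ℝ × ℝ) : F := fderiv ℝ G q w

theorem contDiff_dirDeriv {G : ℝ × ℝ → F} (hG : ContDiff ℝ ∞ G) (w : ℝ × ℝ) :
    ContDiff ℝ ∞ (dirDeriv w G) :=
  (hG.fderiv_right (m := ∞) (by simp)).clm_apply contDiff_const

theorem contDiff_iterate_dirDeriv {G : ℝ × ℝ → F} (hG : ContDiff ℝ ∞ G) (w : ℝ × ℝ) (n : ℕ) :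
    ContDiff ℝ ∞ ((dirDeriv w)^[n] G) := by
  induction n with
  | zero => exact hG
  | succ n ih =>
    rw [Function.iterate_succ_apply']
    exact contDiff_dirDeriv ih w

theorem hasDerivAt_snd {G : ℝ × ℝ → F} (hG : ContDiff ℝ ∞ G) (x ξ : ℝ) :
    HasDerivAt (fun η => G (x, η)) (dirDeriv (0, 1) G (x, ξ)) ξ := by
  have h1 := (hG.differentiable (by simp) (x, ξ)).hasFDerivAt
  exact h1.comp_hasDerivAt ξ ((hasDerivAt_const ξ x).prodMk (hasDerivAt_id ξ))

theorem hasDerivAt_fst {G : ℝ × ℝ → F} (hG : ContDiff ℝ ∞ G) (x ξ : ℝ) :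
    HasDerivAt (fun y => G (y, ξ)) (dirDeriv (1, 0) G (x, ξ)) x := by
  have h1 := (hG.differentiable (by simp) (x, ξ)).hasFDerivAt
  exact h1.comp_hasDerivAt x ((hasDerivAt_id x).prodMk (hasDerivAt_const x ξ))

theorem iteratedDeriv_snd {G : ℝ × ℝ → F} (hG : ContDiff ℝ ∞ G) (n : ℕ) (x : ℝ) :
    iteratedDeriv n (fun η => G (x, η)) = fun η => (dirDeriv (0, 1))^[n] G (x, η) := by
  induction n with
  | zero => simp
  | succ n ih =>
    rw [iteratedDeriv_succ, ih, Function.iterate_succ_apply']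
    funext ξ
    exact (hasDerivAt_snd (contDiff_iterate_dirDeriv hG _ n) x ξ).deriv

theorem iteratedDeriv_fst {G : ℝ × ℝ → F} (hG : ContDiff ℝ ∞ G) (n : ℕ) (ξ : ℝ) :
    iteratedDeriv n (fun y => G (y, ξ)) = fun y => (dirDeriv (1, 0))^[n] G (y, ξ) := by
  induction n with
  | zero => simp
  | succ n ih =>
    rw [iteratedDeriv_succ, ih, Function.iterate_succ_apply']
    funext x
    exact (hasDerivAt_fst (contDiff_iterate_dirDeriv hG _ n) x ξ).deriv

theorem hasDerivAt_parametric_integral {G : ℝ × ℝ → F} (hG : ContDiff ℝ ∞ G) (a b ξ : ℝ) :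
    HasDerivAt (fun η => ∫ x in a..b, G (x, η)) (∫ x in a..b, dirDeriv (0, 1) G (x, ξ)) ξ := by
  have hc : Continuous G := hG.continuous
  have hd : Continuous (dirDeriv (0, 1) G) := (contDiff_dirDeriv hG _).continuous
  have hx : ∀ {H : ℝ × ℝ → F}, Continuous H → ∀ η, Continuous fun x => H (x, η) := fun hH η =>
    hH.comp (continuous_id.prodMk continuous_const)
  obtain ⟨C, hC⟩ := (isCompact_uIcc (a := a) (b := b)).prod
    (isCompact_closedBall ξ 1) |>.exists_bound_of_continuousOn hd.continuousOn
  refine (intervalIntegral.hasDerivAt_integral_of_dominated_loc_of_deriv_le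
    (F' := fun η x => dirDeriv (0, 1) G (x, η)) (bound := fun _ => C)
    (Metric.ball_mem_nhds ξ one_pos) (Filter.Eventually.of_forall fun η =>
      (hx hc η).aestronglyMeasurable) ((hx hc ξ).intervalIntegrable _ _)
    (hx hd ξ).aestronglyMeasurable (Filter.Eventually.of_forall fun x hxab η hη => ?_)
    (continuous_const.intervalIntegrable _ _)
    (Filter.Eventually.of_forall fun x _ η _ => hasDerivAt_snd hG x η)).2
  exact hC (x, η) ⟨Set.uIoc_subset_uIcc hxab, Metric.ball_subset_closedBall hη⟩

theorem iteratedDeriv_parametric_integral {G : ℝ × ℝ → F} (hG : ContDiff ℝ ∞ G) (a b : ℝ) (n : ℕ) :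
    iteratedDeriv n (fun η => ∫ x in a..b, G (x, η)) =
      fun η => ∫ x in a..b, (dirDeriv (0, 1))^[n] G (x, η) := by
  induction n with
  | zero => simp
  | succ n ih =>
    rw [iteratedDeriv_succ, ih]
    funext ξ
    rw [(hasDerivAt_parametric_integral (contDiff_iterate_dirDeriv hG _ n) a b ξ).deriv,
      Function.iterate_succ_apply']

theorem contDiff_parametric_integral {G : ℝ × ℝ → F} (hG : ContDiff ℝ ∞ G) (a b : ℝ) :
    ContDiff ℝ ∞ (fun η => ∫ x in a..b, G (x, η)) := by
  refine contDiff_of_differentiable_iteratedDeriv fun n _ => ?_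
  rw [iteratedDeriv_parametric_integral hG]
  exact fun ξ => (hasDerivAt_parametric_integral
    (contDiff_iterate_dirDeriv hG _ n) a b ξ).differentiableAt

end ParametricIntegrals

attribute [local instance] completeSpace_of_finiteDimensional_complex

/-! ### From symbols to their Fourier coefficients. -/

section Symbols

variable {V : Type*} [NormedAddCommGroup V] [InnerProductSpace ℂ V] [FiniteDimensional ℂ V]

/-- Repeated integration by parts. Evaluation at vectors reduces it to `coeffR_iteratedDeriv`, which
concerns functions with values in an inner product space. -/
theorem integral_exp_smul_iteratedDeriv {h : ℝ → (V →L[ℂ] V)} (hh : ContDiff ℝ ∞ h)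
    (hp : Function.Periodic h (2 * Real.pi)) (l : ℤ) (n : ℕ) :
    ∫ x in (0 : ℝ)..(2 * Real.pi), Complex.exp ((((-l : ℤ) : ℂ) * Complex.I) * x) •
        iteratedDeriv n h x =
      ((l : ℂ) * Complex.I) ^ n • ∫ x in (0 : ℝ)..(2 * Real.pi),
        Complex.exp ((((-l : ℤ) : ℂ) * Complex.I) * x) • h x := by
  have hev : ∀ {g : ℝ → (V →L[ℂ] V)}, Continuous g → ∀ v, (∫ x in (0 : ℝ)..(2 * Real.pi),
      Complex.exp ((((-l : ℤ) : ℂ) * Complex.I) * x) • g x) v = coeffR (fun x => g x v) l := by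
    intro g hg v
    rw [coeffR, ContinuousLinearMap.intervalIntegral_apply]
    · rfl
    · exact ((contDiff_exp_mul _).continuous.smul hg).intervalIntegrable _ _
  have hc : Continuous (iteratedDeriv n h) :=
    hh.continuous_iteratedDeriv n (by exact_mod_cast le_top)
  ext v
  rw [smul_apply, hev hc, hev hh.continuous]
  let L : (V →L[ℂ] V) →L[ℝ] V := (ContinuousLinearMap.apply ℂ V v).restrictScalars ℝ
  have h1 : ContDiff ℝ ∞ fun x => h x v := L.contDiff.comp hh
  have h2 : iteratedDeriv n (fun x => h x v) = fun x => iteratedDeriv n h x v := by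
    funext x
    have := L.iteratedFDeriv_comp_left (f := h) (x := x) (i := n) hh.contDiffAt
      (by exact_mod_cast le_top)
    rw [iteratedDeriv_eq_iteratedFDeriv, iteratedDeriv_eq_iteratedFDeriv]
    exact congrArg (fun T => T fun _ => (1 : ℝ)) this
  rw [← h2]
  exact (coeffR_iteratedDeriv h1 (fun x => by simp only [hp x]) l n).1

variable {m : ℝ} {σ : S1 → ℝ → (V →L[ℂ] V)}

omit [FiniteDimensional ℂ V] in
theorem IsSymbol.continuous_fst (hσ : IsSymbol m σ) (ξ : ℝ) : Continuous fun x => σ x ξ :=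
  (QuotientAddGroup.isQuotientMap_mk (N := AddSubgroup.zmultiples (2 * Real.pi))).continuous_iff.2
    (hσ.1.continuous.comp (continuous_id.prodMk continuous_const))

/-- The Fourier coefficients of a symbol with respect to `x`. -/
def symbolCoeff (σ : S1 → ℝ → (V →L[ℂ] V)) (l : ℤ) (ξ : ℝ) : V →L[ℂ] V :=
  fourierCoeff (fun x => σ x ξ) l

theorem symbolCoeff_eq (σ : S1 → ℝ → (V →L[ℂ] V)) (l : ℤ) (ξ : ℝ) :
    symbolCoeff σ l ξ = (1 / (2 * Real.pi)) • ∫ x in (0 : ℝ)..(2 * Real.pi),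
      Complex.exp ((((-l : ℤ) : ℂ) * Complex.I) * x) • σ (x : S1) ξ := by
  rw [symbolCoeff, fourierCoeff_eq_intervalIntegral _ _ 0, zero_add]
  simp_rw [fourier_two_pi]

theorem IsSymbol.contDiff_exp_smul (hσ : IsSymbol m σ) (l : ℤ) (β : ℕ) :
    ContDiff ℝ ∞ fun q : ℝ × ℝ => Complex.exp ((((-l : ℤ) : ℂ) * Complex.I) * q.1) •
      (dirDeriv (1, 0))^[β] (fun q : ℝ × ℝ => σ (q.1 : S1) q.2) q :=
  ((contDiff_exp_mul _).comp contDiff_fst).smul (contDiff_iterate_dirDeriv hσ.1 _ β)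

theorem IsSymbol.smul_symbolCoeff (hσ : IsSymbol m σ) (l : ℤ) (β : ℕ) (ξ : ℝ) :
    ((l : ℂ) * Complex.I) ^ β • symbolCoeff σ l ξ = (1 / (2 * Real.pi)) •
      ∫ x in (0 : ℝ)..(2 * Real.pi), Complex.exp ((((-l : ℤ) : ℂ) * Complex.I) * x) •
        (dirDeriv (1, 0))^[β] (fun q : ℝ × ℝ => σ (q.1 : S1) q.2) (x, ξ) := by
  rw [symbolCoeff_eq, smul_comm]
  congr 1
  have h1 : ContDiff ℝ ∞ fun x : ℝ => σ (x : S1) ξ :=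
    hσ.1.comp (contDiff_id.prodMk contDiff_const)
  rw [← integral_exp_smul_iteratedDeriv h1
    (fun x => by simp only [AddCircle.coe_add_period])]
  simp only [iteratedDeriv_fst hσ.1]

theorem IsSymbol.contDiff_symbolCoeff (hσ : IsSymbol m σ) (l : ℤ) :
    ContDiff ℝ ∞ (symbolCoeff σ l) := by
  have h : symbolCoeff σ l = fun ξ => (1 / (2 * Real.pi)) • ∫ x in (0 : ℝ)..(2 * Real.pi),
      Complex.exp ((((-l : ℤ) : ℂ) * Complex.I) * x) • σ (x : S1) ξ :=
    funext fun ξ => symbolCoeff_eq σ l ξ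
  rw [h]
  exact (contDiff_const : ContDiff ℝ ∞ fun _ : ℝ => 1 / (2 * Real.pi)).smul
    (contDiff_parametric_integral (hσ.contDiff_exp_smul l 0) _ _)

/-- Multiplication by `(i l)^β` turns the coefficient of `σ` into that of `∂_x^β σ`, and a
coefficient is bounded by the supremum. -/
theorem IsSymbol.exists_bound (hσ : IsSymbol m σ) (α β : ℕ) : ∃ C : ℝ, ∀ (l : ℤ) (ξ : ℝ),
    |(l : ℝ)| ^ β * ‖iteratedDeriv α (symbolCoeff σ l) ξ‖ ≤ C * wt ξ ^ (m - α) := by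
  obtain ⟨C, hC⟩ := hσ.2 α β
  refine ⟨C, fun l ξ => ?_⟩
  set G := (dirDeriv (1, 0))^[β] (fun q : ℝ × ℝ => σ (q.1 : S1) q.2) with hG
  have hGs : ContDiff ℝ ∞ G := contDiff_iterate_dirDeriv hσ.1 _ β
  set H : ℝ × ℝ → (V →L[ℂ] V) := fun q =>
    Complex.exp ((((-l : ℤ) : ℂ) * Complex.I) * q.1) • G q with hH
  have hHs : ContDiff ℝ ∞ H := hσ.contDiff_exp_smul l β
  have h1 : ((l : ℂ) * Complex.I) ^ β • iteratedDeriv α (symbolCoeff σ l) ξ =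
      (1 / (2 * Real.pi)) • ∫ x in (0 : ℝ)..(2 * Real.pi), (dirDeriv (0, 1))^[α] H (x, ξ) := by
    have h2 : (fun ξ => ((l : ℂ) * Complex.I) ^ β • symbolCoeff σ l ξ) = fun ξ =>
        (1 / (2 * Real.pi)) • ∫ x in (0 : ℝ)..(2 * Real.pi), H (x, ξ) :=
      funext fun ξ => hσ.smul_symbolCoeff l β ξ
    have h3 := congrFun (congrArg (iteratedDeriv α) h2) ξ
    rw [iteratedDeriv_fun_const_smul, iteratedDeriv_fun_const_smul,
      iteratedDeriv_parametric_integral hHs] at h3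
    · exact h3
    · exact ((contDiff_parametric_integral hHs _ _).of_le (by exact_mod_cast le_top)).contDiffAt
    · exact ((hσ.contDiff_symbolCoeff l).of_le (by exact_mod_cast le_top)).contDiffAt
  have h4 : ∀ x : ℝ, ‖(dirDeriv (0, 1))^[α] H (x, ξ)‖ ≤ C * wt ξ ^ (m - α) := by
    intro x
    have h5 : (dirDeriv (0, 1))^[α] H (x, ξ) =
        Complex.exp ((((-l : ℤ) : ℂ) * Complex.I) * x) •
          iteratedDeriv α (fun η => G (x, η)) ξ := by
      rw [← congrFun (iteratedDeriv_snd hHs α x) ξ]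
      have h6 : ContDiff ℝ ∞ fun η => G (x, η) := hGs.comp (contDiff_const.prodMk contDiff_id)
      have h7 : ContDiff ℝ (α : ℕ∞) fun η => G (x, η) := h6.of_le (by exact_mod_cast le_top)
      rw [← iteratedDeriv_fun_const_smul h7.contDiffAt]
    rw [h5, norm_smul, norm_exp_int_mul, one_mul]
    have := hC x ξ
    simp only [iteratedDeriv_fst hσ.1] at this
    exact this
  rw [← norm_int_mul_I_pow, ← norm_smul, h1, norm_smul, Real.norm_of_nonneg (by positivity)]
  have h6 := intervalIntegral.norm_integral_le_of_norm_le_const (a := 0) (b := 2 * Real.pi)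
    fun x _ => h4 x
  rw [sub_zero, abs_of_pos Real.two_pi_pos] at h6
  rw [one_div, inv_mul_le_iff₀ Real.two_pi_pos, mul_comm (2 * Real.pi)]
  exact h6

theorem wt_pow_mul_rpow_le {m : ℝ} {n : ℕ} (h : m ≤ n) (α : ℕ) (ξ : ℝ) :
    wt ξ ^ α * wt ξ ^ (m - α) ≤ wt ξ ^ n := by
  rw [← Real.rpow_natCast (wt ξ) α, ← Real.rpow_add (wt_pos ξ), add_sub_cancel,
    ← Real.rpow_natCast]
  exact Real.rpow_le_rpow_of_exponent_le (one_le_wt ξ) h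

/-- Rounding the order up to a natural number leaves only integral powers of weights; nothing is
lost, as `IsPDO` does not fix the order. -/
theorem IsSymbol.isFourierSymbol (hσ : IsSymbol m σ) {n : ℕ} (hn : m ≤ n) :
    IsFourierSymbol n (symbolCoeff σ) := by
  refine ⟨hσ.contDiff_symbolCoeff, fun α N => ?_⟩
  obtain ⟨C, hC⟩ := hσ.exists_bound α 0
  obtain ⟨D, hD⟩ := hσ.exists_bound α N
  refine ⟨2 ^ N * (C + D), fun l ξ => ?_⟩
  rw [norm_iteratedFDeriv_eq_norm_iteratedDeriv]
  set X := ‖iteratedDeriv α (symbolCoeff σ l) ξ‖ with hX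
  have hX0 : 0 ≤ X := norm_nonneg _
  have hξ := wt_pos ξ
  have h1 : X ≤ C * wt ξ ^ (m - α) := by simpa using hC l ξ
  have h2 : |(l : ℝ)| ^ N * X ≤ D * wt ξ ^ (m - α) := hD l ξ
  have hCD : 0 ≤ C + D := by
    have : 0 ≤ (C + D) * wt ξ ^ (m - α) := by
      rw [add_mul]
      exact add_nonneg (hX0.trans h1) (le_trans (by positivity) h2)
    exact nonneg_of_mul_nonneg_left this (by positivity)
  calc wt l ^ N * (wt ξ ^ α * X) ≤ (2 ^ N * (1 + |(l : ℝ)| ^ N)) * (wt ξ ^ α * X) := by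
        gcongr
        exact wt_pow_le _ _
    _ = 2 ^ N * (wt ξ ^ α * (X + |(l : ℝ)| ^ N * X)) := by ring
    _ ≤ 2 ^ N * (wt ξ ^ α * (C * wt ξ ^ (m - α) + D * wt ξ ^ (m - α))) := by gcongr
    _ = 2 ^ N * (C + D) * (wt ξ ^ α * wt ξ ^ (m - α)) := by ring
    _ ≤ _ := by
        gcongr
        exact wt_pow_mul_rpow_le hn α ξ

omit [FiniteDimensional ℂ V] in
theorem IsSymbol.norm_le (hσ : IsSymbol m σ) {n : ℕ} (hn : m ≤ n) : ∃ C : ℝ, ∀ (x : S1) (ξ : ℝ),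
    ‖σ x ξ‖ ≤ C * wt ξ ^ n := by
  obtain ⟨C, hC⟩ := hσ.2 0 0
  refine ⟨C, fun x ξ => ?_⟩
  obtain ⟨y, rfl⟩ := QuotientAddGroup.mk_surjective x
  have h := hC y ξ
  simp only [iteratedDeriv_zero, Nat.cast_zero] at h
  have h1 := wt_pow_mul_rpow_le hn 0 ξ
  rw [pow_zero, one_mul, Nat.cast_zero] at h1
  have hp : 0 < wt ξ ^ (m - 0) := Real.rpow_pos_of_pos (wt_pos ξ) _
  exact h.trans (mul_le_mul_of_nonneg_left h1
    (nonneg_of_mul_nonneg_left ((norm_nonneg _).trans h) hp))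

/-- The series for `A f` is integrated termwise against `e^{-ijx}`; its `k`-th term contributes the
coefficient of index `j - k` of `σ (·, k)`, applied to `f̂(k)`. -/
theorem IsPDO.exists_isFourierSymbol {A : Op V} (hA : IsPDO A) :
    ∃ (n : ℕ) (c : ℤ → ℝ → (V →L[ℂ] V)), IsFourierSymbol n c ∧
      HasMatrix A fun j k => c (j - k) k := by
  obtain ⟨m, σ, hσ, hA⟩ := hA
  obtain ⟨n, hn⟩ := exists_nat_ge m
  refine ⟨n, symbolCoeff σ, hσ.isFourierSymbol hn, fun f j => ?_⟩
  obtain ⟨C, hC⟩ := hσ.norm_le hn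
  set T : ℤ → S1 → V := fun k x =>
    (fourier (-j) x : ℂ) • (fourier k x : ℂ) • σ x k (coef f k) with hT
  have hcont : ∀ k : ℤ, Continuous fun x => σ x k (coef f k) := fun k =>
    (hσ.continuous_fst k).clm_apply continuous_const
  have hTc : ∀ k, Continuous (T k) := fun k =>
    (map_continuous (fourier (-j))).smul ((map_continuous (fourier k)).smul (hcont k))
  have hTn : ∀ k x, ‖T k x‖ ≤ C * (wt k ^ n * ‖coef f k‖) := by
    intro k x
    rw [hT, norm_smul, norm_smul, norm_fourier_apply, norm_fourier_apply, one_mul, one_mul,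
      ← mul_assoc]
    exact ((σ x k).le_opNorm _).trans (mul_le_mul_of_nonneg_right (hC x k) (norm_nonneg _))
  have h1 := MeasureTheory.hasSum_integral_of_summable_integral_norm (F := T)
    (μ := (AddCircle.haarAddCircle : MeasureTheory.Measure S1))
    (fun k => (hTc k).integrable_of_hasCompactSupport (HasCompactSupport.of_compactSpace _)) (by
      refine ((summable_wt_mul_coef f n).mul_left C).of_nonneg_of_le
        (fun k => MeasureTheory.integral_nonneg fun x => norm_nonneg _) fun k => ?_
      have := MeasureTheory.integral_mono_of_nonneg
        (μ := (AddCircle.haarAddCircle : MeasureTheory.Measure S1))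
        (Filter.Eventually.of_forall fun x => norm_nonneg (T k x))
        (MeasureTheory.integrable_const _) (Filter.Eventually.of_forall (hTn k))
      simpa using this)
  have h2 : ∀ k, ∫ x, T k x ∂AddCircle.haarAddCircle = symbolCoeff σ (j - k) k (coef f k) := by
    intro k
    rw [symbolCoeff]
    have := fourierCoeff_clm (ContinuousLinearMap.apply ℂ V (coef f k)) (fun x => σ x k)
      (hσ.continuous_fst k) (j - k)
    simp only [ContinuousLinearMap.apply_apply] at this
    rw [← this, fourierCoeff]
    refine MeasureTheory.integral_congr_ae (Filter.Eventually.of_forall fun x => ?_)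
    simp only [hT, smul_smul, ← fourier_add]
    congr 3
    ring
  have h3 : ∫ x, ∑' k, T k x ∂AddCircle.haarAddCircle = coef (A f) j := by
    rw [coef, fourierCoeff]
    refine MeasureTheory.integral_congr_ae (Filter.Eventually.of_forall fun x => ?_)
    exact ((hA f x).const_smul (fourier (-j) x : ℂ)).tsum_eq
  rw [h3] at h1
  simpa only [h2] using h1

end Symbols

end PDOCocycle
end

noncomputable section

namespace PDOCocycle

attribute [local instance] completeSpace_of_finiteDimensional_complex

/-! ### The algebra of pseudodifferential operators and the curvature. -/

section PDOAlgebra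

variable {V : Type*} [NormedAddCommGroup V] [InnerProductSpace ℂ V] [FiniteDimensional ℂ V]

theorem coef_eq_of_hasSum {f : CInf V} {d : ℤ → V} (hd : Summable fun k => ‖d k‖)
    (hf : ∀ x, HasSum (fun k => (fourier k x : ℂ) • d k) (f x)) (j : ℤ) : coef f j = d j := by
  set T : ℤ → S1 → V := fun k x => (fourier (-j) x : ℂ) • (fourier k x : ℂ) • d k with hT
  have hTc : ∀ k, Continuous (T k) := fun k =>
    (map_continuous (fourier (-j))).smul ((map_continuous (fourier k)).smul continuous_const)
  have hTn : ∀ k x, ‖T k x‖ = ‖d k‖ := by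
    intro k x
    rw [hT, norm_smul, norm_smul, norm_fourier_apply, norm_fourier_apply, one_mul, one_mul]
  have h1 := MeasureTheory.hasSum_integral_of_summable_integral_norm (F := T)
    (μ := (AddCircle.haarAddCircle : MeasureTheory.Measure S1))
    (fun k => (hTc k).integrable_of_hasCompactSupport (HasCompactSupport.of_compactSpace _))
    (by simpa only [hTn, MeasureTheory.integral_const, MeasureTheory.probReal_univ, one_smul]
      using hd)
  have h2 : ∀ k, ∫ x, T k x ∂AddCircle.haarAddCircle = if k = j then d j else 0 := by
    intro k
    have h3 := congrFun (fourierCoeff_fourier (T := 2 * Real.pi) k) j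
    rw [fourierCoeff] at h3
    have h4 : ∀ x, T k x = ((fourier (-j) x : ℂ) • (fourier k x : ℂ)) • d k := fun x => by
      rw [hT, smul_assoc]
    simp_rw [h4]
    rw [integral_smul_const, h3]
    split_ifs with h
    · rw [h, Pi.single_eq_same, one_smul]
    · rw [Pi.single_eq_of_ne (Ne.symm h), zero_smul]
  have h3 : ∫ x, ∑' k, T k x ∂AddCircle.haarAddCircle = coef f j := by
    rw [coef, fourierCoeff]
    refine MeasureTheory.integral_congr_ae (Filter.Eventually.of_forall fun x => ?_)
    exact ((hf x).const_smul (fourier (-j) x : ℂ)).tsum_eq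
  rw [h3] at h1
  simp only [h2] at h1
  exact h1.unique (hasSum_ite_eq j (d j))

theorem coef_pPos (f : CInf V) (j : ℤ) : coef (pPos V f) j = if 0 < j then coef f j else 0 := by
  refine coef_eq_of_hasSum (d := fun k => if 0 < k then coef f k else 0) ?_ (fun x => ?_) j
  · refine (summable_norm_coef f).of_nonneg_of_le (fun k => norm_nonneg _) fun k => ?_
    split_ifs
    · exact le_rfl
    · simp
  · have h := (CInf.summable_posTerm f x).hasSum
    convert h using 1
    · funext k
      rw [posTerm, smul_ite, smul_zero]
      rfl
    · rfl

omit [FiniteDimensional ℂ V] in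
theorem hasMatrix_of_coef_eq {A : Op V} {c : ℝ → (V →L[ℂ] V)}
    (h : ∀ f j, coef (A f) j = c j (coef f j)) :
    HasMatrix A fun j k => (if j - k = 0 then c else fun _ => 0) k := by
  intro f j
  rw [h]
  convert hasSum_single (f := fun k : ℤ =>
    (if j - k = 0 then c else fun _ => 0) (k : ℝ) (coef f k)) j ?_ using 1
  · simp
  · intro k hk
    rw [if_neg (sub_ne_zero.2 hk.symm)]
    simp

/-- Only integral frequencies matter, so the jump of the cut-off may be smoothed between `0` and
`1`. Outside `[0, 1]` the symbol is locally constant; inside, compactness gives the bounds. -/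
theorem isPDO_pPos : IsPDO (pPos V) := by
  set c : ℝ → (V →L[ℂ] V) := fun ξ => Real.smoothTransition ξ • ContinuousLinearMap.id ℂ V with hc
  have hcs : ContDiff ℝ ∞ c := Real.smoothTransition.contDiff.smul contDiff_const
  refine (isFourierSymbol_single hcs fun α => ?_).isPDO (hasMatrix_of_coef_eq fun f j => ?_)
  · obtain ⟨C, hC⟩ := (isCompact_Icc (a := (0 : ℝ)) (b := 1)).exists_bound_of_continuousOn
      (hcs.continuous_iteratedFDeriv (m := α) (by exact_mod_cast le_top)).continuousOn
    refine ⟨max (2 ^ α * C) ‖ContinuousLinearMap.id ℂ V‖, fun ξ => ?_⟩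
    have hout : ∀ a : V →L[ℂ] V, ‖a‖ ≤ ‖ContinuousLinearMap.id ℂ V‖ → c =ᶠ[nhds ξ] (fun _ => a) →
        wt ξ ^ α * ‖iteratedFDeriv ℝ α c ξ‖ ≤ ‖ContinuousLinearMap.id ℂ V‖ := by
      intro a ha h
      rcases Nat.eq_zero_or_pos α with rfl | hα
      · rw [pow_zero, one_mul, norm_iteratedFDeriv_zero, h.eq_of_nhds]
        exact ha
      · rw [(h.iteratedFDeriv ℝ α).eq_of_nhds, iteratedFDeriv_const_of_ne hα.ne']
        simp
    rcases lt_or_ge ξ 0 with h0 | h0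
    · refine le_max_of_le_right (hout 0 (by simp) ?_)
      filter_upwards [Iio_mem_nhds h0] with η hη
      rw [hc]
      simp only [Real.smoothTransition.zero_of_nonpos (le_of_lt hη), zero_smul]
    rcases lt_or_ge 1 ξ with h1 | h1
    · refine le_max_of_le_right (hout (ContinuousLinearMap.id ℂ V) le_rfl ?_)
      filter_upwards [Ioi_mem_nhds h1] with η hη
      rw [hc]
      simp only [Real.smoothTransition.one_of_one_le (le_of_lt hη), one_smul]
    · refine le_max_of_le_left ?_
      have h2 : wt ξ ≤ 2 := by
        rw [wt, abs_of_nonneg h0]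
        linarith
      have := wt_pos ξ
      gcongr
      exact hC ξ ⟨h0, h1⟩
  · rw [coef_pPos]
    split_ifs with h
    · have : (1 : ℝ) ≤ j := by exact_mod_cast h
      simp [hc, Real.smoothTransition.one_of_one_le this]
    · have : (j : ℝ) ≤ 0 := by exact_mod_cast not_lt.1 h
      simp [hc, Real.smoothTransition.zero_of_nonpos this]

theorem isPDO_algebraMap (a : ℂ) : IsPDO (algebraMap ℂ (Op V) a) := by
  refine (isFourierSymbol_single (c := fun _ => a • ContinuousLinearMap.id ℂ V)
    contDiff_const fun α => ?_).isPDO (hasMatrix_of_coef_eq fun f j => ?_)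
  · rcases Nat.eq_zero_or_pos α with rfl | hα
    · exact ⟨‖a • ContinuousLinearMap.id ℂ V‖, fun ξ => by simp⟩
    · refine ⟨0, fun ξ => ?_⟩
      rw [iteratedFDeriv_const_of_ne hα.ne']
      simp
  · rw [Module.algebraMap_end_apply, coef_smul]
    simp

theorem IsPDO.add {A B : Op V} (hA : IsPDO A) (hB : IsPDO B) : IsPDO (A + B) := by
  obtain ⟨m, a, ha, hAa⟩ := hA.exists_isFourierSymbol
  obtain ⟨n, b, hb, hBb⟩ := hB.exists_isFourierSymbol
  exact (ha.add hb).isPDO (hAa.add hBb)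

theorem IsPDO.mul {A B : Op V} (hA : IsPDO A) (hB : IsPDO B) : IsPDO (A * B) := by
  obtain ⟨m, a, ha, hAa⟩ := hA.exists_isFourierSymbol
  obtain ⟨n, b, hb, hBb⟩ := hB.exists_isFourierSymbol
  refine (ha.comp hb).isPDO ?_
  -- At `ξ = k` the substitution `s = r + k` turns the composed symbol into the matrix product.
  convert hAa.mul hBb ha.tempered hb.tempered using 3 with j k
  refine Eq.trans (tsum_congr fun r => ?_)
    ((Equiv.addRight k).tsum_eq fun s : ℤ => a (j - s) s * b (s - k) k)
  simp only [Equiv.coe_addRight, Int.cast_add, add_sub_cancel_right]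
  rw [add_comm r k, add_comm (r : ℝ), sub_sub]

variable (V) in
/-- `PDO(S¹, V)` as an algebra. -/
def pdoAlgebra : Subalgebra ℂ (Op V) where
  carrier := {A | IsPDO A}
  mul_mem' hA hB := IsPDO.mul hA hB
  add_mem' hA hB := IsPDO.add hA hB
  algebraMap_mem' := isPDO_algebraMap

theorem IsPDO.exists_tempered {A : Op V} (hA : IsPDO A) : ∃ M, Tempered M ∧ HasMatrix A M := by
  obtain ⟨n, c, hc, h⟩ := hA.exists_isFourierSymbol
  exact ⟨_, hc.tempered, h⟩

theorem mul_mem_rapidOps_left {A B : Op V} (hA : A ∈ rapidOps V) (hB : IsPDO B) :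
    A * B ∈ rapidOps V := by
  obtain ⟨M, hM, hA⟩ := hA
  obtain ⟨N, hN, hB⟩ := hB.exists_tempered
  exact ⟨_, hM.matMul_tempered hN, hA.mul hB hM.tempered hN⟩

theorem mul_mem_rapidOps_right {A B : Op V} (hA : IsPDO A) (hB : B ∈ rapidOps V) :
    A * B ∈ rapidOps V := by
  obtain ⟨M, hM, hA⟩ := hA.exists_tempered
  obtain ⟨N, hN, hB⟩ := hB
  exact ⟨_, hM.matMul_rapid hN, hA.mul hB hM hN.tempered⟩

/-- The off-diagonal part `(1 - p) b p` of a pseudodifferential operator is smoothing. -/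
theorem one_sub_pPos_mul_mul_pPos_mem {b : Op V} (hb : IsPDO b) :
    (1 - pPos V) * b * pPos V ∈ rapidOps V := by
  obtain ⟨m, c, hc, hbc⟩ := hb.exists_isFourierSymbol
  refine ⟨fun j k => if 0 < j then 0 else if 0 < k then c (j - k) k else 0, fun N => ?_,
    fun f j => ?_⟩
  -- One exponent `N` for each of the two weights, and `m` against the growth of the symbol in `k`.
  · obtain ⟨C, hC0, hC⟩ := hc.norm_le (N + N + m)
    refine ⟨C, fun j k => ?_⟩
    beta_reduce
    split_ifs with hj hk
    · simpa using hC0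
    · have hw : ((j - k : ℤ) : ℝ) = j - k := by push_cast; rfl
      have hj' : (j : ℝ) ≤ 0 := by exact_mod_cast not_lt.1 hj
      have hk' : (0 : ℝ) < k := by exact_mod_cast hk
      -- The indices lie on opposite sides of `0`, so their distance dominates both of them.
      have h1 : wt ((j - k : ℤ) : ℝ) = 1 - j + k := by
        rw [hw, wt, abs_of_nonpos (by linarith)]
        ring
      have h2 : wt j ≤ wt ((j - k : ℤ) : ℝ) := by
        rw [h1, wt, abs_of_nonpos hj']
        linarith
      have h3 : wt k ≤ wt ((j - k : ℤ) : ℝ) := by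
        rw [h1, wt, abs_of_pos hk']
        linarith
      have hjp := wt_pos j
      have hkp := wt_pos k
      have hjkp := wt_pos ((j - k : ℤ) : ℝ)
      refine le_of_mul_le_mul_right ?_ (pow_pos hkp m)
      calc wt j ^ N * (wt k ^ N * ‖c (j - k) k‖) * wt k ^ m
          ≤ wt ((j - k : ℤ) : ℝ) ^ N * (wt ((j - k : ℤ) : ℝ) ^ N * ‖c (j - k) k‖) *
            wt ((j - k : ℤ) : ℝ) ^ m := by gcongr
        _ = wt ((j - k : ℤ) : ℝ) ^ (N + N + m) * ‖c (j - k) k‖ := by ring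
        _ ≤ C * wt k ^ m := hC _ _
    · simpa using hC0
  · have h1 : coef (((1 - pPos V) * b * pPos V) f) j =
        if 0 < j then 0 else coef (b (pPos V f)) j := by
      have e : ((1 - pPos V) * b * pPos V) f + pPos V (b (pPos V f)) = b (pPos V f) := by
        simp [Module.End.mul_apply]
      have := congrArg (fun g => coef g j) e
      simp only [coef_add, coef_pPos] at this
      split_ifs with h
      · rw [if_pos h] at this
        exact left_eq_add.1 (by rw [add_comm]; exact this.symm)
      · rw [if_neg h, add_zero] at this
        exact this
    rw [h1]
    split_ifs with h
    · simp only [h, if_true]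
      simp
    · simp only [h, if_false]
      convert hbc (pPos V f) j using 1
      funext k
      rw [coef_pPos]
      split_ifs <;> simp

/-- The defect of `a ↦ a * p` from being multiplicative is `-a * ((1 - p) * b * p)`, and the ideal
property applies. -/
theorem halfCurv_pPos_mem {a b : Op V} (ha : IsPDO a) (hb : IsPDO b) :
    halfCurv (pPos V) a b ∈ rapidOps V := by
  have e : halfCurv (pPos V) a b = -(a * ((1 - pPos V) * b * pPos V)) := by
    rw [halfCurv]
    noncomm_ring
  rw [e]
  exact neg_mem (mul_mem_rapidOps_right ha (one_sub_pPos_mul_mul_pPos_mem hb))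

theorem curv_eq_halfCurv (a b : Op V) :
    curv a b = halfCurv (pPos V) a b - halfCurv (pPos V) b a := by
  simp only [curv, Omega, theta, halfCurv]
  noncomm_ring

theorem Omega_eq_curv_mul (a b c : Op V) : Omega a b c = curv a b * c := by
  simp only [curv, Omega, theta]
  noncomm_ring

theorem curv_mem {a b : Op V} (ha : IsPDO a) (hb : IsPDO b) : curv a b ∈ rapidOps V := by
  rw [curv_eq_halfCurv]
  exact sub_mem (halfCurv_pPos_mem ha hb) (halfCurv_pPos_mem hb ha)

theorem pairProd_mem_rapidOps {k : ℕ} (hk : 1 ≤ k) {F : Fin k → Op V → Op V → Op V}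
    {x : Fin (2 * k) → Op V} (hF : ∀ i a b, IsPDO a → IsPDO b → F i a b ∈ rapidOps V)
    (hx : ∀ i, IsPDO (x i)) : pairProd F x ∈ rapidOps V := by
  have h : ∀ l : List (Op V), (∀ A ∈ l, A ∈ rapidOps V) → l ≠ [] → l.prod ∈ rapidOps V := by
    intro l
    induction l with
    | nil => exact fun _ h => absurd rfl h
    | cons A l ih =>
      intro hl _
      rw [List.prod_cons]
      by_cases h0 : l = []
      · subst h0
        simpa using hl A (by simp)
      · obtain ⟨M, hM, hA⟩ := hl A (by simp)
        obtain ⟨N, hN, hB⟩ := ih (fun B hB => hl B (by simp [hB])) h0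
        exact ⟨_, hM.matMul_tempered hN.tempered, hA.mul hB hM.tempered hN.tempered⟩
  -- The case `k = 0` has to be excluded: the empty product is the identity.
  refine h _ (fun A hA => ?_) ?_
  · obtain ⟨i, rfl⟩ := List.mem_ofFn.1 hA
    exact hF i _ _ (hx _) (hx _)
  · rw [Ne, List.ofFn_eq_nil_iff]
    omega

end PDOAlgebra

end PDOCocycle
end

noncomputable section

namespace PDOCocycle

attribute [local instance] completeSpace_of_finiteDimensional_complex

/-! ### Rapidly decreasing matrices have smooth kernels. -/

section SmoothKernel

variable {V : Type*} [NormedAddCommGroup V] [InnerProductSpace ℂ V] [FiniteDimensional ℂ V]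
variable {M : ℤ → ℤ → (V →L[ℂ] V)} {A : Op V}

theorem HasMatrix.hasSum_apply (hA : HasMatrix A M) (hM : Tempered M) (f : CInf V) (x : S1) :
    HasSum (fun q : ℤ × ℤ => (fourier q.1 x : ℂ) • M q.1 q.2 (coef f q.2)) (A f x) := by
  have hs : Summable fun q : ℤ × ℤ => (fourier q.1 x : ℂ) • M q.1 q.2 (coef f q.2) := by
    refine (hM.summable_mul_coef f).of_norm_bounded fun q => ?_
    rw [norm_smul, norm_fourier_apply, one_mul]
  have h := hs.hasSum.prod_fiberwise fun j => (hA f j).const_smul (fourier j x : ℂ)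
  rw [(hasSum_fourier_coef (A f) x).unique h]
  exact hs.hasSum

omit [FiniteDimensional ℂ V] in
theorem Rapid.summable (hM : Rapid M) (N : ℕ) :
    Summable fun q : ℤ × ℤ => wt q.1 ^ N * (wt q.2 ^ N * ‖M q.1 q.2‖) := by
  obtain ⟨C, hC⟩ := hM (N + 2)
  have h := (summable_inv_wt_sq.mul_of_nonneg summable_inv_wt_sq
    (fun r => by have := wt_pos r; positivity) (fun k => by have := wt_pos k; positivity)).mul_left C
  refine h.of_nonneg_of_le (fun q => by
    have := wt_pos q.1
    have := wt_pos q.2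
    positivity) fun q => ?_
  have h1 := wt_pos q.1
  have h2 := wt_pos q.2
  rw [← mul_inv, ← div_eq_mul_inv, le_div_iff₀ (by positivity)]
  calc _ = wt q.1 ^ (N + 2) * (wt q.2 ^ (N + 2) * ‖M q.1 q.2‖) := by ring
    _ ≤ C := hC _ _

omit [FiniteDimensional ℂ V] in
theorem Rapid.summable_norm (hM : Rapid M) : Summable fun q : ℤ × ℤ => ‖M q.1 q.2‖ := by
  simpa using hM.summable 0

theorem norm_le_tsum_coef (f : CInf V) (x : S1) : ‖f x‖ ≤ ∑' k, ‖coef f k‖ := by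
  rw [← (hasSum_fourier_coef f x).tsum_eq]
  refine tsum_of_norm_bounded (summable_norm_coef f).hasSum fun k => ?_
  rw [norm_smul, norm_fourier_apply, one_mul]

/-- The kernel of an operator with rapidly decreasing matrix. -/
def kernelOf (M : ℤ → ℤ → (V →L[ℂ] V)) (x y : S1) : V →L[ℂ] V :=
  ((2 * Real.pi)⁻¹ : ℝ) • ∑' q : ℤ × ℤ, ((fourier q.1 x : ℂ) * fourier (-q.2) y) • M q.1 q.2

theorem Rapid.contDiff_kernelOf (hM : Rapid M) :
    ContDiff ℝ ∞ fun z : ℝ × ℝ => kernelOf M (z.1 : S1) (z.2 : S1) := by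
  set f : ℤ × ℤ → ℝ × ℝ → (V →L[ℂ] V) := fun q z => (Complex.exp ((q.1 * Complex.I) * z.1) *
    Complex.exp ((((-q.2 : ℤ) : ℂ) * Complex.I) * z.2)) • M q.1 q.2 with hf
  suffices h : ContDiff ℝ ∞ fun z => ∑' q, f q z by
    simp only [kernelOf, fourier_two_pi]
    exact (contDiff_const : ContDiff ℝ ∞ fun _ : ℝ × ℝ => ((2 * Real.pi)⁻¹ : ℝ)).smul h
  have h1 : ∀ j : ℤ, ContDiff ℝ ∞ fun z : ℝ × ℝ => Complex.exp ((j * Complex.I) * z.1) :=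
    fun l => (contDiff_exp_mul _).comp contDiff_fst
  have h2 : ∀ j : ℤ, ContDiff ℝ ∞ fun z : ℝ × ℝ => Complex.exp ((j * Complex.I) * z.2) :=
    fun l => (contDiff_exp_mul _).comp contDiff_snd
  have hb : ∀ (j : ℤ) (i : ℕ) (y : ℝ),
      ‖iteratedFDeriv ℝ i (fun y : ℝ => Complex.exp ((j * Complex.I) * y)) y‖ ≤ wt j ^ i := by
    intro j i y
    rw [norm_iteratedFDeriv_eq_norm_iteratedDeriv, iteratedDeriv_exp_mul, norm_mul,
      norm_int_mul_I_pow, norm_exp_int_mul, mul_one]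
    exact abs_pow_le_wt_pow _ _
  have hfs : ∀ q, ContDiff ℝ ∞ (f q) := fun q =>
    ((h1 q.1).mul (h2 (-q.2))).smul contDiff_const
  refine contDiff_tsum (f := f) (N := ⊤) (v := fun n q => 2 ^ n * (wt q.1 ^ n * (wt q.2 ^ n * ‖M q.1 q.2‖)))
    hfs (fun n _ => (hM.summable n).mul_left _)
    fun n q z _ => ?_
  -- The factor `2 ^ n` is the sum of the binomial coefficients in the Leibniz rule.
  have h3 : ‖iteratedFDeriv ℝ n (fun z : ℝ × ℝ => (Complex.exp ((q.1 * Complex.I) * z.1) *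
      Complex.exp ((((-q.2 : ℤ) : ℂ) * Complex.I) * z.2))) z‖ ≤ 2 ^ n * (wt q.1 ^ n * wt q.2 ^ n) := by
    refine (norm_iteratedFDeriv_mul_le (h1 q.1) (h2 (-q.2)) z (n := n)
      (by exact_mod_cast le_top)).trans ?_
    have h4 : (2 : ℝ) ^ n = ∑ i ∈ Finset.range (n + 1), (n.choose i : ℝ) := by
      exact_mod_cast (Nat.sum_range_choose n).symm
    rw [h4, Finset.sum_mul]
    refine Finset.sum_le_sum fun i hi => ?_
    rw [mul_assoc]
    have hin : i ≤ n := Nat.lt_succ_iff.1 (Finset.mem_range.1 hi)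
    have hw1 := wt_pos q.1
    gcongr
    · refine (norm_iteratedFDeriv_comp_le (ContinuousLinearMap.fst ℝ ℝ ℝ)
        (ContinuousLinearMap.norm_fst_le ..) (contDiff_exp_mul _) z i).trans ?_
      exact (hb _ _ _).trans (wt_pow_le_wt_pow _ hin)
    · refine (norm_iteratedFDeriv_comp_le (ContinuousLinearMap.snd ℝ ℝ ℝ)
        (ContinuousLinearMap.norm_snd_le ..) (contDiff_exp_mul _) z (n - i)).trans ?_
      refine (hb _ _ _).trans ((wt_pow_le_wt_pow _ (Nat.sub_le n i)).trans_eq ?_)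
      push_cast
      rw [wt_neg]
  let L : ℂ →L[ℝ] (V →L[ℂ] V) :=
    ((ContinuousLinearMap.id ℂ ℂ).smulRight (M q.1 q.2)).restrictScalars ℝ
  have hL : ‖L‖ ≤ ‖M q.1 q.2‖ := by
    refine ContinuousLinearMap.opNorm_le_bound _ (norm_nonneg _) fun w => ?_
    change ‖w • M q.1 q.2‖ ≤ _
    rw [norm_smul, mul_comm]
  refine (L.norm_iteratedFDeriv_comp_left (((h1 q.1).mul (h2 (-q.2))).contDiffAt)
    (by exact_mod_cast le_top : (n : WithTop ℕ∞) ≤ ∞)).trans ?_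
  calc _ ≤ ‖M q.1 q.2‖ * (2 ^ n * (wt q.1 ^ n * wt q.2 ^ n)) := by
        gcongr
    _ = _ := by ring

/-- Termwise integration of the Fourier expansion of the kernel. Fourier coefficients use the
normalized Haar measure and the kernel the volume, of total mass `2π`; hence the factor in
`kernelOf`. -/
theorem Rapid.isSmoothing (hM : Rapid M) (hA : HasMatrix A M) : IsSmoothing A := by
  refine ⟨kernelOf M, hM.contDiff_kernelOf, fun f x => ?_⟩
  set T : ℤ × ℤ → S1 → V := fun q y =>
    (fourier q.1 x : ℂ) • (fourier (-q.2) y : ℂ) • M q.1 q.2 (f y) with hT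
  have hTc : ∀ q, Continuous (T q) := fun q =>
    continuous_const.smul ((map_continuous (fourier (-q.2))).smul
      ((M q.1 q.2).continuous.comp (CInf.continuous f)))
  set B := ∑' k, ‖coef f k‖ with hB
  have hTn : ∀ q y, ‖T q y‖ ≤ ‖M q.1 q.2‖ * B := by
    intro q y
    rw [hT, norm_smul, norm_smul, norm_fourier_apply, norm_fourier_apply, one_mul, one_mul]
    exact ((M q.1 q.2).le_opNorm _).trans
      (mul_le_mul_of_nonneg_left (norm_le_tsum_coef f y) (norm_nonneg _))
  have h1 := MeasureTheory.hasSum_integral_of_summable_integral_norm (F := T)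
    (μ := (AddCircle.haarAddCircle : MeasureTheory.Measure S1))
    (fun q => (hTc q).integrable_of_hasCompactSupport (HasCompactSupport.of_compactSpace _)) (by
      refine (hM.summable_norm.mul_right B).of_nonneg_of_le
        (fun k => MeasureTheory.integral_nonneg fun x => norm_nonneg _) fun q => ?_
      have := MeasureTheory.integral_mono_of_nonneg
        (μ := (AddCircle.haarAddCircle : MeasureTheory.Measure S1))
        (Filter.Eventually.of_forall fun x => norm_nonneg (T q x))
        (MeasureTheory.integrable_const _) (Filter.Eventually.of_forall (hTn q))
      simpa using this)
  have h2 : ∀ q : ℤ × ℤ, ∫ y, T q y ∂AddCircle.haarAddCircle =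
      (fourier q.1 x : ℂ) • M q.1 q.2 (coef f q.2) := by
    intro q
    rw [coef, ← fourierCoeff_clm (M q.1 q.2) f (CInf.continuous f), fourierCoeff, hT,
      MeasureTheory.integral_smul]
  simp only [h2] at h1
  rw [(hA.hasSum_apply hM.tempered f x).unique h1, AddCircle.integral_haarAddCircle,
    ← MeasureTheory.integral_smul]
  refine MeasureTheory.integral_congr_ae (Filter.Eventually.of_forall fun y => ?_)
  have hs : Summable fun q : ℤ × ℤ => ((fourier q.1 x : ℂ) * fourier (-q.2) y) • M q.1 q.2 := by
    refine hM.summable_norm.of_norm_bounded fun q => ?_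
    rw [norm_smul, norm_mul, norm_fourier_apply, norm_fourier_apply, one_mul, one_mul]
  have h3 := (hs.hasSum.mapL (ContinuousLinearMap.apply ℂ V (f y))).tsum_eq
  have h4 : ∑' q, T q y = (∑' q : ℤ × ℤ, ((fourier q.1 x : ℂ) * fourier (-q.2) y) • M q.1 q.2)
      (f y) := by
    refine Eq.trans (tsum_congr fun q => ?_) h3
    rw [hT]
    simp only [ContinuousLinearMap.apply_apply, smul_apply, smul_smul]
  beta_reduce
  rw [h4, kernelOf]
  rfl

end SmoothKernel

end PDOCocycle
end

noncomputable section

namespace PDOCocycle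

/-! ### The trace of nuclear operators on a Hilbert space. -/

section AbstractTrace

variable {H : Type*} [NormedAddCommGroup H] [InnerProductSpace ℂ H] {ι ν : Type*}

/-- Cauchy–Schwarz together with Bessel's inequality for `x` and for `y`. -/
theorem tsum_norm_inner_mul_inner_le (b : HilbertBasis ι ℂ H) (x y : H) :
    ∑' i, ‖(inner ℂ x (b i) : ℂ) * inner ℂ (b i) y‖ ≤ ‖x‖ * ‖y‖ := by
  refine Real.tsum_le_of_sum_le (fun i => norm_nonneg _) fun s => ?_
  have h1 : ∀ z : H, √(∑ i ∈ s, ‖(inner ℂ (b i) z : ℂ)‖ ^ 2) ≤ ‖z‖ := fun z =>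
    Real.sqrt_le_iff.2 ⟨norm_nonneg _, b.orthonormal.sum_inner_products_le z⟩
  calc ∑ i ∈ s, ‖(inner ℂ x (b i) : ℂ) * inner ℂ (b i) y‖
      = ∑ i ∈ s, ‖(inner ℂ (b i) x : ℂ)‖ * ‖(inner ℂ (b i) y : ℂ)‖ :=
        Finset.sum_congr rfl fun i _ => by rw [norm_mul, norm_inner_symm]
    _ ≤ √(∑ i ∈ s, ‖(inner ℂ (b i) x : ℂ)‖ ^ 2) * √(∑ i ∈ s, ‖(inner ℂ (b i) y : ℂ)‖ ^ 2) :=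
        Real.sum_mul_le_sqrt_mul_sqrt _ _ _
    _ ≤ ‖x‖ * ‖y‖ := mul_le_mul (h1 x) (h1 y) (Real.sqrt_nonneg _) (norm_nonneg _)

/-- The trace of a nuclear operator does not depend on the Hilbert basis. -/
theorem hasSum_inner_apply_of_nuclear {T : H →L[ℂ] H} {u v : ν → H}
    (hs : Summable fun n => ‖u n‖ * ‖v n‖)
    (hT : ∀ x, HasSum (fun n => (inner ℂ (u n) x : ℂ) • v n) (T x)) (b : HilbertBasis ι ℂ H) :
    HasSum (fun i => (inner ℂ (b i) (T (b i)) : ℂ)) (∑' n, inner ℂ (u n) (v n)) := by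
  have hF : Summable fun n => (inner ℂ (u n) (v n) : ℂ) :=
    hs.of_norm_bounded fun n => norm_inner_le_norm _ _
  -- Summed over `i`, this is Parseval's formula for `⟪u n, v n⟫`; summed over `n`, it is the
  -- diagonal entry of `T` at `b i`.
  set g : ν × ι → ℂ := fun q => inner ℂ (u q.1) (b q.2) * inner ℂ (b q.2) (v q.1) with hg
  have h1 : ∀ n, HasSum (fun i => g (n, i)) (inner ℂ (u n) (v n)) := fun n =>
    b.hasSum_inner_mul_inner (u n) (v n)
  have h2 : ∀ i, HasSum (fun n => g (n, i)) (inner ℂ (b i) (T (b i))) := by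
    intro i
    have := (innerSL ℂ (b i)).hasSum (hT (b i))
    simpa only [innerSL_apply_apply, inner_smul_right, smul_eq_mul] using this
  have h3 : Summable fun q => ‖g q‖ := by
    have h4 : ∀ n, Summable fun i => ‖g (n, i)‖ := fun n => (h1 n).summable.norm
    have h5 : ∀ n, ∑' i, ‖g (n, i)‖ ≤ ‖u n‖ * ‖v n‖ := fun n =>
      tsum_norm_inner_mul_inner_le b (u n) (v n)
    have h6 : Summable fun n => ∑' i, ‖g (n, i)‖ :=
      hs.of_nonneg_of_le (fun n => tsum_nonneg fun i => norm_nonneg _) h5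
    exact (summable_prod_of_nonneg fun q => norm_nonneg (g q)).2 ⟨h4, h6⟩
  exact hasSum_swap h3.of_norm h1 h2 hF.hasSum

theorem isTraceClass_of_nuclear [Countable ν] {T : H →L[ℂ] H} {u v : ν → H}
    (hs : Summable fun n => ‖u n‖ * ‖v n‖)
    (hT : ∀ x, HasSum (fun n => (inner ℂ (u n) x : ℂ) • v n) (T x)) : IsTraceClass T := by
  obtain ⟨e, he⟩ := exists_injective_nat ν
  refine ⟨Function.extend e u 0, Function.extend e v 0, ?_, fun x => ?_⟩
  · have : (fun n => ‖Function.extend e u 0 n‖ * ‖Function.extend e v 0 n‖) =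
        Function.extend e (fun n => ‖u n‖ * ‖v n‖) 0 := by
      funext n
      by_cases hn : ∃ a, e a = n
      · obtain ⟨a, rfl⟩ := hn
        simp only [he.extend_apply]
      · simp [Function.extend_apply' _ _ _ hn]
    rw [this]
    exact ((hasSum_extend_zero he).2 hs.hasSum).summable
  · have : (fun n => (inner ℂ (Function.extend e u 0 n) x : ℂ) • Function.extend e v 0 n) =
        Function.extend e (fun n => (inner ℂ (u n) x : ℂ) • v n) 0 := by
      funext n
      by_cases hn : ∃ a, e a = n
      · obtain ⟨a, rfl⟩ := hn
        simp only [he.extend_apply]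
      · simp [Function.extend_apply' _ _ _ hn]
    rw [this]
    exact (hasSum_extend_zero he).2 (hT x)

end AbstractTrace

attribute [local instance] completeSpace_of_finiteDimensional_complex

/-! ### Fourier modes in `L²` and density of the smooth functions. -/

section FourierModes

variable {V : Type*} [NormedAddCommGroup V] [InnerProductSpace ℂ V] [FiniteDimensional ℂ V]

open MeasureTheory

/-- The function `e^{ikx} v`. -/
def mode (k : ℤ) (v : V) : CInf V :=
  CInf.mk (fun x => (fourier k x : ℂ) • v) (by
    simp only [fourier_two_pi]
    exact (contDiff_exp_mul _).smul contDiff_const)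

theorem coef_mode (k : ℤ) (v : V) (j : ℤ) : coef (mode k v) j = if j = k then v else 0 := by
  have h := coef_eq_of_hasSum (f := mode k v) (d := fun j => if j = k then v else 0)
    (summable_of_ne_finset_zero (s := {k}) fun j hj => by
      rw [if_neg (by simpa using hj), norm_zero]) (fun x => ?_) j
  · exact h
  · convert hasSum_ite_eq k ((fourier k x : ℂ) • v) using 1
    · funext j
      split_ifs with hj
      · rw [hj]
      · rw [smul_zero]
    · rfl

theorem inner_toL2 (f g : CInf V) : (inner ℂ (toL2 f) (toL2 g) : ℂ) = ∫ x : S1, inner ℂ (f x) (g x) := by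
  rw [L2.inner_def]
  refine integral_congr_ae ?_
  filter_upwards [ContinuousMap.coeFn_toLp (p := 2) (𝕜 := ℂ) (volume : Measure S1)
    ⟨(f : S1 → V), CInf.continuous f⟩, ContinuousMap.coeFn_toLp (p := 2) (𝕜 := ℂ)
    (volume : Measure S1) ⟨(g : S1 → V), CInf.continuous g⟩] with x hf hg
  rw [toL2, toL2, hf, hg]
  rfl

theorem inner_mode_toL2 (k : ℤ) (v : V) (f : CInf V) :
    (inner ℂ (toL2 (mode k v)) (toL2 f) : ℂ) = ((2 * Real.pi : ℝ) : ℂ) * inner ℂ v (coef f k) := by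
  have h1 := fourierCoeff_clm (innerSL ℂ v) f (CInf.continuous f) k
  simp only [innerSL_apply_apply] at h1
  rw [inner_toL2, coef, ← h1, fourierCoeff, AddCircle.integral_haarAddCircle, ← Complex.real_smul,
    smul_smul, mul_inv_cancel₀ Real.two_pi_pos.ne', one_smul]
  refine integral_congr_ae (Filter.Eventually.of_forall fun x => ?_)
  change inner ℂ ((fourier k x : ℂ) • v) (f x) = _
  rw [inner_smul_left, ← fourier_neg]
  rfl

theorem toL2_mode_norm_le : ∃ C : ℝ, 0 ≤ C ∧ ∀ (k : ℤ) (v : V), ‖toL2 (mode k v)‖ ≤ C * ‖v‖ := by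
  refine ⟨‖(ContinuousMap.toLp 2 (volume : Measure S1) ℂ : C(S1, V) →L[ℂ] L2 V)‖,
    ContinuousLinearMap.opNorm_nonneg _, fun k v => ?_⟩
  refine (ContinuousLinearMap.le_opNorm _ _).trans
    (mul_le_mul_of_nonneg_left ?_ (ContinuousLinearMap.opNorm_nonneg _))
  refine (ContinuousMap.norm_le _ (norm_nonneg v)).2 fun x => ?_
  change ‖(fourier k x : ℂ) • v‖ ≤ _
  rw [norm_smul, norm_fourier_apply, one_mul]

/-- An absolutely convergent series of Fourier modes converges in `L²`. -/
theorem hasSum_toL2_mode {ν : Type*} {k : ν → ℤ} {v : ν → V} (hs : Summable fun n => ‖v n‖)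
    {f : CInf V} (hf : ∀ x, HasSum (fun n => (fourier (k n) x : ℂ) • v n) (f x)) :
    HasSum (fun n => toL2 (mode (k n) (v n))) (toL2 f) := by
  let m : ν → C(S1, V) := fun n => ⟨mode (k n) (v n), CInf.continuous _⟩
  have hm : Summable m := by
    refine hs.of_norm_bounded fun n => (ContinuousMap.norm_le _ (norm_nonneg _)).2 fun x => ?_
    change ‖(fourier (k n) x : ℂ) • v n‖ ≤ _
    rw [norm_smul, norm_fourier_apply, one_mul]
  have h1 : HasSum m ⟨f, CInf.continuous f⟩ := by
    convert hm.hasSum using 1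
    ext x
    exact (hf x).unique (ContinuousMap.hasSum_apply hm.hasSum x)
  exact h1.mapL (ContinuousMap.toLp 2 (volume : Measure S1) ℂ)

theorem ae_volume_of_ae_haar {p : S1 → Prop}
    (h : ∀ᵐ x ∂(AddCircle.haarAddCircle : Measure S1), p x) : ∀ᵐ x : S1, p x := by
  rw [AddCircle.volume_eq_smul_haarAddCircle]
  exact Measure.ae_smul_measure h _

theorem ae_eq_zero_of_fourierCoeff_eq_zero {g : S1 → ℂ} (hg : MemLp g 2 (volume : Measure S1))
    (h : ∀ k, fourierCoeff g k = 0) : ∀ᵐ x : S1, g x = 0 := by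
  have hg' : MemLp g 2 (AddCircle.haarAddCircle : Measure S1) :=
    memLp_haarAddCircle_iff.2 hg
  have h0 : hg'.toLp g = 0 := by
    apply (fourierBasis (T := 2 * Real.pi)).repr.injective
    rw [map_zero]
    ext k
    rw [fourierBasis_repr, fourierCoeff_congr_ae hg'.coeFn_toLp, h k]
    rfl
  have h1 := hg'.coeFn_toLp
  rw [h0] at h1
  refine ae_volume_of_ae_haar ?_
  filter_upwards [h1, Lp.coeFn_zero ℂ 2 (AddCircle.haarAddCircle : Measure S1)] with x hx hx0
  rw [← hx, hx0]
  rfl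

variable (V) in
/-- The smooth functions, as a subspace of `L²`. -/
def smoothL2 : Submodule ℂ (L2 V) where
  carrier := Set.range toL2
  add_mem' := by
    rintro _ _ ⟨f, rfl⟩ ⟨g, rfl⟩
    exact ⟨f + g, map_add (ContinuousMap.toLp 2 (volume : Measure S1) ℂ)
      (⟨f, CInf.continuous f⟩ : C(S1, V)) ⟨g, CInf.continuous g⟩⟩
  zero_mem' := ⟨0, map_zero (ContinuousMap.toLp (E := V) 2 (volume : Measure S1) ℂ)⟩
  smul_mem' := by
    rintro c _ ⟨f, rfl⟩
    exact ⟨c • f, map_smul (ContinuousMap.toLp 2 (volume : Measure S1) ℂ) c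
      (⟨f, CInf.continuous f⟩ : C(S1, V))⟩

/-- If `g` is orthogonal to all modes, each `⟪v, g⟫` has vanishing Fourier coefficients and is zero
almost everywhere. Finitely many `v`, an orthonormal basis, determine `g`. -/
theorem smoothL2_dense : (smoothL2 V).topologicalClosure = ⊤ := by
  rw [Submodule.topologicalClosure_eq_top_iff, Submodule.eq_bot_iff]
  intro g hg
  have h1 : ∀ (k : ℤ) (v : V), fourierCoeff (fun x => (inner ℂ v (g x) : ℂ)) k = 0 := by
    intro k v
    have h2 : (inner ℂ (toL2 (mode k v)) g : ℂ) = 0 := hg _ ⟨_, rfl⟩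
    rw [L2.inner_def] at h2
    rw [fourierCoeff, AddCircle.integral_haarAddCircle, smul_eq_zero]
    refine Or.inr (Eq.trans (integral_congr_ae ?_) h2)
    filter_upwards [ContinuousMap.coeFn_toLp (p := 2) (𝕜 := ℂ) (volume : Measure S1)
      ⟨(mode k v : S1 → V), CInf.continuous _⟩] with x hx
    rw [toL2, hx]
    change _ = inner ℂ ((fourier k x : ℂ) • v) (g x)
    rw [inner_smul_left, ← fourier_neg, smul_eq_mul]
  have h2 : ∀ v : V, ∀ᵐ x : S1, (inner ℂ v (g x) : ℂ) = 0 := fun v =>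
    ae_eq_zero_of_fourierCoeff_eq_zero ((Lp.memLp g).const_inner v) fun k => h1 k v
  have h3 : ∀ᵐ x : S1, ∀ a, (inner ℂ (stdOrthonormalBasis ℂ V a) (g x) : ℂ) = 0 :=
    ae_all_iff.2 fun a => h2 _
  rw [Lp.eq_zero_iff_ae_eq_zero]
  filter_upwards [h3] with x hx
  rw [Pi.zero_apply, ← (stdOrthonormalBasis ℂ V).sum_repr' (g x)]
  exact Finset.sum_eq_zero fun a _ => by rw [hx a, zero_smul]

theorem Extends.unique {A : Op V} {T T' : L2 V →L[ℂ] L2 V} (h : Extends T A) (h' : Extends T' A) :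
    T = T' := by
  refine ContinuousLinearMap.ext_on (s := (smoothL2 V : Set (L2 V))) ?_ ?_
  · rw [Submodule.span_eq]
    exact (Submodule.dense_iff_topologicalClosure_eq_top).2 smoothL2_dense
  · rintro _ ⟨f, rfl⟩
    rw [h f, h' f]

/-- Density makes the extension chosen in the definition of `tr` irrelevant. -/
theorem tr_eq_trace {A : Op V} {T : L2 V →L[ℂ] L2 V} (h : Extends T A) : tr A = trace T := by
  have h' : ∃ T : L2 V →L[ℂ] L2 V, Extends T A := ⟨T, h⟩
  rw [tr, dif_pos h', h'.choose_spec.unique h]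

end FourierModes

end PDOCocycle
end

noncomputable section

namespace PDOCocycle

attribute [local instance] completeSpace_of_finiteDimensional_complex

/-! ### The operator trace, its cyclicity, and the Chern–Weil form. -/

section OperatorTrace

variable {V : Type*} [NormedAddCommGroup V] [InnerProductSpace ℂ V] [FiniteDimensional ℂ V]
variable {M N : ℤ → ℤ → (V →L[ℂ] V)} {A B : Op V}

variable (V) in
/-- The trace on `End V`. -/
def fibreTrace : (V →L[ℂ] V) →L[ℂ] ℂ :=
  LinearMap.toContinuousLinearMap (LinearMap.trace ℂ V ∘ₗ ContinuousLinearMap.coeLM ℂ)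

theorem fibreTrace_mul_comm (a b : V →L[ℂ] V) : fibreTrace V (a * b) = fibreTrace V (b * a) :=
  LinearMap.trace_mul_comm ℂ (a : V →ₗ[ℂ] V) (b : V →ₗ[ℂ] V)

theorem fibreTrace_eq_sum_inner (a : V →L[ℂ] V) :
    fibreTrace V a = ∑ i, inner ℂ (stdOrthonormalBasis ℂ V i) (a (stdOrthonormalBasis ℂ V i)) :=
  LinearMap.trace_eq_sum_inner _ _

/-- The operator with matrix `M` is nuclear, and its trace is `∑ₖ tr M k k`. -/
theorem exists_nuclear_extension (hM : Rapid M) (hA : HasMatrix A M) :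
    ∃ (T : L2 V →L[ℂ] L2 V)
      (u v : (ℤ × ℤ) × Fin (Module.finrank ℂ V) → L2 V), Extends T A ∧
      Summable (fun n => ‖u n‖ * ‖v n‖) ∧
      (∀ x, HasSum (fun n => (inner ℂ (u n) x : ℂ) • v n) (T x)) ∧
      ∑' n, (inner ℂ (u n) (v n) : ℂ) = ∑' k, fibreTrace V (M k k) := by
  set e := stdOrthonormalBasis ℂ V with he
  set c : ℂ := ((2 * Real.pi : ℝ) : ℂ) with hc
  have hcc : star c⁻¹ * c = 1 := by
    rw [hc, ← Complex.ofReal_inv, Complex.star_def, Complex.conj_ofReal, ← Complex.ofReal_mul,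
      inv_mul_cancel₀ Real.two_pi_pos.ne', Complex.ofReal_one]
  -- The modes have squared norm `2π` in `L²`; with the factor `c⁻¹` the pairing with `u` is the
  -- component of a Fourier coefficient along `e n.2`.
  set u : (ℤ × ℤ) × Fin (Module.finrank ℂ V) → L2 V :=
    fun n => c⁻¹ • toL2 (mode n.1.2 (e n.2)) with hu
  set v : (ℤ × ℤ) × Fin (Module.finrank ℂ V) → L2 V :=
    fun n => toL2 (mode n.1.1 (M n.1.1 n.1.2 (e n.2))) with hv
  have hinner : ∀ (n : (ℤ × ℤ) × Fin (Module.finrank ℂ V)) (f : CInf V),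
      (inner ℂ (u n) (toL2 f) : ℂ) = inner ℂ (e n.2) (coef f n.1.2) := by
    intro n f
    simp only [hu]
    rw [inner_smul_left, inner_mode_toL2, ← mul_assoc, ← hc]
    change star c⁻¹ * c * _ = _
    rw [hcc, one_mul]
  have hsum : Summable fun n => ‖u n‖ * ‖v n‖ := by
    obtain ⟨C, hC0, hC⟩ := toL2_mode_norm_le (V := V)
    have h1 : Summable fun n : (ℤ × ℤ) × Fin (Module.finrank ℂ V) => ‖M n.1.1 n.1.2‖ * 1 :=
      hM.summable_norm.mul_of_nonneg (Summable.of_finite (f := fun _ => (1 : ℝ)))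
        (fun _ => norm_nonneg _) (fun _ => zero_le_one)
    refine (h1.mul_left (‖c⁻¹‖ * C * C)).of_nonneg_of_le (fun n => by positivity) fun n => ?_
    have h2 : ‖u n‖ ≤ ‖c⁻¹‖ * C := by
      simp only [hu]
      rw [norm_smul]
      refine mul_le_mul_of_nonneg_left ((hC _ _).trans_eq ?_) (norm_nonneg _)
      rw [e.norm_eq_one, mul_one]
    have h3 : ‖v n‖ ≤ C * ‖M n.1.1 n.1.2‖ := by
      refine (hC _ _).trans (mul_le_mul_of_nonneg_left ?_ hC0)
      refine ((M n.1.1 n.1.2).le_opNorm _).trans_eq ?_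
      rw [e.norm_eq_one, mul_one]
    calc ‖u n‖ * ‖v n‖ ≤ (‖c⁻¹‖ * C) * (C * ‖M n.1.1 n.1.2‖) :=
          mul_le_mul h2 h3 (norm_nonneg _) (by positivity)
      _ = _ := by ring
  have hT : Summable fun n => InnerProductSpace.rankOne ℂ (v n) (u n) :=
    hsum.of_norm_bounded fun n => by
      rw [InnerProductSpace.norm_rankOne, mul_comm]
  set T : L2 V →L[ℂ] L2 V := ∑' n, InnerProductSpace.rankOne ℂ (v n) (u n) with hTdef
  have hTx : ∀ x, HasSum (fun n => (inner ℂ (u n) x : ℂ) • v n) (T x) := fun x =>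
    hT.hasSum.mapL (ContinuousLinearMap.apply ℂ (L2 V) x)
  refine ⟨T, u, v, fun f => ?_, hsum, hTx, ?_⟩
  · have h1 := (hTx (toL2 f)).prod_fiberwise fun q => hasSum_fintype _
    have h2 := hasSum_toL2_mode (hM.tempered.summable_mul_coef f)
      (fun x => hA.hasSum_apply hM.tempered f x)
    refine h1.unique ?_
    convert h2 using 1
    funext q
    simp only [hinner]
    have h3 : ∀ (j : ℤ) (s : ℂ) (w : V), s • toL2 (mode j w) = toL2 (mode j (s • w)) := by
      intro j s w
      have : mode j (s • w) = s • mode j w := by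
        ext x
        change (fourier j x : ℂ) • s • w = s • (fourier j x : ℂ) • w
        rw [smul_comm]
      rw [this]
      exact (map_smul (ContinuousMap.toLp 2 (MeasureTheory.volume : MeasureTheory.Measure S1) ℂ) s
        (⟨mode j w, CInf.continuous _⟩ : C(S1, V))).symm
    have h4 : ∀ (j : ℤ) (w : Fin (Module.finrank ℂ V) → V),
        ∑ a, toL2 (mode j (w a)) = toL2 (mode j (∑ a, w a)) := by
      intro j w
      let L : V →+ L2 V :=
        { toFun := fun w => toL2 (mode j w)
          map_zero' := by simpa using (h3 j 0 (0 : V)).symm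
          map_add' := fun a b => by
            have : mode j (a + b) = mode j a + mode j b := by
              ext x
              exact smul_add _ a b
            rw [this]
            exact map_add (ContinuousMap.toLp 2
              (MeasureTheory.volume : MeasureTheory.Measure S1) ℂ)
              (⟨mode j a, CInf.continuous _⟩ : C(S1, V)) ⟨mode j b, CInf.continuous _⟩ }
      exact (map_sum L w Finset.univ).symm
    simp only [hv, h3, h4]
    congr 2
    rw [← e.sum_repr' (coef f q.2), map_sum]
    simp only [map_smul, e.sum_repr']
  · have hs : Summable fun n => (inner ℂ (u n) (v n) : ℂ) :=
      hsum.of_norm_bounded fun n => norm_inner_le_norm _ _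
    have h1 := hs.hasSum.prod_fiberwise fun q => hasSum_fintype _
    rw [← h1.tsum_eq]
    -- Modes of different frequency are orthogonal, so only the diagonal blocks contribute.
    have h2 : ∀ q : ℤ × ℤ, ∑ a, (inner ℂ (u (q, a)) (v (q, a)) : ℂ) =
        if q.2 = q.1 then fibreTrace V (M q.1 q.2) else 0 := by
      intro q
      rw [fibreTrace_eq_sum_inner]
      simp only [hv, hinner, coef_mode]
      split_ifs
      · rfl
      · simp
    simp only [h2]
    have hinj : Function.Injective fun k : ℤ => (k, k) := fun a b h => (Prod.ext_iff.1 h).1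
    rw [← hinj.tsum_eq (f := fun q : ℤ × ℤ => if q.2 = q.1 then fibreTrace V (M q.1 q.2) else 0)]
    · simp
    · intro q hq
      by_contra h
      refine hq (if_neg fun h' => h ⟨q.1, Prod.ext rfl h'.symm⟩)

theorem hasTrace_and_tr_eq (hM : Rapid M) (hA : HasMatrix A M) :
    HasTrace A ∧ tr A = ∑' k, fibreTrace V (M k k) := by
  obtain ⟨T, u, v, hT, hs, hTx, htr⟩ := exists_nuclear_extension hM hA
  have h : tr A = ∑' k, fibreTrace V (M k k) := by
    rw [tr_eq_trace hT, ← htr]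
    exact (hasSum_inner_apply_of_nuclear hs hTx _).tsum_eq
  refine ⟨⟨T, hT, isTraceClass_of_nuclear hs hTx, fun ι b => ?_⟩, h⟩
  rw [h, ← htr]
  exact hasSum_inner_apply_of_nuclear hs hTx b

theorem Rapid.summable_fibreTrace (hM : Rapid M) : Summable fun k => fibreTrace V (M k k) := by
  have hinj : Function.Injective fun k : ℤ => (k, k) := fun a b h => (Prod.ext_iff.1 h).1
  refine ((hM.summable_norm.comp_injective hinj).mul_left ‖fibreTrace V‖).of_norm_bounded
    fun k => ?_
  exact (fibreTrace V).le_opNorm _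

/-- Both sides sum `tr (M j r * N r j)`, in different orders; the decay of `M` against the growth of
`N` gives absolute convergence. -/
theorem tsum_fibreTrace_matMul_comm (hM : Rapid M) (hN : Tempered N) :
    ∑' k, fibreTrace V (matMul M N k k) = ∑' k, fibreTrace V (matMul N M k k) := by
  set g : ℤ × ℤ → ℂ := fun q => fibreTrace V (M q.1 q.2 * N q.2 q.1) with hg
  have h1 : ∀ j, HasSum (fun r => g (j, r)) (fibreTrace V (matMul M N j j)) := fun j =>
    (fibreTrace V).hasSum (hM.tempered.summable_mul hN j j).hasSum
  have h2 : ∀ r, HasSum (fun j => g (j, r)) (fibreTrace V (matMul N M r r)) := fun r => by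
    have h3 := (fibreTrace V).hasSum (hN.summable_mul hM.tempered r r).hasSum
    simp only [hg]
    simp only [fibreTrace_mul_comm (M _ r)]
    exact h3
  have h4 : Summable g := by
    obtain ⟨C, n, hC0, hC⟩ := hN.norm_le
    refine ((hM.summable n).mul_left (‖fibreTrace V‖ * C)).of_norm_bounded fun q => ?_
    have hw1 := wt_pos q.1
    have hw2 := one_le_pow₀ (one_le_wt q.2) (n := n)
    calc ‖g q‖ ≤ ‖fibreTrace V‖ * (‖M q.1 q.2‖ * ‖N q.2 q.1‖) :=
          ((fibreTrace V).le_opNorm _).trans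
            (mul_le_mul_of_nonneg_left (norm_mul_le _ _) (norm_nonneg _))
      _ ≤ ‖fibreTrace V‖ * ((wt q.2 ^ n * ‖M q.1 q.2‖) * (C * wt q.1 ^ n)) := by
          have h5 := hC q.2 q.1
          have h6 : ‖M q.1 q.2‖ ≤ wt q.2 ^ n * ‖M q.1 q.2‖ :=
            le_mul_of_one_le_left (norm_nonneg _) hw2
          gcongr
      _ = _ := by ring
  have h5 : Summable fun j => fibreTrace V (matMul M N j j) :=
    (h4.hasSum.prod_fiberwise h1).summable
  exact (hasSum_swap h4 h1 h2 h5.hasSum).tsum_eq.symm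

theorem tr_mul_comm (hA : A ∈ rapidOps V) (hB : IsPDO B) : tr (A * B) = tr (B * A) := by
  obtain ⟨M, hM, hA⟩ := hA
  obtain ⟨N, hN, hB⟩ := hB.exists_tempered
  rw [(hasTrace_and_tr_eq (hM.matMul_tempered hN) (hA.mul hB hM.tempered hN)).2,
    (hasTrace_and_tr_eq (hN.matMul_rapid hM) (hB.mul hA hN hM.tempered)).2]
  exact tsum_fibreTrace_matMul_comm hM hN

variable (V) in
/-- The trace, as a linear form on the operators with rapidly decreasing matrix. -/
def rapidTrace : rapidOps V →ₗ[ℂ] ℂ where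
  toFun A := tr (A : Op V)
  map_add' := by
    rintro ⟨A, M, hM, hA⟩ ⟨B, N, hN, hB⟩
    change tr (A + B) = tr A + tr B
    rw [(hasTrace_and_tr_eq hM hA).2, (hasTrace_and_tr_eq hN hB).2,
      (hasTrace_and_tr_eq (hM.add hN) (hA.add hB)).2,
      ← hM.summable_fibreTrace.tsum_add hN.summable_fibreTrace]
    exact tsum_congr fun k => map_add _ _ _
  map_smul' := by
    rintro c ⟨A, M, hM, hA⟩
    change tr (c • A) = c • tr A
    rw [(hasTrace_and_tr_eq hM hA).2, (hasTrace_and_tr_eq (hM.smul c) (hA.smul c)).2,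
      ← hM.summable_fibreTrace.tsum_const_smul c]
    exact tsum_congr fun k => (fibreTrace V).map_smul c (M k k)

-- The function `tr` has a default value on operators without a bounded extension, so linearity is
-- available on `rapidOps V` only. An arbitrary linear extension gives an alternating form on all of
-- `Op V`; its values elsewhere do not affect the result.
variable (V) in
theorem exists_linear_tr : ∃ τ : Op V →ₗ[ℂ] ℂ, ∀ A ∈ rapidOps V, τ A = tr A := by
  obtain ⟨τ, hτ⟩ := LinearMap.exists_extend (rapidTrace V)
  exact ⟨τ, fun A hA => LinearMap.congr_fun hτ ⟨A, hA⟩⟩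

theorem curvProd_eq_pairProd {k : ℕ} (x : Fin (2 * k) → Op V) :
    curvProd k x = pairProd (fun _ => curv) x := rfl

theorem curvProd_mem {k : ℕ} (hk : 1 ≤ k) {x : Fin (2 * k) → Op V} (hx : ∀ i, IsPDO (x i)) :
    curvProd k x ∈ rapidOps V :=
  pairProd_mem_rapidOps hk (fun _ _ _ => curv_mem) hx

theorem isSmoothing_of_mem (hA : A ∈ rapidOps V) : IsSmoothing A := by
  obtain ⟨M, hM, hA⟩ := hA
  exact hM.isSmoothing hA

theorem hasTrace_of_mem (hA : A ∈ rapidOps V) : HasTrace A := by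
  obtain ⟨M, hM, hA⟩ := hA
  exact (hasTrace_and_tr_eq hM hA).1

variable (V) in
/-- The curvature as a bilinear map. -/
def curvBilinear : Op V →ₗ[ℂ] Op V →ₗ[ℂ] Op V :=
  LinearMap.mk₂ ℂ curv
    (fun a b c => by simp only [curv_eq_halfCurv, halfCurv, add_mul, mul_add]; abel)
    (fun s a b => by simp only [curv_eq_halfCurv, halfCurv, smul_mul_assoc, mul_smul_comm, smul_sub])
    (fun a b c => by simp only [curv_eq_halfCurv, halfCurv, add_mul, mul_add]; abel)
    (fun s a b => by simp only [curv_eq_halfCurv, halfCurv, smul_mul_assoc, mul_smul_comm, smul_sub])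

/-- The Chern-Weil form, defined on all operators by means of a linear extension `τ` of the
trace. -/
def chernWeilForm (τ : Op V →ₗ[ℂ] ℂ) (k : ℕ) : Op V [⋀^Fin (2 * k)]→ₗ[ℂ] ℂ :=
  ((2 * k).factorial : ℂ)⁻¹ •
    MultilinearMap.alternatization (τ.compMultilinearMap (pairProdMultilinear k (curvBilinear V)))

theorem chernWeilForm_apply (τ : Op V →ₗ[ℂ] ℂ) (k : ℕ) (x : Fin (2 * k) → Op V) :
    chernWeilForm τ k x = ((2 * k).factorial : ℂ)⁻¹ * ∑ s : Equiv.Perm (Fin (2 * k)),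
      ((Equiv.Perm.sign s : ℤ) : ℂ) * τ (curvProd k (x ∘ s)) := by
  rw [chernWeilForm, AlternatingMap.smul_apply, MultilinearMap.alternatization_apply, smul_eq_mul]
  congr 1
  refine Finset.sum_congr rfl fun s _ => ?_
  rw [Units.smul_def, zsmul_eq_mul]
  rfl

theorem ceDiff_chernWeilForm (τ : Op V →ₗ[ℂ] ℂ) (hτ : ∀ A ∈ rapidOps V, τ A = tr A) {k : ℕ}
    (hk : 1 ≤ k) {x : Fin (2 * k + 1) → Op V} (hx : ∀ i, IsPDO (x i)) :
    ceDiff (chernWeilForm τ k) x = 0 := by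
  refine ceDiff_eq_zero_of_trace τ (pPos V) ((2 * k).factorial : ℂ)⁻¹ (chernWeilForm τ k)
    (fun z => ?_) x fun t j => ?_
  · rw [chernWeilForm_apply]
    simp only [curvProd_eq_pairProd, ← curv_eq_halfCurv]
  · have h1 : pairProd (fun _ => halfCurv (pPos V)) ((x ∘ t) ∘ Fin.succ) ∈ rapidOps V :=
      pairProd_mem_rapidOps hk (fun _ _ _ => halfCurv_pPos_mem) fun i => hx _
    have h2 : IsPDO (x j * pPos V) := (hx j).mul isPDO_pPos
    rw [hτ _ (mul_mem_rapidOps_right h2 h1), hτ _ (mul_mem_rapidOps_left h1 h2),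
      tr_mul_comm h1 h2]

end OperatorTrace

end PDOCocycle
end

noncomputable section

namespace PDOCocycle

/-- Naturality of the coboundary under Lie algebra morphisms, needed for the inclusion of a Lie
subalgebra. -/
theorem ceDiff_compLinearMap {L L' : Type*} [LieRing L] [LieAlgebra ℂ L] [LieRing L']
    [LieAlgebra ℂ L'] {n : ℕ} (c : L' [⋀^Fin n]→ₗ[ℂ] ℂ) (f : L →ₗ⁅ℂ⁆ L') (x : Fin (n + 1) → L) :
    ceDiff (c.compLinearMap (f : L →ₗ[ℂ] L')) x = ceDiff c (f ∘ x) := by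
  unfold ceDiff
  refine Finset.sum_congr rfl fun j _ => Finset.sum_congr rfl fun i _ => ?_
  rw [AlternatingMap.compLinearMap_apply]
  congr 2
  funext l
  have h := congrFun (Function.comp_update f x i ⁅x i, x j⁆) (j.succAbove l)
  rw [f.map_lie] at h
  exact h

end PDOCocycle
end

theorem mainTheorem1 (V : Type*) [NormedAddCommGroup V] [InnerProductSpace ℂ V]
    [FiniteDimensional ℂ V] :
    -- `PDO(S¹, V)` is an algebra, hence a Lie algebra, and `θ` acts on it
    (∃ P : Subalgebra ℂ (Op V), (∀ A : Op V, A ∈ P ↔ IsPDO A) ∧ pPos V ∈ P) ∧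
    -- the curvature acts by composition on the left with a smoothing operator
    (∀ a b : Op V, IsPDO a → IsPDO b →
      IsSmoothing (curv a b) ∧ ∀ c : Op V, Omega a b c = curv a b * c) ∧
    ∀ k : ℕ, 1 ≤ k →
      -- the operators whose trace is taken are smoothing and trace class
      (∀ x : Fin (2 * k) → Op V, (∀ i, IsPDO (x i)) →
        IsSmoothing (curvProd k x) ∧ HasTrace (curvProd k x)) ∧
      -- `tr (Ω^k)` is a `2k`-cocycle on every Lie subalgebra, in particular on `PDO(S¹, V)` itself
      ∀ 𝒜 : LieSubalgebra ℂ (Op V), (∀ a ∈ 𝒜, IsPDO a) →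
        ∃ φ : 𝒜 [⋀^Fin (2 * k)]→ₗ[ℂ] ℂ,
          (∀ x : Fin (2 * k) → 𝒜, φ x = trOmegaPow k (fun i => (x i : Op V))) ∧
          ∀ x : Fin (2 * k + 1) → 𝒜, ceDiff φ x = 0 := by
  refine ⟨⟨pdoAlgebra V, fun _ => Iff.rfl, isPDO_pPos⟩, fun a b ha hb =>
    ⟨isSmoothing_of_mem (curv_mem ha hb), Omega_eq_curv_mul a b⟩, fun k hk =>
    ⟨fun x hx => ⟨isSmoothing_of_mem (curvProd_mem hk hx), hasTrace_of_mem (curvProd_mem hk hx)⟩,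
      fun 𝒜 h𝒜 => ?_⟩⟩
  obtain ⟨τ, hτ⟩ := exists_linear_tr V
  refine ⟨(chernWeilForm τ k).compLinearMap (𝒜.incl : 𝒜 →ₗ[ℂ] Op V), fun x => ?_, fun x => ?_⟩
  · have hx : ∀ i, IsPDO (x i : Op V) := fun i => h𝒜 _ (x i).2
    rw [AlternatingMap.compLinearMap_apply, chernWeilForm_apply, trOmegaPow]
    congr 1
    refine Finset.sum_congr rfl fun s _ => congrArg _ ?_
    -- On `𝒜` the form evaluates `τ` only at products of curvatures, where it is the trace.
    exact hτ _ (curvProd_mem hk fun i => hx (s i))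
  · rw [ceDiff_compLinearMap]
    exact ceDiff_chernWeilForm τ hτ hk fun i => h𝒜 _ (x i).2
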